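/- Let $\Omega=(0,L)^3$ with periodic boundary conditions, $L>0$, $\nu>0$ and $l\ge 5/4$. Let $V_0$ be the space of real periodic divergence-free fields in $L^2(\Omega)^3$ with zero average, with the $L^2$ norm $\|\cdot\|$; let $A=-\Delta$ be the Stokes operator, $\|u\|_s=\|A^{s/2}u\|$, $V_s=D(A^{s/2})\subset V_0$, $\lambda_1=(2\pi/L)^2$, and $b(u,v,w)=\sum_{i,j}\int_\Omega u_i\,\partial_i v_j\,w_j\,dx$. Let $X^0$ be the space of weakly continuous $u:[0,\infty)\to V_0$ with $u\in L^\infty(0,\infty;V_0)\cap L^2_{loc}[0,\infty;V_1)$, with convergence in $L^\infty(0,T;V_0)\cap L^2(0,T;V_1)$ for every $T$. For $\varepsilon\ge0$ and a time-independent force $f\in L^2(\Omega)^3$ (on time-independent forces the $L^\infty C$-topology is that of the $L^2$ norm), a weak solution of $$\partial_t u+\varepsilon A^l u+\nu Au+B(u,u)=f$$ is a $u\in X^0$, with $u\in L^2_{loc}[0,\infty;V_l)$ if $\varepsilon>0$, such that for all $0\le t_0\le t$ and all $v\in V_1$ ($v\in V_l$ if $\varepsilon>0$) $$\langle u(t)-u(t_0),v\rangle+\varepsilon\int_{t_0}^t\langle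 A^{l/2}u,A^{l/2}v\rangle ds+\nu\int_{t_0}^t\langle A^{1/2}u,A^{1/2}v\rangle ds+\int_{t_0}^t b(u,u,v)\,ds=\int_{t_0}^t\langle f,v\rangle ds,$$ and such that for almost every $t_0>0$ and all $t\ge t_0$ $$\|u(t)\|^2+2\varepsilon\int_{t_0}^t\|A^{l/2}u\|^2ds+2\nu\int_{t_0}^t\|A^{1/2}u\|^2ds\le\|u(t_0)\|^2+2\int_{t_0}^t\langle f,u\rangle ds .$$ Write $u\in B_R$ if $\|u(t)\|_1\le R$ for all $t\ge0$; $R=\infty$ means no restriction. Let $M^\varepsilon_R\subset L^2\times V_0$ (norm topology) be the set of pairs $(f,\varphi)$ for which there is a weak solution $u\in B_R$ with force $f$ and $u(0)=\varphi$. 1. (Semiflow.) Let $\varepsilon\ge0$ and $R\in[0,\infty]$, where $R=\infty$ is allowed only if $\varepsilon>0$. There is a semiflow $\pi^\varepsilon(t)(f,\varphi)=(f,S^\varepsilon(f,t)\varphi)$ on $M^\varepsilon_R$ (identity at $t=0$, semigroup property, joint continuity), also continuous at $t=0$, such that $S^\varepsilon(f,t)u(0)=u(t)$ for all $t\ge0$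 and every weak solution $u\in B_R$ with force $f$. 2. (Continuous family.) Let $\varepsilon_n,\varepsilon_0\ge0$ and $R\in[0,\infty]$, where $R=\infty$ is allowed only if $\varepsilon_0>0$. Let $u^n,u^0\in B_R$ be weak solutions with parameters $\varepsilon_n,\varepsilon_0$ and forces $f^n,f^0$. If $\varepsilon_n\to\varepsilon_0$, $f^n\to f^0$ in $L^2$ and $u^n(0)\to u^0(0)$ in $V_0$, then $u^n\to u^0$ in $X^0$; in particular $S^{\varepsilon_n}(f^n,t)\varphi^n\to S^{\varepsilon_0}(f^0,t)\varphi^0$ in $V_0$ uniformly for $t$ in compact subsets of $[0,\infty)$, where $\varphi^n=u^n(0)$ and $\varphi^0=u^0(0)$. 3. (Gronwall bound.) There is an absolute constant $c>0$ such that the following holds for all $L,\nu,l$ as above. Let $R\in[0,\infty)$, $\varepsilon,\varepsilon'\ge0$ with $\varepsilon>0$ or $\varepsilon=\varepsilon'$, and let $u,u'\in B_R$ be weak solutions with parameters $\varepsilon,\varepsilon'$ and forces $f,f'$. Then for all $0\le t\le T$ $$\|u(t)-u'(t)\|^2\le e^{cR^4T/\nu^3}\Big(\|u(0)-u'(0)\|^2+\frac{2T}{\nu\lambda_1}\|f-f'\|^2+\frac{(\varepsilon-\varepsilon')^2}{2\varepsilon}\int_0^T\|u'(s)\|_l^2\,ds\Big),$$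 where the last term is absent if $\varepsilon=\varepsilon'$ (and may be $+\infty$ otherwise). -/

import Mathlib

open MeasureTheory Filter Topology Set
open scoped ENNReal NNReal

noncomputable section

namespace PeriodicNS

/-- The periodic box `(0, L)³`, that is, the torus `(ℝ / Lℤ)³`, of total volume `L ^ 3`. -/
abbrev Box (L : ℝ) : Type := Fin 3 → AddCircle L

section Spaces

variable {L : ℝ} [Fact (0 < L)]

variable (L) in
/-- The Hilbert space `L²(Ω)³` of real periodic square integrable vector fields. -/
abbrev L2Field : Type := Lp (EuclideanSpace ℝ (Fin 3)) 2 (volume : Measure (Box L))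

/-- The character `x ↦ exp (2 π i k · x / L)`. -/
def character (k : Fin 3 → ℤ) (x : Box L) : ℂ := ∏ i, fourier (k i) (x i)

/-- The `k`-th Fourier coefficient `L⁻³ ∫ g(x) exp (- 2 π i k · x / L) dx`. -/
def scalarCoeff (g : Box L → ℝ) (k : Fin 3 → ℤ) : ℂ :=
  ((L ^ 3)⁻¹ : ℝ) * ∫ x, character (-k) x * (g x : ℂ)

/-- The `k`-th Fourier coefficient of the `j`-th component of a vector field. -/
def coeff (u : L2Field L) (k : Fin 3 → ℤ) (j : Fin 3) : ℂ := scalarCoeff (fun x => u x j) k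

/-- `V₀`: the fields in `L²` with zero average and zero (distributional) divergence. -/
def V₀ (L : ℝ) [Fact (0 < L)] : Set (L2Field L) :=
  {u | (∀ j, coeff u 0 j = 0) ∧ ∀ k : Fin 3 → ℤ, ∑ j, (k j : ℂ) * coeff u k j = 0}

/-- The eigenvalue `|2 π k / L|²` of `A = -Δ` on the `k`-th Fourier mode. -/
def eigenvalue (L : ℝ) (k : Fin 3 → ℤ) : ℝ := ∑ i, (2 * Real.pi * (k i : ℝ) / L) ^ 2

/-- `‖u‖ₛ² = ‖A ^ (s / 2) u‖²`, with value `∞` outside the domain of `A ^ (s / 2)`.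
In particular `‖u‖₁ = ‖∇ u‖`. -/
def sobSq (s : ℝ) (u : L2Field L) : ℝ≥0∞ :=
  ∑' k : Fin 3 → ℤ, ENNReal.ofReal (L ^ 3 * eigenvalue L k ^ s * ∑ j, ‖coeff u k j‖ ^ 2)

/-- `V_s`, the domain of `A ^ (s / 2)` in `V₀`. -/
def V (L : ℝ) [Fact (0 < L)] (s : ℝ) : Set (L2Field L) := {u | u ∈ V₀ L ∧ sobSq s u < ∞}

/-- The inner product `(A ^ (s / 2) u, A ^ (s / 2) v)`, meant for `u, v ∈ V_s`. -/
def powForm (s : ℝ) (u v : L2Field L) : ℝ :=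
  ∑' k : Fin 3 → ℤ, L ^ 3 * eigenvalue L k ^ s *
    ∑ j, (coeff u k j * (starRingEnd ℂ) (coeff v k j)).re

open Classical in
/-- The weak derivative `∂ᵢ vⱼ` in `L²`: the function whose Fourier coefficients are those of `vⱼ`
multiplied by `2 π i kᵢ / L`. It exists for `v ∈ V₁`; elsewhere the value may be the default `0`. -/
def weakDeriv (i j : Fin 3) (v : L2Field L) : Lp ℝ 2 (volume : Measure (Box L)) :=
  if h : ∃ g : Lp ℝ 2 (volume : Measure (Box L)), ∀ k : Fin 3 → ℤ,
      scalarCoeff g k = (2 * Real.pi * Complex.I * (k i : ℂ) / (L : ℂ)) * coeff v k j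
  then h.choose else 0

/-- The trilinear form `b(u, v, w) = ∑ᵢⱼ ∫ uᵢ (∂ᵢ vⱼ) wⱼ dx`. -/
def trilinear (u v w : L2Field L) : ℝ :=
  ∑ i, ∑ j, ∫ x, u x i * weakDeriv i j v x * w x j

/-- Membership in `X⁰ = L^∞(0, ∞; V₀) ∩ L²_loc[0, ∞; V₁)`, with weak continuity on `[0, ∞)`
into `V₀` (only the restriction of `u` to `[0, ∞)` matters). -/
structure MemX0 (u : ℝ → L2Field L) : Prop where
  mem : ∀ t, 0 ≤ t → u t ∈ V₀ L
  bounded : ∃ C : ℝ, ∀ t, 0 ≤ t → ‖u t‖ ≤ C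
  weakly_continuous : ∀ v ∈ V₀ L, ContinuousOn (fun t => inner ℝ (u t) v) (Ici 0)
  locally_square_integrable : ∀ T : ℝ, ∫⁻ s in Icc 0 T, sobSq 1 (u s) < ∞

/-- Convergence in `X⁰`: in `L^∞(0, T; V₀)` and in `L²(0, T; V₁)` for every `T`. -/
def TendstoX0 (u : ℕ → ℝ → L2Field L) (u₀ : ℝ → L2Field L) : Prop :=
  ∀ T : ℝ, TendstoUniformlyOn u u₀ atTop (Icc 0 T) ∧
    Tendsto (fun n => ∫⁻ s in Icc 0 T, sobSq 1 (u n s - u₀ s)) atTop (𝓝 0)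

/-- `u` is a (Leray-Hopf) weak solution on `[0, ∞)` of
`∂ₜ u + ε A ^ l u + ν A u + B(u, u) = f` with the time independent force `f ∈ L²`.
For `ε = 0` this is the Navier-Stokes system, tested against `V₁`; the membership of `du/dt` in
`L^{4/3}_loc(0, ∞; V₁')` is then a consequence of `equation`. For `ε > 0` the solution lies in
addition in `L²_loc[0, ∞; V_l)`, and the test fields are those of `V_l`. -/
structure IsWeakSolution (ν l ε : ℝ) (f : L2Field L) (u : ℝ → L2Field L) : Prop where
  memX0 : MemX0 u
  regular : 0 < ε → ∀ T : ℝ, ∫⁻ s in Icc 0 T, sobSq l (u s) < ∞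
  equation : ∀ v ∈ V L 1, (0 < ε → v ∈ V L l) → ∀ t₀ t : ℝ, 0 ≤ t₀ → t₀ ≤ t →
    inner ℝ (u t - u t₀) v + ε * (∫ s in t₀..t, powForm l (u s) v)
        + ν * (∫ s in t₀..t, powForm 1 (u s) v) + (∫ s in t₀..t, trilinear (u s) (u s) v)
      = ∫ _s in t₀..t, inner ℝ f v
  energy : ∀ᵐ t₀ ∂(volume.restrict (Ioi (0 : ℝ))), ∀ t, t₀ ≤ t →
    ‖u t‖ ^ 2 + 2 * ε * (∫ s in t₀..t, (sobSq l (u s)).toReal)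
        + 2 * ν * (∫ s in t₀..t, (sobSq 1 (u s)).toReal)
      ≤ ‖u t₀‖ ^ 2 + 2 * ∫ s in t₀..t, inner ℝ f (u s)

/-- The trajectory `u` stays in the `V₁`-ball of radius `R`; no restriction if `R = ∞`. -/
def InBall (R : ℝ≥0∞) (u : ℝ → L2Field L) : Prop := ∀ t, 0 ≤ t → sobSq 1 (u t) ≤ R ^ 2

/-- The pairs `(f, φ)` of a force and an initial datum from which there starts a weak solution
that stays in the `V₁`-ball of radius `R`; a subspace of `L² × V₀` with the norm topology. -/
def phaseSpace (L : ℝ) [Fact (0 < L)] (ν l ε : ℝ) (R : ℝ≥0∞) : Set (L2Field L × L2Field L) :=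
  {p | ∃ u, IsWeakSolution ν l ε p.1 u ∧ InBall R u ∧ u 0 = p.2}

end Spaces

/-- A semiflow on `M`: identity at time `0`, semigroup property, continuity on `M × (0, ∞)`. -/
structure IsSemiflow {M : Type*} [TopologicalSpace M] (σ : M → ℝ≥0 → M) : Prop where
  zero : ∀ w, σ w 0 = w
  add : ∀ w s t, σ (σ w s) t = σ w (s + t)
  continuousOn : ContinuousOn (fun p : M × ℝ≥0 => σ p.1 p.2) {p | 0 < p.2}

end PeriodicNS

end

noncomputable section

namespace PeriodicNS

/-! ### Fourier series on the periodic box -/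

section Fourier

open Submodule
open scoped ComplexConjugate

variable {L : ℝ}

/-! Everything rests on one computation in Fourier variables: the energy balance of the difference w
= u - u' of two solutions, projected by P_N = `trunc (box N)` onto finitely many modes. The equation
may be tested against fields with frequencies in a finite set, so the coordinates of P_N w are
absolutely continuous in time and `energy_identity` is exact. Incompressibility gives b(u, P_N w,
P_N w) = 0. Hence the difference of the nonlinear terms is b(u, w - P_N w, P_N w) + b(w, u', P_N w)
(`tri_difference`): a cutoff error and the term that drives Gronwall's inequality. The form b is
controlled by convolution sums over the lattice (`conv_le`), which give |b(u, v, w)| ≤ ‖u‖_s ‖v‖_1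
‖w‖_{3/2-s} for 1/4 ≤ s ≤ 5/4, and variants, with constant 1 for every L.

In a ball of V_1, |b(w, u', w)| ≤ R ‖w‖_{1/2} ‖w‖_1 ≤ R ‖w‖^{1/2} ‖w‖_1^{3/2}. The viscosity νA
absorbs this and leaves 2R⁴/ν³ ‖w‖² in the inequality for ‖w‖², while the cutoff error is of order
R³ N^{-1/2}. Letting N → ∞ gives the Gronwall bound (`gronwall_bound`). For ε_n → ε_0 with ε_0
possibly zero, no uniform V_l bound is available. The mismatch of the viscosities is then estimated
at fixed N, where it vanishes as n → ∞, and the modes beyond N are small uniformly in n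
(`tail_ball`, `tendstoX0_of_ball`).

Without a ball, ε_0 > 0 and l ≥ 5/4 take over. Now b is bounded by two V_{5/4} norms, each square
integrable in time, and one L² norm. The term εA^l absorbs one V_{5/4} factor, the Gronwall
coefficient 1 + C ‖u'‖_l²/ε is integrable in time, and the cutoff error disappears by dominated
convergence (`viscous_gronwall`, `tendstoX0_of_pos`).

Continuous dependence along a constant sequence is uniqueness. Together with strong continuity in
time (uniform convergence of the truncations in a ball, the energy equality for ε > 0) it yields the
jointly continuous flow, and translation in time yields the semigroup law. -/

lemma character_add (k l : Fin 3 → ℤ) (x : Box L) :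
    character (k + l) x = character k x * character l x := by
  simp only [character, Pi.add_apply, fourier_add, Finset.prod_mul_distrib]

lemma character_neg (k : Fin 3 → ℤ) (x : Box L) : character (-k) x = conj (character k x) := by
  simp only [character, Pi.neg_apply, fourier_neg, map_prod]

lemma character_zero (x : Box L) : character 0 x = 1 := by
  simp only [character, Pi.zero_apply, fourier_zero, Finset.prod_const_one]

lemma continuous_character (k : Fin 3 → ℤ) : Continuous (character k : Box L → ℂ) := by
  unfold character; fun_prop

lemma norm_character (k : Fin 3 → ℤ) (x : Box L) : ‖character k x‖ = 1 := by
  simp [character, norm_prod, Circle.norm_coe]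

lemma character_single (z : Box L) (i : Fin 3) :
    character (Pi.single i 1) z = fourier 1 (z i) := by
  rw [character, Finset.prod_eq_single i]
  · simp
  · intro j _ hj
    simp [Pi.single_eq_of_ne hj]
  · simp

/-- The character as a continuous map. -/
def characterMap (L : ℝ) (k : Fin 3 → ℤ) : C(Box L, ℂ) := ⟨character k, continuous_character k⟩

/-- The star subalgebra of trigonometric polynomials. -/
def trigSubalgebra (L : ℝ) : StarSubalgebra ℂ C(Box L, ℂ) where
  toSubalgebra := Algebra.adjoin ℂ (range (characterMap L))
  star_mem' := by
    change Algebra.adjoin ℂ (range (characterMap L)) ≤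
      star (Algebra.adjoin ℂ (range (characterMap L)))
    refine Algebra.adjoin_le ?_
    rintro _ ⟨n, rfl⟩
    refine Algebra.subset_adjoin ⟨-n, ?_⟩
    ext1 x
    simp only [characterMap, character_neg, starRingEnd_apply, ContinuousMap.star_apply,
      ContinuousMap.coe_mk]

/-- The characters contain 1 and are closed under multiplication, so the algebra they generate is
already their linear span. -/
lemma trigSubalgebra_coe :
    Subalgebra.toSubmodule (trigSubalgebra L).toSubalgebra = span ℂ (range (characterMap L)) := by
  apply Algebra.adjoin_eq_span_of_subset
  refine .trans (fun x ↦ Submonoid.closure_induction (fun _ ↦ id) ⟨0, ?_⟩ ?_) subset_span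
  · ext z
    simp [characterMap, character_zero]
  · rintro _ _ _ _ ⟨m, rfl⟩ ⟨n, rfl⟩
    refine ⟨m + n, ?_⟩
    ext z
    simp [characterMap, character_add]

variable [hL : Fact (0 < L)]

/-- Two distinct points differ in some coordinate `i`, and the character of the `i`-th unit mode is
the injective map of that circle onto the unit circle. -/
lemma trigSubalgebra_separatesPoints : (trigSubalgebra L).SeparatesPoints := by
  intro x y hxy
  rw [Ne, funext_iff, not_forall] at hxy
  obtain ⟨i, hi⟩ := hxy
  refine ⟨_, ⟨characterMap L (Pi.single i 1), Algebra.subset_adjoin ⟨Pi.single i 1, rfl⟩, rfl⟩, ?_⟩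
  change character _ x ≠ character _ y
  rw [character_single, character_single, fourier_one, fourier_one]
  contrapose hi
  exact AddCircle.injective_toCircle hL.out.ne' (Circle.ext hi)

lemma span_characterMap_closure_eq_top :
    (span ℂ (range (characterMap L))).topologicalClosure = ⊤ := by
  rw [← trigSubalgebra_coe]
  exact congr_arg (Subalgebra.toSubmodule <| StarSubalgebra.toSubalgebra ·)
    (ContinuousMap.starSubalgebra_topologicalClosure_eq_top_of_separatesPoints _
      trigSubalgebra_separatesPoints)

lemma integral_fourier_addCircle (n : ℤ) :
    ∫ x : AddCircle L, fourier n x = if n = 0 then (L : ℂ) else 0 := by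
  have h := congr_fun (fourierCoeff_fourier (T := L) n) 0
  rw [fourierCoeff, AddCircle.integral_haarAddCircle] at h
  have hL' : (L : ℂ) ≠ 0 := by exact_mod_cast hL.out.ne'
  simp only [neg_zero, fourier_zero, one_smul] at h
  rw [Complex.real_smul, Complex.ofReal_inv, inv_mul_eq_iff_eq_mul₀ hL'] at h
  rw [h]
  by_cases hn : n = 0
  · subst hn; simp
  · rw [if_neg hn, Pi.single_eq_of_ne (Ne.symm hn), mul_zero]

lemma integral_character (k : Fin 3 → ℤ) :
    ∫ x : Box L, character k x = if k = 0 then (L : ℂ) ^ 3 else 0 := by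
  unfold character
  rw [integral_fintype_prod_volume_eq_prod (fun i (x : AddCircle L) => fourier (k i) x)]
  simp only [integral_fourier_addCircle]
  split_ifs with h
  · subst h; simp
  · obtain ⟨i, hi⟩ := Function.ne_iff.mp h
    exact Finset.prod_eq_zero (Finset.mem_univ i) (if_neg hi)

/-- The normalised characters in `L²`. -/
def characterLp (L : ℝ) [Fact (0 < L)] (k : Fin 3 → ℤ) : Lp ℂ 2 (volume : Measure (Box L)) :=
  (((Real.sqrt (L ^ 3))⁻¹ : ℝ) : ℂ) • ContinuousMap.toLp (E := ℂ) 2 volume ℂ (characterMap L k)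

lemma orthonormal_characterLp : Orthonormal ℂ (characterLp L) := by
  rw [orthonormal_iff_ite]
  intro m n
  have h3 : 0 < L ^ 3 := pow_pos hL.out 3
  rw [characterLp, characterLp, inner_smul_left, inner_smul_right, ContinuousMap.inner_toLp]
  have : ∀ x, characterMap L n x * conj (characterMap L m x) = character (n - m) x := by
    intro x
    simp only [characterMap, ContinuousMap.coe_mk, ← character_neg, ← character_add,
      sub_eq_add_neg]
  simp only [this, integral_character, sub_eq_zero]
  rw [Complex.conj_ofReal, ← mul_assoc, ← Complex.ofReal_mul, ← mul_inv,
    Real.mul_self_sqrt h3.le]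
  by_cases h : m = n
  · rw [if_pos h.symm, if_pos h, ← Complex.ofReal_pow, ← Complex.ofReal_mul,
      inv_mul_cancel₀ h3.ne', Complex.ofReal_one]
  · rw [if_neg (Ne.symm h), if_neg h, mul_zero]

lemma span_characterLp_closure_eq_top :
    (span ℂ (range (characterLp L))).topologicalClosure = ⊤ := by
  have h3 : 0 < L ^ 3 := pow_pos hL.out 3
  have h := (ContinuousMap.toLp_denseRange (p := 2) ℂ (volume : Measure (Box L)) ℂ
    (by simp)).topologicalClosure_map_submodule (span_characterMap_closure_eq_top (L := L))
  rw [← h]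
  congr 1
  rw [map_span, ← range_comp]
  apply le_antisymm
  · rw [span_le]
    rintro _ ⟨k, rfl⟩
    exact smul_mem _ _ (subset_span ⟨k, rfl⟩)
  · rw [span_le]
    rintro _ ⟨k, rfl⟩
    have hc : (((Real.sqrt (L ^ 3))⁻¹ : ℝ) : ℂ) ≠ 0 := by
      exact_mod_cast inv_ne_zero (Real.sqrt_ne_zero'.mpr h3)
    have : ContinuousMap.toLp (E := ℂ) 2 volume ℂ (characterMap L k) =
        (((Real.sqrt (L ^ 3))⁻¹ : ℝ) : ℂ)⁻¹ • characterLp L k := by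
      rw [characterLp, inv_smul_smul₀ hc]
    rw [SetLike.mem_coe, Function.comp_apply]
    erw [this]
    exact smul_mem _ _ (subset_span ⟨k, rfl⟩)

/-- The Hilbert basis of normalised characters. -/
def characterBasis (L : ℝ) [Fact (0 < L)] :
    HilbertBasis (Fin 3 → ℤ) ℂ (Lp ℂ 2 (volume : Measure (Box L))) :=
  HilbertBasis.mk orthonormal_characterLp span_characterLp_closure_eq_top.ge

/-- Fourier coefficients of a complex function. -/
def cCoeff (g : Box L → ℂ) (k : Fin 3 → ℤ) : ℂ :=
  ((L ^ 3)⁻¹ : ℝ) * ∫ x, character (-k) x * g x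

lemma cCoeff_ofReal (g : Box L → ℝ) (k : Fin 3 → ℤ) :
    cCoeff (fun x => (g x : ℂ)) k = scalarCoeff g k := rfl

lemma cCoeff_congr {g h : Box L → ℂ} (hgh : g =ᵐ[volume] h) (k : Fin 3 → ℤ) :
    cCoeff g k = cCoeff h k := by
  unfold cCoeff
  congr 1
  apply integral_congr_ae
  filter_upwards [hgh] with x hx
  rw [hx]

lemma scalarCoeff_congr {g h : Box L → ℝ} (hgh : g =ᵐ[volume] h) (k : Fin 3 → ℤ) :
    scalarCoeff g k = scalarCoeff h k := by
  rw [← cCoeff_ofReal, ← cCoeff_ofReal]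
  apply cCoeff_congr
  filter_upwards [hgh] with x hx
  rw [hx]

lemma characterBasis_repr (f : Lp ℂ 2 (volume : Measure (Box L))) (k : Fin 3 → ℤ) :
    (characterBasis L).repr f k = (Real.sqrt (L ^ 3) : ℂ) * cCoeff f k := by
  have h3 : 0 < L ^ 3 := pow_pos hL.out 3
  rw [(characterBasis L).repr_apply_apply f k, characterBasis, HilbertBasis.coe_mk, characterLp,
    inner_smul_left, Complex.conj_ofReal, L2.inner_def, cCoeff, ← mul_assoc, ← Complex.ofReal_mul]
  have e : (Real.sqrt (L ^ 3))⁻¹ = Real.sqrt (L ^ 3) * (L ^ 3)⁻¹ := by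
    have hs : Real.sqrt (L ^ 3) ≠ 0 := Real.sqrt_ne_zero'.mpr h3
    have := Real.mul_self_sqrt h3.le
    rw [eq_mul_inv_iff_mul_eq₀ h3.ne', inv_mul_eq_iff_eq_mul₀ hs, this]
  rw [e]
  congr 1
  apply integral_congr_ae
  filter_upwards [ContinuousMap.coeFn_toLp (p := 2) (𝕜 := ℂ) volume (characterMap L k)] with x hx
  rw [hx, RCLike.inner_apply, character_neg, mul_comm]
  rfl

lemma hasSum_cCoeff_mul (f g : Lp ℂ 2 (volume : Measure (Box L))) :
    HasSum (fun k => (L : ℂ) ^ 3 * (conj (cCoeff f k) * cCoeff g k))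
      (∫ x, conj (f x) * g x) := by
  have h3 : 0 < L ^ 3 := pow_pos hL.out 3
  have h := (characterBasis L).hasSum_inner_mul_inner f g
  have e : (inner ℂ f g : ℂ) = ∫ x, conj (f x) * g x := by
    rw [L2.inner_def]
    congr 1; ext x
    rw [RCLike.inner_apply, mul_comm]
  rw [e] at h
  convert! h using 2 with k
  rw [← (characterBasis L).repr_apply_apply g k, ← inner_conj_symm f,
    ← (characterBasis L).repr_apply_apply f k, characterBasis_repr, characterBasis_repr, map_mul,
    Complex.conj_ofReal]
  have := Real.mul_self_sqrt h3.le
  have h' : (Real.sqrt (L ^ 3) : ℂ) * (Real.sqrt (L ^ 3) : ℂ) = (L : ℂ) ^ 3 := by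
    rw [← Complex.ofReal_mul, this, Complex.ofReal_pow]
  rw [← h']; ring

lemma cCoeff_character_mul (g : Box L → ℂ) (k l : Fin 3 → ℤ) :
    cCoeff (fun x => character l x * g x) k = cCoeff g (k - l) := by
  unfold cCoeff
  congr 2; ext x
  rw [← mul_assoc, ← character_add]
  congr 2; abel

/-- Parseval's identity with a shift. -/
lemma hasSum_scalarCoeff_mul {g h : Box L → ℝ} (hg : MemLp g 2) (hh : MemLp h 2)
    (l : Fin 3 → ℤ) :
    HasSum (fun k => (L : ℂ) ^ 3 * (conj (scalarCoeff g k) * scalarCoeff h (k - l)))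
      (∫ x, character l x * ((g x : ℂ) * (h x : ℂ))) := by
  have hgc : MemLp (fun x => (g x : ℂ)) 2 := hg.ofReal
  have hhc : MemLp (fun x => character l x * (h x : ℂ)) 2 := by
    refine MemLp.of_le (g := h) hh ?_ (ae_of_all _ fun x => ?_)
    · exact (continuous_character l).aestronglyMeasurable.mul hh.ofReal.aestronglyMeasurable
    · rw [norm_mul, norm_character, one_mul, Complex.norm_real]
  -- The character is absorbed into `h`, where it only shifts the index of the coefficients.
  have := hasSum_cCoeff_mul (hgc.toLp _) (hhc.toLp _)
  have e : (∫ x, character l x * ((g x : ℂ) * (h x : ℂ))) =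
      ∫ x, conj (hgc.toLp _ x) * hhc.toLp _ x := by
    apply integral_congr_ae
    filter_upwards [hgc.coeFn_toLp, hhc.coeFn_toLp] with x h1 h2
    rw [h1, h2, Complex.conj_ofReal]; ring
  rw [e]
  convert! this using 2 with k
  rw [cCoeff_congr hgc.coeFn_toLp, cCoeff_congr hhc.coeFn_toLp, cCoeff_character_mul]
  rfl

lemma conj_scalarCoeff (g : Box L → ℝ) (k : Fin 3 → ℤ) :
    conj (scalarCoeff g k) = scalarCoeff g (-k) := by
  unfold scalarCoeff
  rw [map_mul, Complex.conj_ofReal, ← integral_conj]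
  congr 1
  refine integral_congr_ae (ae_of_all _ fun x => ?_)
  change conj _ = _
  rw [map_mul, Complex.conj_ofReal, neg_neg, character_neg, Complex.conj_conj]

lemma integrable_character_mul {g : Box L → ℝ} (hg : MemLp g 2) (k : Fin 3 → ℤ) :
    Integrable (fun x => character k x * (g x : ℂ)) := by
  have h1 : Integrable g := hg.integrable (by norm_num)
  exact h1.ofReal.bdd_mul (c := 1) (continuous_character k).aestronglyMeasurable
    (ae_of_all _ fun x => (norm_character k x).le)

lemma scalarCoeff_add {g h : Box L → ℝ} (hg : MemLp g 2) (hh : MemLp h 2) (k : Fin 3 → ℤ) :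
    scalarCoeff (fun x => g x + h x) k = scalarCoeff g k + scalarCoeff h k := by
  unfold scalarCoeff
  rw [← mul_add, ← integral_add (integrable_character_mul hg _) (integrable_character_mul hh _)]
  congr 1
  refine integral_congr_ae (ae_of_all _ fun x => ?_)
  dsimp only
  push_cast; ring

lemma scalarCoeff_const_mul (c : ℝ) (g : Box L → ℝ) (k : Fin 3 → ℤ) :
    scalarCoeff (fun x => c * g x) k = c * scalarCoeff g k := by
  unfold scalarCoeff
  rw [mul_left_comm, ← integral_const_mul (c : ℂ)]
  congr 1
  refine integral_congr_ae (ae_of_all _ fun x => ?_)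
  dsimp only
  push_cast; ring

/-- Riesz–Fischer for real functions. -/
lemma exists_scalarCoeff_eq {c : (Fin 3 → ℤ) → ℂ} (hc : ∀ k, c (-k) = conj (c k))
    (hs : Summable fun k => ‖c k‖ ^ 2) :
    ∃ g : Lp ℝ 2 (volume : Measure (Box L)), ∀ k, scalarCoeff g k = c k := by
  have h3 : 0 < L ^ 3 := pow_pos hL.out 3
  have hs0 : (Real.sqrt (L ^ 3) : ℂ) ≠ 0 := by exact_mod_cast Real.sqrt_ne_zero'.mpr h3
  have hm : Memℓp (fun k => (Real.sqrt (L ^ 3) : ℂ) * c k) 2 := by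
    apply memℓp_gen
    simp only [ENNReal.toReal_ofNat, Real.rpow_ofNat, norm_mul, mul_pow]
    exact hs.mul_left _
  set f := (characterBasis L).repr.symm ⟨_, hm⟩ with hf
  have hfc : ∀ k, cCoeff f k = c k := by
    intro k
    have := characterBasis_repr f k
    rw [hf, LinearIsometryEquiv.apply_symm_apply] at this
    exact (mul_left_cancel₀ hs0 this).symm
  have hfm : MemLp (fun x => f x) 2 := Lp.memLp f
  have hre : MemLp (fun x => (f x).re) 2 := hfm.re
  refine ⟨hre.toLp _, fun k => ?_⟩
  rw [scalarCoeff_congr hre.coeFn_toLp]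
  have hint : ∀ k, Integrable (fun x => character k x * f x) := fun k =>
    (hfm.integrable (by norm_num)).bdd_mul (c := 1) (continuous_character k).aestronglyMeasurable
      (ae_of_all _ fun x => (norm_character k x).le)
  have hint' : Integrable (fun x => character (-k) x * conj (f x)) := by
    have h0 : ∀ x, character (-k) x * conj (f x) = conj (character k x * f x) := fun x => by
      rw [map_mul, character_neg]
    simp only [h0]
    exact (Complex.conjCLE.toContinuousLinearMap.integrable_comp (hint k))
  have h2 : conj (cCoeff f (-k)) = ((L ^ 3)⁻¹ : ℝ) * ∫ x, character (-k) x * conj (f x) := by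
    unfold cCoeff
    rw [map_mul, Complex.conj_ofReal, ← integral_conj]
    congr 2; ext x
    rw [map_mul, neg_neg, character_neg]
  -- Passing to the real part averages the coefficient at `k` with the conjugate of the one at `-k`;
  -- by the symmetry `hc` both equal `c k`.
  have h1 : scalarCoeff (fun x => (f x).re) k = (cCoeff f k + conj (cCoeff f (-k))) / 2 := by
    rw [h2, cCoeff, ← mul_add, ← integral_add (hint _) hint', scalarCoeff, mul_div_assoc,
      ← integral_div]
    congr 2; ext x
    rw [← mul_add, Complex.add_conj]
    push_cast; ring
  rw [h1, hfc, hfc, hc, Complex.conj_conj]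
  ring

end Fourier

/-! ### Fourier coefficients of vector fields -/

section Fields

open scoped ComplexConjugate

variable {L : ℝ} [hL : Fact (0 < L)]

lemma memLp_component (u : L2Field L) (j : Fin 3) : MemLp (fun x => u x j) 2 :=
  (Lp.memLp u).eval_piLp j

lemma coeff_add (u v : L2Field L) (k : Fin 3 → ℤ) (j : Fin 3) :
    coeff (u + v) k j = coeff u k j + coeff v k j := by
  unfold coeff
  rw [← scalarCoeff_add (memLp_component u j) (memLp_component v j)]
  apply scalarCoeff_congr
  filter_upwards [Lp.coeFn_add u v] with x hx
  rw [hx]; rfl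

lemma coeff_smul (c : ℝ) (u : L2Field L) (k : Fin 3 → ℤ) (j : Fin 3) :
    coeff (c • u) k j = c * coeff u k j := by
  unfold coeff
  rw [← scalarCoeff_const_mul]
  apply scalarCoeff_congr
  filter_upwards [Lp.coeFn_smul c u] with x hx
  rw [hx]; rfl

lemma coeff_neg (u : L2Field L) (k : Fin 3 → ℤ) (j : Fin 3) :
    coeff (-u) k j = -coeff u k j := by
  rw [← neg_one_smul ℝ, coeff_smul]; simp

lemma coeff_sub (u v : L2Field L) (k : Fin 3 → ℤ) (j : Fin 3) :
    coeff (u - v) k j = coeff u k j - coeff v k j := by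
  rw [sub_eq_add_neg, coeff_add, coeff_neg, sub_eq_add_neg]

lemma coeff_zero (k : Fin 3 → ℤ) (j : Fin 3) : coeff (0 : L2Field L) k j = 0 := by
  rw [← zero_smul ℝ (0 : L2Field L), coeff_smul]; simp

lemma conj_coeff (u : L2Field L) (k : Fin 3 → ℤ) (j : Fin 3) :
    conj (coeff u k j) = coeff u (-k) j := conj_scalarCoeff _ _

/-- Parseval's identity. -/
lemma hasSum_inner (u v : L2Field L) :
    HasSum (fun k => L ^ 3 * ∑ j, (coeff u k j * conj (coeff v k j)).re) (inner ℝ u v) := by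
  have h : ∀ j, HasSum (fun k => L ^ 3 * (coeff u k j * conj (coeff v k j)).re)
      (∫ x, u x j * v x j) := by
    intro j
    have := hasSum_scalarCoeff_mul (memLp_component v j) (memLp_component u j) 0
    have h2 := Complex.reCLM.hasSum this
    simp only [character_zero, one_mul, sub_zero, ← Complex.ofReal_mul, Complex.reCLM_apply,
      ← Complex.ofReal_pow, Complex.re_ofReal_mul, integral_complex_ofReal,
      Complex.ofReal_re] at h2
    convert! h2 using 2 with k
    · rw [mul_comm (coeff u k j)]; rfl
    · ext x; rw [mul_comm]
  have h3 := hasSum_sum (s := Finset.univ) fun j _ => h j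
  simp only [← Finset.mul_sum] at h3
  convert! h3
  rw [L2.inner_def, ← integral_finsetSum]
  · congr 1; ext x
    rw [PiLp.inner_apply]
    refine Finset.sum_congr rfl fun j _ => ?_
    rw [RCLike.inner_apply]
    simp [mul_comm]
  · intro j _
    exact (memLp_component u j).integrable_mul (memLp_component v j)

lemma exists_field {c : (Fin 3 → ℤ) → Fin 3 → ℂ} (hc : ∀ k j, c (-k) j = conj (c k j))
    (hs : ∀ j, Summable fun k => ‖c k j‖ ^ 2) :
    ∃ u : L2Field L, ∀ k j, coeff u k j = c k j := by
  choose g hg using fun j => exists_scalarCoeff_eq (L := L) (fun k => hc k j) (hs j)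
  have hm : MemLp (fun x => (WithLp.toLp 2 (fun j => g j x) : EuclideanSpace ℝ (Fin 3))) 2
      (volume : Measure (Box L)) :=
    MemLp.of_eval_piLp fun j => Lp.memLp (g j)
  refine ⟨hm.toLp _, fun k j => ?_⟩
  rw [← hg]
  apply scalarCoeff_congr
  filter_upwards [hm.coeFn_toLp] with x hx
  rw [hx]

/-- The modulus of the `k`-th Fourier coefficient. -/
def amp (u : L2Field L) (k : Fin 3 → ℤ) : ℝ := Real.sqrt (∑ j, ‖coeff u k j‖ ^ 2)

lemma amp_nonneg (u : L2Field L) (k : Fin 3 → ℤ) : 0 ≤ amp u k := Real.sqrt_nonneg _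

lemma amp_sq (u : L2Field L) (k : Fin 3 → ℤ) : amp u k ^ 2 = ∑ j, ‖coeff u k j‖ ^ 2 :=
  Real.sq_sqrt (by positivity)

lemma amp_neg_index (u : L2Field L) (k : Fin 3 → ℤ) : amp u (-k) = amp u k := by
  simp only [amp, ← conj_coeff, RCLike.norm_conj]

lemma hasSum_norm_sq (u : L2Field L) : HasSum (fun k => L ^ 3 * amp u k ^ 2) (‖u‖ ^ 2) := by
  have := hasSum_inner u u
  rw [real_inner_self_eq_norm_sq] at this
  convert! this using 3 with k
  rw [amp_sq]
  refine Finset.sum_congr rfl fun j _ => ?_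
  rw [Complex.mul_conj, Complex.normSq_eq_norm_sq, Complex.ofReal_re]

lemma summable_amp_sq (u : L2Field L) : Summable fun k => amp u k ^ 2 := by
  have h3 : L ^ 3 ≠ 0 := (pow_pos hL.out 3).ne'
  exact (summable_mul_left_iff h3).mp (hasSum_norm_sq u).summable

lemma norm_sum_mul_le (a b : Fin 3 → ℂ) :
    ‖∑ j, a j * b j‖ ≤ Real.sqrt (∑ j, ‖a j‖ ^ 2) * Real.sqrt (∑ j, ‖b j‖ ^ 2) := by
  refine (norm_sum_le _ _).trans ?_
  simp only [norm_mul]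
  exact Real.sum_mul_le_sqrt_mul_sqrt _ _ _

lemma ext_coeff {u v : L2Field L} (h : ∀ k j, coeff u k j = coeff v k j) : u = v := by
  have h1 : ∀ k, amp (u - v) k = 0 := fun k => by simp [amp, coeff_sub, h]
  have h2 := hasSum_norm_sq (u - v)
  simp only [h1] at h2
  have h3 : ‖u - v‖ ^ 2 = 0 := by
    refine h2.unique ?_
    simp
  rwa [sq_eq_zero_iff, norm_eq_zero, sub_eq_zero] at h3

/-! ### Truncation in frequency -/

/-- The field with the Fourier coefficients of `u` on `S` and `0` elsewhere (for symmetric `S`). -/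
def trunc (S : Finset (Fin 3 → ℤ)) (u : L2Field L) : L2Field L :=
  open Classical in
  if h : ∃ z : L2Field L, ∀ k j, coeff z k j = if k ∈ S then coeff u k j else 0 then h.choose else 0

/-- The symmetry of `S` keeps the truncated coefficients conjugate-symmetric, so they belong to a
real field and the default value in `trunc` does not occur. -/
lemma coeff_trunc {S : Finset (Fin 3 → ℤ)} (hS : ∀ k, k ∈ S → -k ∈ S) (u : L2Field L)
    (k : Fin 3 → ℤ) (j : Fin 3) :
    coeff (trunc S u) k j = if k ∈ S then coeff u k j else 0 := by
  classical
  have hS' : ∀ k, -k ∈ S ↔ k ∈ S := fun k => ⟨fun h => by simpa using hS _ h, hS k⟩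
  have h : ∃ z : L2Field L, ∀ k j, coeff z k j = if k ∈ S then coeff u k j else 0 := by
    apply exists_field
    · intro k j
      rw [apply_ite conj, conj_coeff, map_zero]
      simp only [hS']
    · intro j
      refine summable_of_ne_finset_zero (s := S) fun k hk => ?_
      simp [hk]
  have h2 := h.choose_spec k j
  rw [trunc, dif_pos h]
  convert! h2

lemma amp_trunc {S : Finset (Fin 3 → ℤ)} (hS : ∀ k, k ∈ S → -k ∈ S) (u : L2Field L)
    (k : Fin 3 → ℤ) : amp (trunc S u) k = if k ∈ S then amp u k else 0 := by
  unfold amp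
  simp only [coeff_trunc hS]
  split_ifs <;> simp

lemma amp_sub_trunc {S : Finset (Fin 3 → ℤ)} (hS : ∀ k, k ∈ S → -k ∈ S) (u : L2Field L)
    (k : Fin 3 → ℤ) : amp (u - trunc S u) k = if k ∈ S then 0 else amp u k := by
  unfold amp
  simp only [coeff_sub, coeff_trunc hS]
  split_ifs <;> simp

lemma trunc_mem {S : Finset (Fin 3 → ℤ)} (hS : ∀ k, k ∈ S → -k ∈ S) {u : L2Field L}
    (hu : u ∈ V₀ L) : trunc S u ∈ V₀ L := by
  refine ⟨fun j => ?_, fun k => ?_⟩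
  · rw [coeff_trunc hS, hu.1 j, ite_self]
  · simp only [coeff_trunc hS]
    split_ifs
    · exact hu.2 k
    · simp

lemma add_mem_V₀ {u v : L2Field L} (hu : u ∈ V₀ L) (hv : v ∈ V₀ L) : u + v ∈ V₀ L := by
  refine ⟨fun j => by rw [coeff_add, hu.1, hv.1, add_zero], fun k => ?_⟩
  simp only [coeff_add, mul_add, Finset.sum_add_distrib, hu.2, hv.2, add_zero]

lemma smul_mem_V₀ (c : ℝ) {u : L2Field L} (hu : u ∈ V₀ L) : c • u ∈ V₀ L := by
  refine ⟨fun j => by rw [coeff_smul, hu.1, mul_zero], fun k => ?_⟩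
  simp only [coeff_smul, mul_left_comm _ (c : ℂ), ← Finset.mul_sum, hu.2, mul_zero]

lemma zero_mem_V₀ : (0 : L2Field L) ∈ V₀ L :=
  ⟨fun j => coeff_zero _ _, fun k => by simp [coeff_zero]⟩

lemma sub_mem_V₀ {u v : L2Field L} (hu : u ∈ V₀ L) (hv : v ∈ V₀ L) : u - v ∈ V₀ L := by
  rw [sub_eq_add_neg, ← neg_one_smul ℝ]
  exact add_mem_V₀ hu (smul_mem_V₀ _ hv)

lemma amp_zero_mode {u : L2Field L} (hu : u ∈ V₀ L) : amp u 0 = 0 := by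
  simp [amp, hu.1]

/-! ### Sobolev norms -/

lemma eigenvalue_nonneg {L : ℝ} (k : Fin 3 → ℤ) : 0 ≤ eigenvalue L k := by
  unfold eigenvalue; positivity

/-- The `k`-th term of `‖u‖ₛ²`. -/
def sobTerm (s : ℝ) (u : L2Field L) (k : Fin 3 → ℤ) : ℝ :=
  L ^ 3 * eigenvalue L k ^ s * amp u k ^ 2

lemma sobTerm_nonneg (s : ℝ) (u : L2Field L) (k : Fin 3 → ℤ) : 0 ≤ sobTerm s u k := by
  have := pow_pos hL.out 3
  have := Real.rpow_nonneg (eigenvalue_nonneg (L := L) k) s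
  unfold sobTerm; positivity

lemma sobSq_eq (s : ℝ) (u : L2Field L) :
    sobSq s u = ∑' k, ENNReal.ofReal (sobTerm s u k) := by
  simp only [sobSq, sobTerm, amp_sq]

/-- Because `0 ^ 0 = 1`, the zero mode is counted as well, and zero average is not needed. -/
lemma sobSq_zero_exponent (u : L2Field L) : sobSq 0 u = ENNReal.ofReal (‖u‖ ^ 2) := by
  rw [sobSq_eq]
  simp only [sobTerm, Real.rpow_zero, mul_one]
  rw [← (hasSum_norm_sq u).tsum_eq, ENNReal.ofReal_tsum_of_nonneg _ (hasSum_norm_sq u).summable]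
  intro k
  have := pow_pos hL.out 3
  positivity

lemma sobTerm_sub_le (s : ℝ) (u v : L2Field L) (k : Fin 3 → ℤ) :
    sobTerm s (u - v) k ≤ 2 * sobTerm s u k + 2 * sobTerm s v k := by
  have h : amp (u - v) k ^ 2 ≤ 2 * amp u k ^ 2 + 2 * amp v k ^ 2 := by
    simp only [amp_sq, Finset.mul_sum, ← Finset.sum_add_distrib, coeff_sub]
    refine Finset.sum_le_sum fun j _ => ?_
    have := norm_sub_le (coeff u k j) (coeff v k j)
    have h0 := norm_nonneg (coeff u k j - coeff v k j)
    nlinarith [sq_nonneg (‖coeff u k j‖ - ‖coeff v k j‖)]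
  have := pow_pos hL.out 3
  have := Real.rpow_nonneg (eigenvalue_nonneg (L := L) k) s
  calc sobTerm s (u - v) k ≤ L ^ 3 * eigenvalue L k ^ s * (2 * amp u k ^ 2 + 2 * amp v k ^ 2) := by
        unfold sobTerm; gcongr
    _ = _ := by unfold sobTerm; ring

lemma sobSq_sub_le (s : ℝ) (u v : L2Field L) :
    sobSq s (u - v) ≤ 2 * sobSq s u + 2 * sobSq s v := by
  simp only [sobSq_eq, ← ENNReal.tsum_mul_left]
  rw [← ENNReal.tsum_add]
  refine ENNReal.tsum_le_tsum fun k => ?_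
  have h2 : ∀ a : ℝ, 2 * ENNReal.ofReal a = ENNReal.ofReal (2 * a) := fun a => by
    rw [ENNReal.ofReal_mul zero_le_two, ENNReal.ofReal_ofNat]
  rw [h2, h2, ← ENNReal.ofReal_add (by have := sobTerm_nonneg s u k; positivity)
      (by have := sobTerm_nonneg s v k; positivity)]
  exact ENNReal.ofReal_le_ofReal (sobTerm_sub_le s u v k)

lemma sobTerm_trunc {S : Finset (Fin 3 → ℤ)} (hS : ∀ k, k ∈ S → -k ∈ S) (s : ℝ) (u : L2Field L)
    (k : Fin 3 → ℤ) : sobTerm s (trunc S u) k = if k ∈ S then sobTerm s u k else 0 := by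
  unfold sobTerm
  rw [amp_trunc hS]
  split_ifs <;> simp

lemma sobSq_trunc {S : Finset (Fin 3 → ℤ)} (hS : ∀ k, k ∈ S → -k ∈ S) (s : ℝ) (u : L2Field L) :
    sobSq s (trunc S u) = ENNReal.ofReal (∑ k ∈ S, sobTerm s u k) := by
  rw [sobSq_eq, tsum_eq_sum (s := S), ENNReal.ofReal_sum_of_nonneg]
  · refine Finset.sum_congr rfl fun k hk => ?_
    rw [sobTerm_trunc hS, if_pos hk]
  · exact fun k _ => sobTerm_nonneg s u k
  · intro k hk
    rw [sobTerm_trunc hS, if_neg hk, ENNReal.ofReal_zero]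

lemma sobSq_trunc_le {S : Finset (Fin 3 → ℤ)} (hS : ∀ k, k ∈ S → -k ∈ S) (s : ℝ) (u : L2Field L) :
    sobSq s (trunc S u) ≤ sobSq s u := by
  simp only [sobSq_eq]
  refine ENNReal.tsum_le_tsum fun k => ?_
  rw [sobTerm_trunc hS]
  split_ifs
  · exact le_rfl
  · simp

lemma sobSq_eq_trunc_add {S : Finset (Fin 3 → ℤ)} (hS : ∀ k, k ∈ S → -k ∈ S) (s : ℝ)
    (u : L2Field L) : sobSq s u = sobSq s (trunc S u) + sobSq s (u - trunc S u) := by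
  simp only [sobSq_eq]
  rw [← ENNReal.tsum_add]
  refine tsum_congr fun k => ?_
  unfold sobTerm
  rw [amp_trunc hS, amp_sub_trunc hS]
  split_ifs <;> simp

lemma trunc_mem_V {S : Finset (Fin 3 → ℤ)} (hS : ∀ k, k ∈ S → -k ∈ S) {u : L2Field L}
    (hu : u ∈ V₀ L) (s : ℝ) : trunc S u ∈ V L s := by
  refine ⟨trunc_mem hS hu, ?_⟩
  rw [sobSq_trunc hS]
  exact ENNReal.ofReal_lt_top

/-! ### The trilinear form in Fourier variables -/

/-- Mode by mode the candidate coefficients are dominated by the terms of ‖v‖_1², so Riesz–Fischer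
provides the derivative and the default value is excluded. -/
lemma weakDeriv_spec {v : L2Field L} (hv : sobSq 1 v < ∞) (i j : Fin 3) (k : Fin 3 → ℤ) :
    scalarCoeff (weakDeriv i j v) k =
      (2 * Real.pi * Complex.I * (k i : ℂ) / (L : ℂ)) * coeff v k j := by
  have h3 := pow_pos hL.out 3
  have h : ∃ g : Lp ℝ 2 (volume : Measure (Box L)), ∀ k : Fin 3 → ℤ,
      scalarCoeff g k = (2 * Real.pi * Complex.I * (k i : ℂ) / (L : ℂ)) * coeff v k j := by
    apply exists_scalarCoeff_eq
    · intro k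
      rw [map_mul, conj_coeff]
      simp [Complex.conj_ofReal, map_ofNat]
    · have hs : Summable fun k => (L ^ 3)⁻¹ * sobTerm 1 v k := by
        apply Summable.mul_left
        rw [sobSq_eq] at hv
        have := ENNReal.summable_toReal hv.ne
        simpa only [ENNReal.toReal_ofReal (sobTerm_nonneg 1 v _)] using this
      refine Summable.of_nonneg_of_le (fun k => by positivity) (fun k => ?_) hs
      unfold sobTerm
      rw [Real.rpow_one, mul_assoc (L ^ 3), inv_mul_cancel_left₀ h3.ne', norm_mul, mul_pow]
      have h1 : ‖(2 * Real.pi * Complex.I * (k i : ℂ) / (L : ℂ))‖ ^ 2 =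
          (2 * Real.pi * (k i : ℝ) / L) ^ 2 := by
        have : (2 * Real.pi * Complex.I * (k i : ℂ) / (L : ℂ)) =
            ((2 * Real.pi * (k i : ℝ) / L : ℝ) : ℂ) * Complex.I := by push_cast; ring
        rw [this, norm_mul, Complex.norm_I, mul_one, Complex.norm_real, Real.norm_eq_abs, sq_abs]
      rw [h1]
      have h2 : (2 * Real.pi * (k i : ℝ) / L) ^ 2 ≤ eigenvalue L k :=
        Finset.single_le_sum (f := fun i => (2 * Real.pi * (k i : ℝ) / L) ^ 2)
          (fun i _ => sq_nonneg _) (Finset.mem_univ i)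
      have h4 : ‖coeff v k j‖ ^ 2 ≤ amp v k ^ 2 := by
        rw [amp_sq]
        exact Finset.single_le_sum (f := fun j => ‖coeff v k j‖ ^ 2)
          (fun i _ => sq_nonneg _) (Finset.mem_univ j)
      have := eigenvalue_nonneg (L := L) k
      gcongr
  rw [weakDeriv, dif_pos h]
  exact h.choose_spec k

lemma cCoeff_character (k l : Fin 3 → ℤ) :
    cCoeff (character l : Box L → ℂ) k = if k = l then 1 else 0 := by
  have h3 : (L : ℂ) ^ 3 ≠ 0 := by exact_mod_cast (pow_pos hL.out 3).ne'
  unfold cCoeff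
  simp only [← character_add, integral_character]
  by_cases h : k = l
  · simp [h, h3]
  · rw [if_neg h, if_neg (by rwa [neg_add_eq_zero]), mul_zero]

/-- Both sides have the same Fourier coefficients. Parseval's identity does not apply to a product
of three L² functions; writing the test field as a finite trigonometric sum reduces b to products of
two. -/
lemma component_eq_of_support {S : Finset (Fin 3 → ℤ)} {w : L2Field L}
    (hw : ∀ k, k ∉ S → ∀ j, coeff w k j = 0) (j : Fin 3) :
    (fun x => ((w x j : ℝ) : ℂ)) =ᵐ[volume] fun x => ∑ l ∈ S, coeff w l j * character l x := by
  have hm : MemLp (fun x => ((w x j : ℝ) : ℂ)) 2 := (memLp_component w j).ofReal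
  have hp1 : ∀ l, MemLp (character l : Box L → ℂ) 2 := fun l =>
    MemLp.of_bound (continuous_character l).aestronglyMeasurable 1
      (ae_of_all _ fun x => (norm_character l x).le)
  have hp : MemLp (fun x : Box L => ∑ l ∈ S, coeff w l j * character l x) 2 :=
    memLp_finsetSum _ fun l _ => (hp1 l).const_mul _
  have hi : ∀ k l, Integrable (fun x : Box L => character (-k) x * character l x) := by
    intro k l
    simp only [← character_add]
    exact (hp1 _).integrable (by norm_num)
  have hc : ∀ k, cCoeff (fun x : Box L => ∑ l ∈ S, coeff w l j * character l x) k =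
      coeff w k j := by
    intro k
    have h1 : cCoeff (fun x : Box L => ∑ l ∈ S, coeff w l j * character l x) k =
        ∑ l ∈ S, coeff w l j * cCoeff (character l : Box L → ℂ) k := by
      simp only [cCoeff, Finset.mul_sum, mul_left_comm _ (coeff w _ j)]
      rw [integral_finsetSum]
      · simp only [integral_const_mul, Finset.mul_sum]
        exact Finset.sum_congr rfl fun l _ => mul_left_comm _ _ _
      · exact fun l _ => (hi k l).const_mul _
    rw [h1]
    simp only [cCoeff_character, mul_ite, mul_one, mul_zero, Finset.sum_ite_eq]
    split_ifs with h
    · rfl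
    · exact (hw k h j).symm
  have he : hm.toLp _ = hp.toLp _ := by
    apply (characterBasis L).repr.injective
    ext k
    rw [characterBasis_repr, characterBasis_repr, cCoeff_congr hm.coeFn_toLp,
      cCoeff_congr hp.coeFn_toLp, hc]
    rfl
  exact hm.coeFn_toLp.symm.trans (he ▸ hp.coeFn_toLp)

/-- The `(k, l)` term of `b(u, v, w)`. -/
def triTerm (u v w : L2Field L) (l k : Fin 3 → ℤ) : ℝ :=
  (-(L ^ 3 * (2 * Real.pi * Complex.I / L)) * (∑ i, (k i : ℂ) * coeff u (k - l) i) *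
    ∑ j, coeff w l j * conj (coeff v k j)).re

/-- The form `b(u, v, P_S w)` in Fourier variables. -/
def tri (S : Finset (Fin 3 → ℤ)) (u v w : L2Field L) : ℝ := ∑ l ∈ S, ∑' k, triTerm u v w l k

/-- Each character in the finite expansion of `w` acts as the shift in Parseval's identity for the
pair of the weak derivative of `v` and a component of `u`. -/
lemma trilinear_eq_tri {S : Finset (Fin 3 → ℤ)} (u : L2Field L) {v w : L2Field L}
    (hv : sobSq 1 v < ∞) (hw : ∀ k, k ∉ S → ∀ j, coeff w k j = 0) :
    trilinear u v w = tri S u v w := by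
  have hg : ∀ i j, MemLp (weakDeriv i j v) 2 := fun i j => Lp.memLp _
  have hint : ∀ i j l, Integrable fun x =>
      character l x * (((weakDeriv i j v x : ℝ) : ℂ) * ((u x i : ℝ) : ℂ)) := by
    intro i j l
    have h1 : Integrable fun x => weakDeriv i j v x * u x i :=
      (hg i j).integrable_mul (memLp_component u i)
    have h2 := h1.ofReal (𝕜 := ℂ).bdd_mul (c := 1) (continuous_character l).aestronglyMeasurable
      (ae_of_all _ fun x => (norm_character l x).le)
    refine h2.congr (ae_of_all _ fun x => ?_)
    simp
  have h1 : ∀ i j, ((∫ x, u x i * weakDeriv i j v x * w x j : ℝ) : ℂ) =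
      ∑ l ∈ S, coeff w l j *
        ∫ x, character l x * (((weakDeriv i j v x : ℝ) : ℂ) * ((u x i : ℝ) : ℂ)) := by
    intro i j
    simp only [← integral_const_mul]
    rw [← integral_finsetSum _ fun l _ => (hint i j l).const_mul _, ← integral_complex_ofReal]
    apply integral_congr_ae
    filter_upwards [component_eq_of_support hw j] with x hx
    rw [Complex.ofReal_mul, hx, Finset.mul_sum]
    refine Finset.sum_congr rfl fun l _ => ?_
    push_cast; ring
  have h2 : ∀ l, HasSum (fun k => ∑ i, ∑ j, coeff w l j * ((L : ℂ) ^ 3 *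
      (conj (scalarCoeff (weakDeriv i j v) k) * coeff u (k - l) i)))
      (∑ i, ∑ j, coeff w l j *
        ∫ x, character l x * (((weakDeriv i j v x : ℝ) : ℂ) * ((u x i : ℝ) : ℂ))) := by
    intro l
    refine hasSum_sum fun i _ => hasSum_sum fun j _ => ?_
    exact (hasSum_scalarCoeff_mul (hg i j) (memLp_component u i) l).mul_left _
  have h3 : ∀ l, HasSum (triTerm u v w l) (∑ i, ∑ j, coeff w l j *
        ∫ x, character l x * (((weakDeriv i j v x : ℝ) : ℂ) * ((u x i : ℝ) : ℂ))).re := by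
    intro l
    have := Complex.reCLM.hasSum (h2 l)
    refine this.congr_fun fun k => ?_
    rw [Complex.reCLM_apply, triTerm]
    congr 1
    rw [mul_assoc, Finset.sum_mul, Finset.mul_sum]
    refine Finset.sum_congr rfl fun i _ => ?_
    rw [Finset.mul_sum, Finset.mul_sum]
    refine Finset.sum_congr rfl fun j _ => ?_
    rw [weakDeriv_spec hv, map_mul]
    simp only [map_mul, map_div₀, Complex.conj_ofReal, Complex.conj_I, map_ofNat, map_intCast]
    ring
  unfold tri
  simp only [fun l => (h3 l).tsum_eq]
  rw [← Complex.re_sum, Finset.sum_comm]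
  have h4 : trilinear u v w = ((trilinear u v w : ℝ) : ℂ).re := rfl
  rw [h4]
  congr 1
  unfold trilinear
  push_cast
  refine Finset.sum_congr rfl fun i _ => ?_
  rw [Finset.sum_comm]
  refine Finset.sum_congr rfl fun j _ => ?_
  exact h1 i j

end Fields

/-! ### Lattice sums and convolution estimates -/

section Lattice

/-- The modes with all components at most `N` in absolute value. -/
def box (N : ℕ) : Finset (Fin 3 → ℤ) := Fintype.piFinset fun _ => Finset.Icc (-(N : ℤ)) N

lemma mem_box {N : ℕ} {k : Fin 3 → ℤ} : k ∈ box N ↔ ∀ i, |k i| ≤ N := by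
  simp [box, abs_le]

lemma neg_mem_box {N : ℕ} (k : Fin 3 → ℤ) (hk : k ∈ box N) : -k ∈ box N := by
  rw [mem_box] at hk ⊢
  simpa using hk

lemma box_mono {M N : ℕ} (h : M ≤ N) : box M ⊆ box N := by
  intro k hk
  rw [mem_box] at hk ⊢
  exact fun i => (hk i).trans (by exact_mod_cast h)

lemma card_box (N : ℕ) : (box N).card = (2 * N + 1) ^ 3 := by
  rw [box, Fintype.card_piFinset]
  simp only [Int.card_Icc, Finset.prod_const, Finset.card_univ, Fintype.card_fin]
  congr 1; omega

/-- The supremum norm of a mode, as a natural number. -/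
def height (k : Fin 3 → ℤ) : ℕ := Finset.univ.sup fun i => (k i).natAbs

lemma mem_box_iff {N : ℕ} {k : Fin 3 → ℤ} : k ∈ box N ↔ height k ≤ N := by
  rw [mem_box, height, Finset.sup_le_iff]
  simp only [Finset.mem_univ, true_implies]
  refine forall_congr' fun i => ?_
  rw [Int.abs_eq_natAbs, Nat.cast_le]

lemma tendsto_box : Tendsto box atTop atTop := by
  refine tendsto_atTop.mpr fun s => ?_
  filter_upwards [eventually_ge_atTop (s.sup height)] with N hN k hk
  exact mem_box_iff.mpr ((Finset.le_sup hk).trans hN)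

variable {L : ℝ} [hL : Fact (0 < L)]

lemma two_pi_div_pos : 0 < 2 * Real.pi / L := by
  have := hL.out
  positivity

lemma le_eigenvalue {N : ℕ} {k : Fin 3 → ℤ} (hk : k ∉ box N) :
    ((2 * Real.pi / L) * (N + 1)) ^ 2 ≤ eigenvalue L k := by
  rw [mem_box] at hk
  push Not at hk
  obtain ⟨i, hi⟩ := hk
  have h1 : ((N : ℝ) + 1) ≤ |(k i : ℝ)| := by exact_mod_cast hi
  have h2 : (2 * Real.pi * (k i : ℝ) / L) ^ 2 ≤ eigenvalue L k :=
    Finset.single_le_sum (f := fun i => (2 * Real.pi * (k i : ℝ) / L) ^ 2)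
      (fun i _ => sq_nonneg _) (Finset.mem_univ i)
  refine le_trans ?_ h2
  have h3 : 2 * Real.pi * (k i : ℝ) / L = (2 * Real.pi / L) * k i := by ring
  rw [h3, mul_pow, mul_pow, ← sq_abs (k i : ℝ)]
  have := two_pi_div_pos (L := L)
  gcongr

lemma le_eigenvalue_height (k : Fin 3 → ℤ) :
    ((2 * Real.pi / L) * height k) ^ 2 ≤ eigenvalue L k := by
  by_cases h : height k = 0
  · rw [h]; simpa using eigenvalue_nonneg k
  · have hk : k ∉ box (height k - 1) := by rw [mem_box_iff]; omega
    have := le_eigenvalue (L := L) hk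
    rwa [← Nat.cast_add_one, Nat.sub_add_cancel (by omega)] at this

lemma mem_box_zero {k : Fin 3 → ℤ} : k ∈ box 0 ↔ k = 0 := by
  rw [mem_box]
  constructor
  · intro h; ext i; simpa using h i
  · rintro rfl; simp

lemma eigenvalue_ge {k : Fin 3 → ℤ} (hk : k ≠ 0) : (2 * Real.pi / L) ^ 2 ≤ eigenvalue L k := by
  have := le_eigenvalue (L := L) (mem_box_zero.not.mpr hk)
  simpa using this

lemma eigenvalue_pos {k : Fin 3 → ℤ} (hk : k ≠ 0) : 0 < eigenvalue L k :=
  (pow_pos two_pi_div_pos 2).trans_le (eigenvalue_ge hk)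

/-- A discrete derivative. Bounding `N ^ (q - 1/2)` by `(N + 1) ^ (q - 1/2)` reduces it to the case
q = 1/2, that is, to √N √(N+1) + 1/2 ≤ N + 1. It is applied with q = 3 - 2s, whence the restriction
s ≤ 5/4. -/
lemma rpow_succ_sub_ge {q : ℝ} (hq : 1 / 2 ≤ q) (N : ℕ) :
    (N : ℝ) ^ q + 1 / 2 * (N + 1 : ℝ) ^ (q - 1) ≤ (N + 1 : ℝ) ^ q := by
  have hN : (0 : ℝ) < N + 1 := by positivity
  have h0 : (0 : ℝ) ≤ N := N.cast_nonneg
  have e1 : (N : ℝ) ^ q ≤ Real.sqrt N * (N + 1 : ℝ) ^ (q - 1 / 2) := by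
    rcases h0.eq_or_lt with h | h
    · rw [← h, Real.zero_rpow (by linarith)]; positivity
    · have : (N : ℝ) ^ q = Real.sqrt N * (N : ℝ) ^ (q - 1 / 2) := by
        rw [Real.sqrt_eq_rpow, ← Real.rpow_add h]; ring_nf
      rw [this]
      gcongr
      linarith
  have e2 : (N + 1 : ℝ) ^ q = Real.sqrt (N + 1) * (N + 1 : ℝ) ^ (q - 1 / 2) := by
    rw [Real.sqrt_eq_rpow, ← Real.rpow_add hN]; ring_nf
  have e3 : (N + 1 : ℝ) ^ (q - 1 / 2) = Real.sqrt (N + 1) * (N + 1 : ℝ) ^ (q - 1) := by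
    rw [Real.sqrt_eq_rpow, ← Real.rpow_add hN]; ring_nf
  have hp : 0 < (N + 1 : ℝ) ^ (q - 1) := Real.rpow_pos_of_pos hN _
  have s1 := Real.sq_sqrt hN.le
  have s2 := Real.sq_sqrt h0
  have s3 := Real.sqrt_nonneg (N : ℝ)
  have s4 := Real.sqrt_nonneg (N + 1 : ℝ)
  have h4 : Real.sqrt N * Real.sqrt (N + 1) + 1 / 2 ≤ Real.sqrt (N + 1) * Real.sqrt (N + 1) := by
    nlinarith [sq_nonneg (Real.sqrt (N + 1) - Real.sqrt N)]
  rw [e2]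
  refine (add_le_add_left e1 _).trans ?_
  rw [e3]
  nlinarith

/-- The lattice sum `Σ_{0 < |m| ≤ N} |m|^{-2s} ≤ C N^{3-2s}`. -/
lemma sum_eigenvalue_rpow_le {s : ℝ} (hs0 : 0 ≤ s) (hs : s ≤ 5 / 4) (N : ℕ) :
    ∑ m ∈ (box N).erase 0, eigenvalue L m ^ (-s) ≤
      52 * (2 * Real.pi / L) ^ (-(2 * s)) * (N : ℝ) ^ (3 - 2 * s) := by
  have hμ := two_pi_div_pos (L := L)
  set μ := 2 * Real.pi / L
  induction N with
  | zero =>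
    have : (box 0).erase 0 = ∅ := by
      ext k; simp [mem_box_zero]
    rw [this, Finset.sum_empty]
    positivity
  | succ N ih =>
    have hsub : (box N).erase 0 ⊆ (box (N + 1)).erase 0 :=
      Finset.erase_subset_erase _ (box_mono (Nat.le_succ N))
    rw [← Finset.sum_sdiff hsub]
    have hd : (box (N + 1)).erase 0 \ (box N).erase 0 = box (N + 1) \ box N := by
      ext k
      have h0 : (0 : Fin 3 → ℤ) ∈ box N := by simp [mem_box]
      simp only [Finset.mem_sdiff, Finset.mem_erase]
      constructor
      · rintro ⟨⟨h1, h2⟩, h3⟩; exact ⟨h2, fun h => h3 ⟨h1, h⟩⟩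
      · rintro ⟨h1, h2⟩
        exact ⟨⟨fun h => h2 (h ▸ h0), h1⟩, fun h => h2 h.2⟩
    rw [hd]
    -- The shell has exactly 24(N+1)² + 2 points. The 52 in the statement is twice 26, which makes
    -- up for the factor 1/2 in `rpow_succ_sub_ge`.
    have hc : ((box (N + 1) \ box N).card : ℝ) ≤ 26 * (N + 1 : ℝ) ^ 2 := by
      have := Finset.card_sdiff_add_card_eq_card (box_mono (Nat.le_succ N))
      rw [card_box, card_box] at this
      have h2 : ((box (N + 1) \ box N).card : ℝ) + (2 * N + 1) ^ 3 = (2 * (N + 1) + 1) ^ 3 := by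
        exact_mod_cast this
      have h0 : (0 : ℝ) ≤ N := N.cast_nonneg
      nlinarith
    have hb : ∑ m ∈ box (N + 1) \ box N, eigenvalue L m ^ (-s) ≤
        26 * μ ^ (-(2 * s)) * (N + 1 : ℝ) ^ (2 - 2 * s) := by
      have h1 : ∀ m ∈ box (N + 1) \ box N,
          eigenvalue L m ^ (-s) ≤ μ ^ (-(2 * s)) * (N + 1 : ℝ) ^ (-(2 * s)) := by
        intro m hm
        have h2 := le_eigenvalue (L := L) (Finset.mem_sdiff.mp hm).2
        have hp : 0 < μ * (N + 1) := by positivity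
        refine (Real.rpow_le_rpow_of_nonpos (pow_pos hp 2) h2 (by linarith)).trans_eq ?_
        rw [← Real.rpow_natCast, ← Real.rpow_mul hp.le,
          Real.mul_rpow hμ.le (by positivity)]
        push_cast
        ring_nf
      refine (Finset.sum_le_card_nsmul _ _ _ h1).trans ?_
      rw [nsmul_eq_mul]
      have e : (N + 1 : ℝ) ^ (2 - 2 * s) = (N + 1 : ℝ) ^ 2 * (N + 1 : ℝ) ^ (-(2 * s)) := by
        rw [← Real.rpow_natCast, ← Real.rpow_add (by positivity)]
        push_cast; ring_nf
      rw [e]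
      have hp : 0 ≤ μ ^ (-(2 * s)) * (N + 1 : ℝ) ^ (-(2 * s)) := by positivity
      nlinarith
    have h3 := rpow_succ_sub_ge (q := 3 - 2 * s) (by linarith) N
    have e : 3 - 2 * s - 1 = 2 - 2 * s := by ring
    rw [e] at h3
    have hp : 0 ≤ μ ^ (-(2 * s)) := by positivity
    push_cast
    nlinarith [mul_le_mul_of_nonneg_left h3 hp]

end Lattice

/-! ### Weighted ℓ² estimates of trilinear convolution sums -/

section Convolution

variable {L : ℝ} [hL : Fact (0 < L)]

/-- The Cauchy–Schwarz inequality. -/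
lemma tsum_mul_sq_le {ι : Type*} (f g : ι → ℝ≥0∞) :
    (∑' i, f i * g i) ^ 2 ≤ (∑' i, f i ^ 2) * ∑' i, g i ^ 2 := by
  let _ : MeasurableSpace ι := ⊤
  have h := ENNReal.lintegral_mul_le_Lp_mul_Lq (Measure.count : Measure ι)
    Real.HolderConjugate.two_two (f := f) (g := g) measurable_from_top.aemeasurable
    measurable_from_top.aemeasurable
  simp only [lintegral_count, Pi.mul_apply, ENNReal.rpow_two] at h
  refine (pow_le_pow_left' h 2).trans_eq ?_
  rw [mul_pow, ← ENNReal.rpow_two, ← ENNReal.rpow_two, ← ENNReal.rpow_mul, ← ENNReal.rpow_mul]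
  norm_num

/-- The eigenvalue as an extended nonnegative real. -/
def ev (L : ℝ) (k : Fin 3 → ℤ) : ℝ≥0∞ := ENNReal.ofReal (eigenvalue L k)

/-- The constant of the lattice sum. -/
def latticeConst (L : ℝ) : ℝ≥0∞ := ENNReal.ofReal (52 * (2 * Real.pi / L) ^ (-3 : ℝ))

lemma ev_ne_zero {k : Fin 3 → ℤ} (hk : k ≠ 0) : ev L k ≠ 0 := by
  rw [ev, Ne, ENNReal.ofReal_eq_zero, not_le]
  exact eigenvalue_pos hk

lemma ev_ne_top {L : ℝ} (k : Fin 3 → ℤ) : ev L k ≠ ∞ := ENNReal.ofReal_ne_top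

/-- This is the lattice sum with N = `height l`. As (2π/L) `height l` is at most the square root of
the eigenvalue, the power N^{3-2s} becomes a power of the eigenvalue, and the factor (2π/L)^{-3}
that remains no longer depends on s. -/
lemma tsum_ev_rpow_le {s : ℝ} (hs0 : 0 ≤ s) (hs : s ≤ 5 / 4) (l : Fin 3 → ℤ) :
    ∑' m, (if m ≠ 0 ∧ height m ≤ height l then ev L m ^ (-s) else 0) ≤
      latticeConst L * ev L l ^ (3 / 2 - s) := by
  have hμ := two_pi_div_pos (L := L)
  rw [tsum_eq_sum (s := (box (height l)).erase 0)]
  · have h1 : ∀ m ∈ (box (height l)).erase 0,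
        (if m ≠ 0 ∧ height m ≤ height l then ev L m ^ (-s) else 0) =
          ENNReal.ofReal (eigenvalue L m ^ (-s)) := by
      intro m hm
      rw [Finset.mem_erase, mem_box_iff] at hm
      rw [if_pos hm, ev, ENNReal.ofReal_rpow_of_pos (eigenvalue_pos hm.1)]
    rw [Finset.sum_congr rfl h1, ← ENNReal.ofReal_sum_of_nonneg
      fun m _ => Real.rpow_nonneg (eigenvalue_nonneg m) _, latticeConst, ev,
      ENNReal.ofReal_rpow_of_nonneg (eigenvalue_nonneg l) (by linarith),
      ← ENNReal.ofReal_mul (by positivity)]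
    apply ENNReal.ofReal_le_ofReal
    refine (sum_eigenvalue_rpow_le hs0 hs _).trans ?_
    have h2 := Real.rpow_le_rpow (sq_nonneg _) (le_eigenvalue_height (L := L) l)
      (show 0 ≤ 3 / 2 - s by linarith)
    have h0 : (0 : ℝ) ≤ height l := Nat.cast_nonneg _
    rw [← Real.rpow_natCast, ← Real.rpow_mul (by positivity), Real.mul_rpow hμ.le h0] at h2
    have e1 : ((2 : ℕ) : ℝ) * (3 / 2 - s) = 3 - 2 * s := by push_cast; ring
    rw [e1] at h2
    have e2 : (2 * Real.pi / L) ^ (-(2 * s)) =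
        (2 * Real.pi / L) ^ (-3 : ℝ) * (2 * Real.pi / L) ^ (3 - 2 * s) := by
      rw [← Real.rpow_add hμ]; ring_nf
    rw [e2]
    have hp : 0 ≤ (2 * Real.pi / L) ^ (-3 : ℝ) := by positivity
    nlinarith [mul_le_mul_of_nonneg_left h2 hp]
  · intro m hm
    rw [Finset.mem_erase, mem_box_iff] at hm
    exact if_neg hm

/-- Cauchy–Schwarz over pairs of modes, after inserting the weights |m|^s and |m|^{-s}. The sum of
|m|^{-2s} over the whole lattice diverges for s < 3/2; restricted to modes no higher than `l` it
costs the weight |l|^{3-2s}, which falls on b². -/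
lemma half_conv_le {s : ℝ} (hs0 : 0 ≤ s) (hs : s ≤ 5 / 4) {a b c : (Fin 3 → ℤ) → ℝ≥0∞}
    (ha : a 0 = 0) :
    (∑' p : (Fin 3 → ℤ) × (Fin 3 → ℤ),
      if height p.1 ≤ height p.2 then a p.1 * b p.2 * c (p.1 + p.2) else 0) ^ 2 ≤
      latticeConst L * (∑' m, ev L m ^ s * a m ^ 2) * (∑' l, ev L l ^ (3 / 2 - s) * b l ^ 2) *
        ∑' k, c k ^ 2 := by
  have h1 : ∀ p : (Fin 3 → ℤ) × (Fin 3 → ℤ),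
      (if height p.1 ≤ height p.2 then a p.1 * b p.2 * c (p.1 + p.2) else 0) =
      (ev L p.1 ^ (s / 2) * a p.1 * c (p.1 + p.2)) *
        (if p.1 ≠ 0 ∧ height p.1 ≤ height p.2 then ev L p.1 ^ (-(s / 2)) * b p.2 else 0) := by
    intro p
    by_cases h0 : p.1 = 0
    · simp [h0, ha]
    by_cases h : height p.1 ≤ height p.2
    · rw [if_pos h, if_pos ⟨h0, h⟩]
      have : ev L p.1 ^ (s / 2) * ev L p.1 ^ (-(s / 2)) = 1 := by
        rw [← ENNReal.rpow_add _ _ (ev_ne_zero h0) (ev_ne_top _), add_neg_cancel,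
          ENNReal.rpow_zero]
      calc a p.1 * b p.2 * c (p.1 + p.2)
          = (ev L p.1 ^ (s / 2) * ev L p.1 ^ (-(s / 2))) * (a p.1 * b p.2 * c (p.1 + p.2)) := by
            rw [this, one_mul]
        _ = _ := by ring
    · rw [if_neg h, if_neg (fun h' => h h'.2), mul_zero]
  simp only [h1]
  refine (tsum_mul_sq_le _ _).trans ?_
  have hsq : ∀ (x : ℝ≥0∞) (t : ℝ), (x ^ (t / 2)) ^ 2 = x ^ t := by
    intro x t
    rw [← ENNReal.rpow_two, ← ENNReal.rpow_mul]; ring_nf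
  have h2 : ∑' p : (Fin 3 → ℤ) × (Fin 3 → ℤ), (ev L p.1 ^ (s / 2) * a p.1 * c (p.1 + p.2)) ^ 2 =
      (∑' m, ev L m ^ s * a m ^ 2) * ∑' k, c k ^ 2 := by
    rw [ENNReal.tsum_prod', ← ENNReal.tsum_mul_right]
    refine tsum_congr fun m => ?_
    simp only [mul_pow, hsq]
    rw [ENNReal.tsum_mul_left]
    congr 1
    exact (Equiv.addLeft m).tsum_eq fun k => c k ^ 2
  have h3 : ∑' p : (Fin 3 → ℤ) × (Fin 3 → ℤ),
      (if p.1 ≠ 0 ∧ height p.1 ≤ height p.2 then ev L p.1 ^ (-(s / 2)) * b p.2 else 0) ^ 2 ≤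
      latticeConst L * ∑' l, ev L l ^ (3 / 2 - s) * b l ^ 2 := by
    rw [ENNReal.tsum_prod', ENNReal.tsum_comm, ← ENNReal.tsum_mul_left]
    refine ENNReal.tsum_le_tsum fun l => ?_
    have h4 : ∀ m, (if m ≠ 0 ∧ height m ≤ height l then ev L m ^ (-(s / 2)) * b l else 0) ^ 2 =
        (if m ≠ 0 ∧ height m ≤ height l then ev L m ^ (-s) else 0) * b l ^ 2 := by
      intro m
      split_ifs
      · rw [mul_pow, ← neg_div, hsq]
      · simp
    simp only [h4]
    rw [ENNReal.tsum_mul_right, ← mul_assoc]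
    gcongr
    exact tsum_ev_rpow_le hs0 hs l
  rw [h2]
  refine (mul_le_mul_right h3 _).trans_eq ?_
  ring

/-- The convolution estimate `|Σ a(m) b(l) c(m+l)| ≤ C |a|_{hˢ} |b|_{h^{3/2-s}} |c|_{ℓ²}`. -/
lemma conv_le {s : ℝ} (hs0 : 1 / 4 ≤ s) (hs : s ≤ 5 / 4) {a b c : (Fin 3 → ℤ) → ℝ≥0∞}
    (ha : a 0 = 0) (hb : b 0 = 0) :
    (∑' m, ∑' l, a m * b l * c (m + l)) ^ 2 ≤
      4 * latticeConst L * (∑' m, ev L m ^ s * a m ^ 2) *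
        (∑' l, ev L l ^ (3 / 2 - s) * b l ^ 2) * ∑' k, c k ^ 2 := by
  have h1 := half_conv_le (L := L) (b := b) (c := c) (by linarith) hs ha
  -- The pairs with the opposite order of heights: `a` and `b` change roles and s becomes 3/2 - s,
  -- which lies again in [1/4, 5/4].
  have h2 := half_conv_le (L := L) (b := a) (c := c) (s := 3 / 2 - s) (by linarith)
    (by linarith) hb
  rw [sub_sub_cancel] at h2
  set X := ∑' p : (Fin 3 → ℤ) × (Fin 3 → ℤ),
      if height p.1 ≤ height p.2 then a p.1 * b p.2 * c (p.1 + p.2) else 0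
  set Y := ∑' p : (Fin 3 → ℤ) × (Fin 3 → ℤ),
      if height p.1 ≤ height p.2 then b p.1 * a p.2 * c (p.1 + p.2) else 0 with hY
  have h3 : ∑' m, ∑' l, a m * b l * c (m + l) ≤ X + Y := by
    have hY' : Y = ∑' p : (Fin 3 → ℤ) × (Fin 3 → ℤ),
        if height p.2 ≤ height p.1 then a p.1 * b p.2 * c (p.1 + p.2) else 0 := by
      rw [hY, ← (Equiv.prodComm _ _).tsum_eq]
      refine tsum_congr fun p => ?_
      simp only [Equiv.prodComm_apply, Prod.fst_swap, Prod.snd_swap]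
      rw [mul_comm (b p.2), add_comm p.2]
      by_cases h : height p.2 ≤ height p.1 <;> simp [h]
    rw [hY', ← ENNReal.tsum_add, ← ENNReal.tsum_prod' (f := fun p => a p.1 * b p.2 * c (p.1 + p.2))]
    refine ENNReal.tsum_le_tsum fun p => ?_
    rcases le_total (height p.1) (height p.2) with h | h
    · rw [if_pos h]; exact le_self_add
    · rw [if_pos h]; exact le_add_self
  have h4 : (X + Y) ^ 2 ≤ 4 * (latticeConst L * (∑' m, ev L m ^ s * a m ^ 2) *
        (∑' l, ev L l ^ (3 / 2 - s) * b l ^ 2) * ∑' k, c k ^ 2) := by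
    have h2' : Y ^ 2 ≤ latticeConst L * (∑' m, ev L m ^ s * a m ^ 2) *
        (∑' l, ev L l ^ (3 / 2 - s) * b l ^ 2) * ∑' k, c k ^ 2 :=
      h2.trans_eq (by ring)
    have h5 : X + Y ≤ 2 * max X Y := by
      rw [two_mul]; exact add_le_add (le_max_left _ _) (le_max_right _ _)
    refine (pow_le_pow_left' h5 2).trans ?_
    rw [mul_pow]
    have : (2 : ℝ≥0∞) ^ 2 = 4 := by norm_num
    rw [this]
    gcongr
    rcases max_cases X Y with h | h
    · rw [h.1]; exact h1
    · rw [h.1]; exact h2'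
  refine (pow_le_pow_left' h3 2).trans (h4.trans_eq ?_)
  ring

end Convolution

/-! ### Estimates of the trilinear form -/

section TriBounds

open scoped ComplexConjugate

variable {L : ℝ} [hL : Fact (0 < L)]

lemma norm_sum_freq_le (u : L2Field L) (k m : Fin 3 → ℤ) :
    2 * Real.pi / L * ‖∑ i, (k i : ℂ) * coeff u m i‖ ≤ Real.sqrt (eigenvalue L k) * amp u m := by
  have hμ := two_pi_div_pos (L := L)
  have h1 : 2 * Real.pi / L * ‖∑ i, (k i : ℂ) * coeff u m i‖ =
      ‖∑ i, ((2 * Real.pi * (k i : ℝ) / L : ℝ) : ℂ) * coeff u m i‖ := by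
    rw [← abs_of_pos hμ, ← Real.norm_eq_abs, ← Complex.norm_real, ← norm_mul, Finset.mul_sum]
    congr 1
    refine Finset.sum_congr rfl fun i _ => ?_
    push_cast; ring
  rw [h1]
  refine (norm_sum_mul_le _ _).trans_eq ?_
  simp only [Complex.norm_real, Real.norm_eq_abs, sq_abs]
  rfl

lemma abs_triTerm_le (u v w : L2Field L) (l k : Fin 3 → ℤ) :
    |triTerm u v w l k| ≤
      L ^ 3 * (2 * Real.pi / L * ‖∑ i, (k i : ℂ) * coeff u (k - l) i‖) * (amp w l * amp v k) := by
  have hμ := two_pi_div_pos (L := L)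
  have h3 := pow_pos hL.out 3
  refine (Complex.abs_re_le_norm _).trans ?_
  rw [norm_mul, norm_mul]
  have e : ‖-((L : ℂ) ^ 3 * (2 * Real.pi * Complex.I / L))‖ = L ^ 3 * (2 * Real.pi / L) := by
    have : -((L : ℂ) ^ 3 * (2 * Real.pi * Complex.I / L)) =
        ((L ^ 3 * (2 * Real.pi / L) : ℝ) : ℂ) * -Complex.I := by push_cast; ring
    rw [this, norm_mul, norm_neg, Complex.norm_I, mul_one, Complex.norm_real, Real.norm_eq_abs,
      abs_of_pos (mul_pos h3 hμ)]
  rw [e, mul_assoc (L ^ 3)]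
  refine mul_le_mul_of_nonneg_left ?_ (by positivity)
  refine (norm_sum_mul_le _ _).trans_eq ?_
  simp only [RCLike.norm_conj]
  rfl

lemma abs_triTerm_le_left (u v w : L2Field L) (l k : Fin 3 → ℤ) :
    |triTerm u v w l k| ≤
      L ^ 3 * (amp u (k - l) * (Real.sqrt (eigenvalue L k) * amp v k) * amp w l) := by
  have h3 := pow_pos hL.out 3
  have h1 := amp_nonneg w l
  have h2 := amp_nonneg v k
  refine (abs_triTerm_le u v w l k).trans ?_
  have := norm_sum_freq_le u k (k - l)
  calc _ ≤ L ^ 3 * (Real.sqrt (eigenvalue L k) * amp u (k - l)) * (amp w l * amp v k) := by gcongr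
    _ = _ := by ring

/-- Integration by parts in Fourier variables: `u` is divergence free, so its coefficient at `k - l`
is orthogonal to `k - l`, and the derivative may be put on the frequency `l` of the test field. -/
lemma abs_triTerm_le_right {u : L2Field L} (hu : u ∈ V₀ L) (v w : L2Field L) (l k : Fin 3 → ℤ) :
    |triTerm u v w l k| ≤
      L ^ 3 * (amp u (k - l) * amp v k * (Real.sqrt (eigenvalue L l) * amp w l)) := by
  have h3 := pow_pos hL.out 3
  have h1 := amp_nonneg w l
  have h2 := amp_nonneg v k
  have e : ∑ i, (k i : ℂ) * coeff u (k - l) i = ∑ i, (l i : ℂ) * coeff u (k - l) i := by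
    rw [← sub_eq_zero, ← Finset.sum_sub_distrib, ← hu.2 (k - l)]
    refine Finset.sum_congr rfl fun i _ => ?_
    rw [Pi.sub_apply]; push_cast; ring
  refine (abs_triTerm_le u v w l k).trans ?_
  rw [e]
  have := norm_sum_freq_le u l (k - l)
  calc _ ≤ L ^ 3 * (Real.sqrt (eigenvalue L l) * amp u (k - l)) * (amp w l * amp v k) := by gcongr
    _ = _ := by ring

/-- With the derivative on the fixed frequency `l`, square summability of `u` and `v` is enough. -/
lemma summable_triTerm {u : L2Field L} (hu : u ∈ V₀ L) (v w : L2Field L) (l : Fin 3 → ℤ) :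
    Summable (triTerm u v w l) := by
  have h3 := pow_pos hL.out 3
  have h1 : Summable fun k => amp u (k - l) ^ 2 :=
    (Equiv.subRight l).summable_iff.mpr (summable_amp_sq u)
  have h2 := ((h1.add (summable_amp_sq v)).mul_left (Real.sqrt (eigenvalue L l) * amp w l)).mul_left
    (L ^ 3)
  refine Summable.of_norm_bounded h2 fun k => ?_
  refine (abs_triTerm_le_right hu v w l k).trans ?_
  have h4 := amp_nonneg w l
  rw [mul_comm (amp u (k - l) * amp v k)]
  gcongr
  nlinarith [sq_nonneg (amp u (k - l) - amp v k), sq_nonneg (amp u (k - l)), sq_nonneg (amp v k)]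

/-- The amplitude as an extended nonnegative real. -/
def eamp (u : L2Field L) (k : Fin 3 → ℤ) : ℝ≥0∞ := ENNReal.ofReal (amp u k)

lemma eamp_neg_index (u : L2Field L) (k : Fin 3 → ℤ) : eamp u (-k) = eamp u k := by
  rw [eamp, amp_neg_index, eamp]

lemma eamp_zero_mode {u : L2Field L} (hu : u ∈ V₀ L) : eamp u 0 = 0 := by
  rw [eamp, amp_zero_mode hu, ENNReal.ofReal_zero]

lemma sobSq_eq_ev {s : ℝ} (hs : 0 ≤ s) (u : L2Field L) :
    sobSq s u = ENNReal.ofReal (L ^ 3) * ∑' k, ev L k ^ s * eamp u k ^ 2 := by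
  rw [sobSq_eq, ← ENNReal.tsum_mul_left]
  refine tsum_congr fun k => ?_
  have h3 := pow_pos hL.out 3
  have h0 := eigenvalue_nonneg (L := L) k
  rw [sobTerm, ev, eamp, ENNReal.ofReal_rpow_of_nonneg h0 hs, ← ENNReal.ofReal_pow (amp_nonneg _ _),
    ← ENNReal.ofReal_mul (by positivity), ← ENNReal.ofReal_mul (by positivity), mul_assoc]

lemma enorm_tri_le {S : Finset (Fin 3 → ℤ)} {u v w : L2Field L}
    {β γ : (Fin 3 → ℤ) → ℝ≥0∞}
    (h : ∀ k, ∀ l ∈ S, ENNReal.ofReal |triTerm u v w l k| ≤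
      ENNReal.ofReal (L ^ 3) * (eamp u (k - l) * β k * γ l)) :
    ‖tri S u v w‖ₑ ≤ ENNReal.ofReal (L ^ 3) * ∑' k, ∑' l, eamp u (k - l) * β k * γ l := by
  have h1 : ‖tri S u v w‖ₑ ≤ ∑ l ∈ S, ∑' k, ENNReal.ofReal |triTerm u v w l k| := by
    refine (enorm_sum_le _ _).trans (Finset.sum_le_sum fun l _ => ?_)
    by_cases hs : Summable (triTerm u v w l)
    · refine (Real.enorm_eq_ofReal_abs _).trans_le ?_
      rw [← ENNReal.ofReal_tsum_of_nonneg (fun _ => abs_nonneg _) hs.abs]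
      apply ENNReal.ofReal_le_ofReal
      simpa only [Real.norm_eq_abs] using norm_tsum_le_tsum_norm hs.norm
    · rw [tsum_eq_zero_of_not_summable hs, enorm_zero]; exact zero_le
  refine h1.trans ?_
  have h2 : ∑ l ∈ S, ∑' k, ENNReal.ofReal |triTerm u v w l k| ≤
      ∑ l ∈ S, ∑' k, ENNReal.ofReal (L ^ 3) * (eamp u (k - l) * β k * γ l) :=
    Finset.sum_le_sum fun l hl => ENNReal.tsum_le_tsum fun k => h k l hl
  refine h2.trans ((ENNReal.sum_le_tsum S).trans ?_)
  rw [ENNReal.tsum_comm]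
  simp only [ENNReal.tsum_mul_left]
  exact le_rfl

/-- Convolution estimate, the unweighted factor being `β`. -/
lemma conv_le_mid {s : ℝ} (hs0 : 1 / 4 ≤ s) (hs : s ≤ 5 / 4) {α β γ : (Fin 3 → ℤ) → ℝ≥0∞}
    (hα : α 0 = 0) (hγ : γ 0 = 0) :
    (∑' k, ∑' l, α (k - l) * β k * γ l) ^ 2 ≤
      4 * latticeConst L * (∑' m, ev L m ^ s * α m ^ 2) *
        (∑' l, ev L l ^ (3 / 2 - s) * γ l ^ 2) * ∑' k, β k ^ 2 := by
  refine le_trans (le_of_eq ?_) (conv_le hs0 hs hα hγ)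
  congr 1
  rw [ENNReal.tsum_comm, ENNReal.tsum_comm (f := fun m l => α m * γ l * β (m + l))]
  refine tsum_congr fun l => ?_
  rw [← (Equiv.addRight l).tsum_eq]
  refine tsum_congr fun m => ?_
  simp only [Equiv.coe_addRight, add_sub_cancel_right]
  ring

/-- Convolution estimate, the unweighted factor being `γ`. -/
lemma conv_le_right {s : ℝ} (hs0 : 1 / 4 ≤ s) (hs : s ≤ 5 / 4) {α β γ : (Fin 3 → ℤ) → ℝ≥0∞}
    (hα : α 0 = 0) (hβ : β 0 = 0) (heven : ∀ k, α (-k) = α k) :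
    (∑' k, ∑' l, α (k - l) * β k * γ l) ^ 2 ≤
      4 * latticeConst L * (∑' m, ev L m ^ s * α m ^ 2) *
        (∑' k, ev L k ^ (3 / 2 - s) * β k ^ 2) * ∑' l, γ l ^ 2 := by
  refine le_trans (le_of_eq ?_) (conv_le hs0 hs hα hβ)
  congr 1
  rw [ENNReal.tsum_comm (f := fun m l => α m * β l * γ (m + l))]
  refine tsum_congr fun k => ?_
  rw [← (Equiv.addRight k).tsum_eq]
  refine tsum_congr fun m => ?_
  simp only [Equiv.coe_addRight]
  rw [← heven (k - (m + k))]
  congr 2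
  abel_nf

/-- Convolution estimate, the unweighted factor being `α`. -/
lemma conv_le_left {s : ℝ} (hs0 : 1 / 4 ≤ s) (hs : s ≤ 5 / 4) {α β γ : (Fin 3 → ℤ) → ℝ≥0∞}
    (hβ : β 0 = 0) (hγ : γ 0 = 0) (heven : ∀ k, γ (-k) = γ k) :
    (∑' k, ∑' l, α (k - l) * β k * γ l) ^ 2 ≤
      4 * latticeConst L * (∑' m, ev L m ^ s * β m ^ 2) *
        (∑' k, ev L k ^ (3 / 2 - s) * γ k ^ 2) * ∑' l, α l ^ 2 := by
  refine le_trans (le_of_eq ?_) (conv_le hs0 hs hβ hγ)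
  congr 1
  refine tsum_congr fun k => ?_
  rw [← (Equiv.neg _).tsum_eq]
  refine tsum_congr fun l => ?_
  simp only [Equiv.neg_apply, sub_neg_eq_add, heven]
  ring

/-- Since 4 · 52 = 208 < 6³ < (2π)³, the numerical factors are absorbed. The trilinear estimates
therefore hold with constant 1 for every L, which makes the final Gronwall constant absolute. -/
lemma latticeConst_bound :
    ENNReal.ofReal (L ^ 3) ^ 2 * (4 * latticeConst L) ≤ ENNReal.ofReal (L ^ 3) ^ 3 := by
  have h3 := pow_pos hL.out 3
  have h4 : (4 : ℝ≥0∞) = ENNReal.ofReal 4 := by simp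
  have hμ := two_pi_div_pos (L := L)
  rw [latticeConst, h4, ← ENNReal.ofReal_mul (by norm_num), ← ENNReal.ofReal_pow h3.le,
    ← ENNReal.ofReal_pow h3.le, ← ENNReal.ofReal_mul (by positivity)]
  apply ENNReal.ofReal_le_ofReal
  rw [pow_succ (L ^ 3) 2]
  refine mul_le_mul_of_nonneg_left ?_ (by positivity)
  have e : (2 * Real.pi / L) ^ (-3 : ℝ) = L ^ 3 / (2 * Real.pi) ^ 3 := by
    rw [Real.rpow_neg hμ.le, show (3 : ℝ) = ((3 : ℕ) : ℝ) by norm_num, Real.rpow_natCast, div_pow,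
      inv_div]
  rw [e]
  have hp : (208 : ℝ) ≤ (2 * Real.pi) ^ 3 := by
    have := Real.pi_gt_three
    calc (208 : ℝ) ≤ (2 * 3) ^ 3 := by norm_num
      _ ≤ _ := by gcongr
  rw [← mul_assoc, ← mul_div_assoc, div_le_iff₀ (by positivity)]
  nlinarith

/-- The squared prefactor L⁶ and the lattice constant together are at most L⁹, and each of the three
squared norms takes one factor L³. -/
lemma le_of_conv {x Φ A B C A' B' C' : ℝ≥0∞} (hx : x ≤ ENNReal.ofReal (L ^ 3) * Φ)
    (hΦ : Φ ^ 2 ≤ 4 * latticeConst L * A * B * C) (hA : ENNReal.ofReal (L ^ 3) * A ≤ A')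
    (hB : ENNReal.ofReal (L ^ 3) * B ≤ B') (hC : ENNReal.ofReal (L ^ 3) * C ≤ C') :
    x ^ 2 ≤ A' * B' * C' := by
  calc x ^ 2 ≤ (ENNReal.ofReal (L ^ 3) * Φ) ^ 2 := pow_le_pow_left' hx 2
    _ = ENNReal.ofReal (L ^ 3) ^ 2 * Φ ^ 2 := mul_pow _ _ _
    _ ≤ ENNReal.ofReal (L ^ 3) ^ 2 * (4 * latticeConst L * A * B * C) := by gcongr
    _ = ENNReal.ofReal (L ^ 3) ^ 2 * (4 * latticeConst L) * (A * B * C) := by ring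
    _ ≤ ENNReal.ofReal (L ^ 3) ^ 3 * (A * B * C) := by gcongr; exact latticeConst_bound
    _ = (ENNReal.ofReal (L ^ 3) * A) * (ENNReal.ofReal (L ^ 3) * B) *
        (ENNReal.ofReal (L ^ 3) * C) := by ring
    _ ≤ A' * B' * C' := by gcongr

lemma ofReal_sqrt_eigenvalue {L : ℝ} (k : Fin 3 → ℤ) :
    ENNReal.ofReal (Real.sqrt (eigenvalue L k)) = ev L k ^ (1 / 2 : ℝ) := by
  rw [Real.sqrt_eq_rpow, ev, ENNReal.ofReal_rpow_of_nonneg (eigenvalue_nonneg k) (by norm_num)]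

lemma sq_half_rpow_mul (x y : ℝ≥0∞) : (x ^ (1 / 2 : ℝ) * y) ^ 2 = x * y ^ 2 := by
  rw [mul_pow, ← ENNReal.rpow_two, ← ENNReal.rpow_mul]
  norm_num

lemma ofReal_triTerm_le_left (u v w : L2Field L) (l k : Fin 3 → ℤ) :
    ENNReal.ofReal |triTerm u v w l k| ≤
      ENNReal.ofReal (L ^ 3) * (eamp u (k - l) * (ev L k ^ (1 / 2 : ℝ) * eamp v k) * eamp w l) := by
  have h3 := pow_pos hL.out 3
  have h1 := amp_nonneg w l
  have h2 := amp_nonneg v k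
  have h4 := amp_nonneg u (k - l)
  refine (ENNReal.ofReal_le_ofReal (abs_triTerm_le_left u v w l k)).trans_eq ?_
  rw [ENNReal.ofReal_mul h3.le, ENNReal.ofReal_mul (by positivity), ENNReal.ofReal_mul h4,
    ENNReal.ofReal_mul (by positivity), ofReal_sqrt_eigenvalue]
  rfl

lemma ofReal_triTerm_le_right {u : L2Field L} (hu : u ∈ V₀ L) (v w : L2Field L)
    (l k : Fin 3 → ℤ) :
    ENNReal.ofReal |triTerm u v w l k| ≤
      ENNReal.ofReal (L ^ 3) * (eamp u (k - l) * eamp v k * (ev L l ^ (1 / 2 : ℝ) * eamp w l)) := by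
  have h3 := pow_pos hL.out 3
  have h1 := amp_nonneg w l
  have h2 := amp_nonneg v k
  have h4 := amp_nonneg u (k - l)
  refine (ENNReal.ofReal_le_ofReal (abs_triTerm_le_right hu v w l k)).trans_eq ?_
  rw [ENNReal.ofReal_mul h3.le, ENNReal.ofReal_mul (by positivity), ENNReal.ofReal_mul h4,
    ENNReal.ofReal_mul (by positivity), ofReal_sqrt_eigenvalue]
  rfl

lemma tsum_ev_rpow_mul_ev {s : ℝ} (hs : 0 ≤ s) (u : L2Field L) :
    ENNReal.ofReal (L ^ 3) * ∑' k, ev L k ^ s * (ev L k ^ (1 / 2 : ℝ) * eamp u k) ^ 2 =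
      sobSq (s + 1) u := by
  rw [sobSq_eq_ev (by linarith)]
  congr 1
  refine tsum_congr fun k => ?_
  rw [sq_half_rpow_mul, ← mul_assoc, ENNReal.rpow_add_of_nonneg _ _ hs zero_le_one,
    ENNReal.rpow_one]

lemma tsum_ev_half (u : L2Field L) :
    ENNReal.ofReal (L ^ 3) * ∑' k, (ev L k ^ (1 / 2 : ℝ) * eamp u k) ^ 2 = sobSq 1 u := by
  have := tsum_ev_rpow_mul_ev le_rfl u
  simpa only [ENNReal.rpow_zero, one_mul, zero_add] using this

lemma tsum_eamp_sq (u : L2Field L) :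
    ENNReal.ofReal (L ^ 3) * ∑' k, eamp u k ^ 2 = sobSq 0 u := by
  rw [sobSq_eq_ev le_rfl]
  simp only [ENNReal.rpow_zero, one_mul]

variable {S : Finset (Fin 3 → ℤ)} {u v w : L2Field L}

lemma eamp_trunc_of_mem (hS : ∀ k, k ∈ S → -k ∈ S) {l : Fin 3 → ℤ} (hl : l ∈ S) (w : L2Field L) :
    eamp (trunc S w) l = eamp w l := by
  rw [eamp, amp_trunc hS, if_pos hl, eamp]

/-- `|b(u, v, P_S w)| ≤ ‖u‖ₛ ‖P_S w‖_{3/2-s} ‖v‖₁`. -/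
lemma enorm_tri_sq_le_gradient (hS : ∀ k, k ∈ S → -k ∈ S) {s : ℝ}
    (hs0 : 1 / 4 ≤ s) (hs : s ≤ 5 / 4) (hu : u ∈ V₀ L)
    (hw : w ∈ V₀ L) :
    ‖tri S u v w‖ₑ ^ 2 ≤ sobSq s u * sobSq (3 / 2 - s) (trunc S w) * sobSq 1 v := by
  have h := enorm_tri_le (S := S) (u := u) (v := v) (w := w)
    (β := fun k => ev L k ^ (1 / 2 : ℝ) * eamp v k) (γ := eamp (trunc S w)) (fun k l hl => by
      rw [eamp_trunc_of_mem hS hl]; exact ofReal_triTerm_le_left u v w l k)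
  refine le_of_conv h (conv_le_mid hs0 hs (eamp_zero_mode hu) (eamp_zero_mode (trunc_mem hS hw)))
    (sobSq_eq_ev (by linarith) u).ge (sobSq_eq_ev (by linarith) _).ge (tsum_ev_half v).le

/-- `|b(u, v, P_S w)| ≤ ‖u‖ₛ ‖v‖_{3/2-s} ‖P_S w‖₁`. -/
lemma enorm_tri_sq_le_test (hS : ∀ k, k ∈ S → -k ∈ S) {s : ℝ}
    (hs0 : 1 / 4 ≤ s) (hs : s ≤ 5 / 4) (hu : u ∈ V₀ L)
    (hv : v ∈ V₀ L) :
    ‖tri S u v w‖ₑ ^ 2 ≤ sobSq s u * sobSq (3 / 2 - s) v * sobSq 1 (trunc S w) := by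
  have h := enorm_tri_le (S := S) (u := u) (v := v) (w := w)
    (β := eamp v) (γ := fun l => ev L l ^ (1 / 2 : ℝ) * eamp (trunc S w) l) (fun k l hl => by
      rw [eamp_trunc_of_mem hS hl]; exact ofReal_triTerm_le_right hu v w l k)
  refine le_of_conv h (conv_le_right hs0 hs (eamp_zero_mode hu) (eamp_zero_mode hv)
    (eamp_neg_index u)) (sobSq_eq_ev (by linarith) u).ge (sobSq_eq_ev (by linarith) _).ge
    (tsum_ev_half _).le

/-- `|b(u, v, P_S w)| ≤ ‖v‖_{5/4} ‖P_S w‖_{5/4} ‖u‖`. -/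
lemma enorm_tri_sq_le_of_left (hS : ∀ k, k ∈ S → -k ∈ S) (hw : w ∈ V₀ L) (hv : v ∈ V₀ L) :
    ‖tri S u v w‖ₑ ^ 2 ≤ sobSq (5 / 4) v * sobSq (5 / 4) (trunc S w) * sobSq 0 u := by
  have h := enorm_tri_le (S := S) (u := u) (v := v) (w := w)
    (β := fun k => ev L k ^ (1 / 2 : ℝ) * eamp v k) (γ := eamp (trunc S w)) (fun k l hl => by
      rw [eamp_trunc_of_mem hS hl]; exact ofReal_triTerm_le_left u v w l k)
  -- The derivative on `v` already contributes 1 to its exponent, so s = 1/4 gives 5/4 for `v` and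
  -- 3/2 - 1/4 = 5/4 for the test field.
  refine le_of_conv h (conv_le_left (s := 1 / 4) (by norm_num) (by norm_num)
    (by rw [eamp_zero_mode hv, mul_zero]) (eamp_zero_mode (trunc_mem hS hw))
    (eamp_neg_index _)) ?_ ?_ (tsum_eamp_sq u).le
  · rw [tsum_ev_rpow_mul_ev (by norm_num)]; norm_num
  · rw [sobSq_eq_ev (by norm_num)]; norm_num

/-- `|b(u, v, P_S w)| ≤ ‖u‖_{5/4} ‖P_S w‖_{5/4} ‖v‖`. -/
lemma enorm_tri_sq_le_of_mid (hS : ∀ k, k ∈ S → -k ∈ S) (hu : u ∈ V₀ L) (hw : w ∈ V₀ L) :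
    ‖tri S u v w‖ₑ ^ 2 ≤ sobSq (5 / 4) u * sobSq (5 / 4) (trunc S w) * sobSq 0 v := by
  have h := enorm_tri_le (S := S) (u := u) (v := v) (w := w)
    (β := eamp v) (γ := fun l => ev L l ^ (1 / 2 : ℝ) * eamp (trunc S w) l) (fun k l hl => by
      rw [eamp_trunc_of_mem hS hl]; exact ofReal_triTerm_le_right hu v w l k)
  refine le_of_conv h (conv_le_mid (s := 5 / 4) (by norm_num) (by norm_num)
    (eamp_zero_mode hu) (by rw [eamp_zero_mode (trunc_mem hS hw), mul_zero])) ?_ ?_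
    (tsum_eamp_sq v).le
  · rw [sobSq_eq_ev (by norm_num)]
  · rw [tsum_ev_rpow_mul_ev (by norm_num)]; norm_num

end TriBounds

/-! ### Algebraic properties of the Fourier forms -/

section Forms

open scoped ComplexConjugate

variable {L : ℝ} [hL : Fact (0 < L)] {S : Finset (Fin 3 → ℤ)}

lemma triTerm_sub_left (u u' v w : L2Field L) (l k : Fin 3 → ℤ) :
    triTerm (u - u') v w l k = triTerm u v w l k - triTerm u' v w l k := by
  simp only [triTerm, coeff_sub, mul_sub, Finset.sum_sub_distrib, sub_mul, Complex.sub_re]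

lemma triTerm_sub_mid (u v v' w : L2Field L) (l k : Fin 3 → ℤ) :
    triTerm u (v - v') w l k = triTerm u v w l k - triTerm u v' w l k := by
  simp only [triTerm, coeff_sub, map_sub, mul_sub, Finset.sum_sub_distrib, Complex.sub_re]

lemma triTerm_add_right (u v w w' : L2Field L) (l k : Fin 3 → ℤ) :
    triTerm u v (w + w') l k = triTerm u v w l k + triTerm u v w' l k := by
  simp only [triTerm, coeff_add, add_mul, mul_add, Finset.sum_add_distrib, Complex.add_re]

lemma triTerm_smul_right (c : ℝ) (u v w : L2Field L) (l k : Fin 3 → ℤ) :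
    triTerm u v (c • w) l k = c * triTerm u v w l k := by
  simp only [triTerm, coeff_smul]
  rw [← Complex.re_ofReal_mul]
  congr 1
  simp only [mul_assoc, ← Finset.mul_sum]
  ring

lemma tri_sub_left {u u' : L2Field L} (hu : u ∈ V₀ L) (hu' : u' ∈ V₀ L) (v w : L2Field L) :
    tri S (u - u') v w = tri S u v w - tri S u' v w := by
  simp only [tri, triTerm_sub_left, ← Finset.sum_sub_distrib]
  exact Finset.sum_congr rfl fun l _ =>
    (summable_triTerm hu v w l).tsum_sub (summable_triTerm hu' v w l)

lemma tri_sub_mid {u : L2Field L} (hu : u ∈ V₀ L) (v v' w : L2Field L) :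
    tri S u (v - v') w = tri S u v w - tri S u v' w := by
  simp only [tri, triTerm_sub_mid, ← Finset.sum_sub_distrib]
  exact Finset.sum_congr rfl fun l _ =>
    (summable_triTerm hu v w l).tsum_sub (summable_triTerm hu v' w l)

lemma tri_add_right {u : L2Field L} (hu : u ∈ V₀ L) (v w w' : L2Field L) :
    tri S u v (w + w') = tri S u v w + tri S u v w' := by
  simp only [tri, triTerm_add_right, ← Finset.sum_add_distrib]
  exact Finset.sum_congr rfl fun l _ =>
    (summable_triTerm hu v w l).tsum_add (summable_triTerm hu v w' l)

lemma tri_smul_right (c : ℝ) (u v w : L2Field L) :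
    tri S u v (c • w) = c * tri S u v w := by
  simp only [tri, triTerm_smul_right, tsum_mul_left, Finset.mul_sum]

lemma tri_congr_right {w w' : L2Field L} (u v : L2Field L)
    (h : ∀ k ∈ S, ∀ j, coeff w k j = coeff w' k j) : tri S u v w = tri S u v w' := by
  unfold tri triTerm
  refine Finset.sum_congr rfl fun l hl => ?_
  simp only [h l hl]

/-- Complex conjugation preserves the real part and exchanges `k` and `l`, up to the sign of the
factor i from the derivative; incompressibility identifies the two frequency factors. -/
lemma triTerm_antisymm {u : L2Field L} (hu : u ∈ V₀ L) (w : L2Field L) (l k : Fin 3 → ℤ) :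
    triTerm u w w l k = -triTerm u w w k l := by
  have e : ∑ i, (k i : ℂ) * coeff u (l - k) i = ∑ i, (l i : ℂ) * coeff u (l - k) i := by
    rw [eq_comm, ← sub_eq_zero, ← Finset.sum_sub_distrib, ← hu.2 (l - k)]
    refine Finset.sum_congr rfl fun i _ => ?_
    rw [Pi.sub_apply]; push_cast; ring
  have e2 : conj (∑ i, (k i : ℂ) * coeff u (k - l) i) = ∑ i, (l i : ℂ) * coeff u (l - k) i := by
    rw [← e, map_sum]
    refine Finset.sum_congr rfl fun i _ => ?_
    rw [map_mul, conj_coeff, neg_sub, map_intCast]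
  have e3 : conj (∑ j, coeff w l j * conj (coeff w k j)) =
      ∑ j, coeff w k j * conj (coeff w l j) := by
    rw [map_sum]
    refine Finset.sum_congr rfl fun i _ => ?_
    rw [map_mul, Complex.conj_conj, mul_comm]
  unfold triTerm
  rw [← Complex.conj_re, map_mul, map_mul, e2, e3, ← Complex.neg_re]
  congr 1
  simp only [map_neg, map_mul, map_div₀, map_pow, Complex.conj_ofReal, Complex.conj_I, map_ofNat]
  ring

/-- Truncating the middle argument confines both frequencies to `S`, and an antisymmetric finite
array sums to zero. This is b(u, P_S w, P_S w) = 0 without any convergence question. -/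
lemma tri_trunc_self (hS : ∀ k, k ∈ S → -k ∈ S) {u : L2Field L} (hu : u ∈ V₀ L)
    (w : L2Field L) : tri S u (trunc S w) w = 0 := by
  have h1 : tri S u (trunc S w) w = ∑ l ∈ S, ∑ k ∈ S, triTerm u w w l k := by
    unfold tri
    refine Finset.sum_congr rfl fun l _ => ?_
    rw [tsum_eq_sum (s := S)]
    · refine Finset.sum_congr rfl fun k hk => ?_
      simp only [triTerm, coeff_trunc hS, if_pos hk]
    · intro k hk
      simp only [triTerm, coeff_trunc hS, if_neg hk, map_zero, mul_zero, Finset.sum_const_zero,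
        Complex.zero_re]
  have h2 : ∑ l ∈ S, ∑ k ∈ S, triTerm u w w l k = -∑ l ∈ S, ∑ k ∈ S, triTerm u w w l k := by
    conv_lhs => rw [Finset.sum_comm]
    rw [← Finset.sum_neg_distrib]
    refine Finset.sum_congr rfl fun l _ => ?_
    rw [← Finset.sum_neg_distrib]
    exact Finset.sum_congr rfl fun k _ => triTerm_antisymm hu w k l
  rw [h1]
  linarith

/-- The difference of the nonlinear terms, tested against the truncated difference. -/
lemma tri_difference (hS : ∀ k, k ∈ S → -k ∈ S) {u u' : L2Field L} (hu : u ∈ V₀ L)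
    (hu' : u' ∈ V₀ L) :
    tri S u u (u - u') - tri S u' u' (u - u') =
      tri S u ((u - u') - trunc S (u - u')) (u - u') + tri S (u - u') u' (u - u') := by
  rw [tri_sub_mid hu, tri_trunc_self hS hu, tri_sub_mid hu, tri_sub_left hu hu']
  ring

lemma tsum_abs_triTerm_le {u : L2Field L} (hu : u ∈ V₀ L) (v w : L2Field L) (l : Fin 3 → ℤ) :
    |∑' k, triTerm u v w l k| ≤
      Real.sqrt (eigenvalue L l) * amp w l * (‖u‖ ^ 2 + ‖v‖ ^ 2) := by
  have h3 := pow_pos hL.out 3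
  have h4 := amp_nonneg w l
  have h1 : HasSum (fun k => L ^ 3 * amp u (k - l) ^ 2) (‖u‖ ^ 2) :=
    (Equiv.subRight l).hasSum_iff.mpr (hasSum_norm_sq u)
  have h2 := ((h1.add (hasSum_norm_sq v)).mul_left (Real.sqrt (eigenvalue L l) * amp w l))
  rw [← Real.norm_eq_abs]
  refine tsum_of_norm_bounded h2 fun k => ?_
  refine (abs_triTerm_le_right hu v w l k).trans ?_
  rw [mul_comm (amp u (k - l) * amp v k), ← mul_assoc, mul_comm (L ^ 3), mul_assoc, ← mul_add]
  gcongr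
  nlinarith [sq_nonneg (amp u (k - l) - amp v k), sq_nonneg (amp u (k - l)), sq_nonneg (amp v k)]

/-- For a fixed test field with finitely many modes the L² norms suffice, so the nonlinear term
stays bounded in time along a solution. -/
lemma abs_tri_le {u : L2Field L} (hu : u ∈ V₀ L) (v w : L2Field L) :
    |tri S u v w| ≤
      (∑ l ∈ S, Real.sqrt (eigenvalue L l) * amp w l) * (‖u‖ ^ 2 + ‖v‖ ^ 2) := by
  rw [Finset.sum_mul]
  exact (Finset.abs_sum_le_sum_abs _ _).trans
    (Finset.sum_le_sum fun l _ => tsum_abs_triTerm_le hu v w l)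

/-- The part of the form `(A^{s/2} u, A^{s/2} v)` carried by the modes in `S`. -/
def partForm (S : Finset (Fin 3 → ℤ)) (s : ℝ) (u v : L2Field L) : ℝ :=
  ∑ k ∈ S, L ^ 3 * eigenvalue L k ^ s * ∑ j, (coeff u k j * conj (coeff v k j)).re

lemma powForm_eq_partForm (s : ℝ) (u : L2Field L) {v : L2Field L}
    (hv : ∀ k, k ∉ S → ∀ j, coeff v k j = 0) : powForm s u v = partForm S s u v := by
  rw [powForm, tsum_eq_sum (s := S)]
  · rfl
  · intro k hk
    simp [hv k hk]

lemma inner_eq_partForm (u : L2Field L) {v : L2Field L}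
    (hv : ∀ k, k ∉ S → ∀ j, coeff v k j = 0) : inner ℝ u v = partForm S 0 u v := by
  rw [← (hasSum_inner u v).tsum_eq, tsum_eq_sum (s := S)]
  · simp only [partForm, Real.rpow_zero, mul_one]
  · intro k hk
    simp [hv k hk]

lemma partForm_add_right (s : ℝ) (u v v' : L2Field L) :
    partForm S s u (v + v') = partForm S s u v + partForm S s u v' := by
  simp only [partForm, coeff_add, map_add, mul_add, Complex.add_re, Finset.sum_add_distrib]

lemma partForm_smul_right (s c : ℝ) (u v : L2Field L) :
    partForm S s u (c • v) = c * partForm S s u v := by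
  simp only [partForm, coeff_smul, map_mul, Complex.conj_ofReal, mul_left_comm _ (c : ℂ),
    Complex.re_ofReal_mul, ← Finset.mul_sum, mul_left_comm _ c]

lemma partForm_sub_left (s : ℝ) (u u' v : L2Field L) :
    partForm S s (u - u') v = partForm S s u v - partForm S s u' v := by
  simp only [partForm, coeff_sub, sub_mul, mul_sub, Complex.sub_re, Finset.sum_sub_distrib]

lemma partForm_congr_right (s : ℝ) {w w' : L2Field L} (u : L2Field L)
    (h : ∀ k ∈ S, ∀ j, coeff w k j = coeff w' k j) : partForm S s u w = partForm S s u w' := by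
  unfold partForm
  refine Finset.sum_congr rfl fun k hk => ?_
  simp only [h k hk]

lemma partForm_self (s : ℝ) (u : L2Field L) : partForm S s u u = ∑ k ∈ S, sobTerm s u k := by
  unfold partForm sobTerm
  simp only [amp_sq]
  refine Finset.sum_congr rfl fun k _ => ?_
  congr 1
  refine Finset.sum_congr rfl fun j _ => ?_
  rw [Complex.mul_conj, Complex.normSq_eq_norm_sq, Complex.ofReal_re]

lemma abs_partForm_le (s : ℝ) (u v : L2Field L) :
    |partForm S s u v| ≤
      Real.sqrt (∑ k ∈ S, sobTerm s u k) * Real.sqrt (∑ k ∈ S, sobTerm s v k) := by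
  have h3 := pow_pos hL.out 3
  unfold partForm
  refine (Finset.abs_sum_le_sum_abs _ _).trans ?_
  have h1 : ∀ k ∈ S, |L ^ 3 * eigenvalue L k ^ s * ∑ j, (coeff u k j * conj (coeff v k j)).re| ≤
      Real.sqrt (sobTerm s u k) * Real.sqrt (sobTerm s v k) := by
    intro k _
    have h0 := Real.rpow_nonneg (eigenvalue_nonneg (L := L) k) s
    have h4 : |∑ j, (coeff u k j * conj (coeff v k j)).re| ≤ amp u k * amp v k := by
      rw [← Complex.re_sum]
      refine (Complex.abs_re_le_norm _).trans ((norm_sum_mul_le _ _).trans_eq ?_)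
      simp only [RCLike.norm_conj]; rfl
    rw [abs_mul, abs_of_nonneg (by positivity), ← Real.sqrt_mul (sobTerm_nonneg s u k)]
    have h5 : sobTerm s u k * sobTerm s v k =
        (L ^ 3 * eigenvalue L k ^ s * (amp u k * amp v k)) ^ 2 := by
      unfold sobTerm; ring
    have := amp_nonneg u k
    have := amp_nonneg v k
    rw [h5, Real.sqrt_sq (by positivity)]
    gcongr
  refine (Finset.sum_le_sum h1).trans ?_
  refine (Real.sum_mul_le_sqrt_mul_sqrt _ _ _).trans_eq ?_
  simp only [Real.sq_sqrt (sobTerm_nonneg _ _ _)]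

lemma norm_trunc_sq (hS : ∀ k, k ∈ S → -k ∈ S) (u : L2Field L) :
    ‖trunc S u‖ ^ 2 = ∑ k ∈ S, sobTerm 0 u k := by
  have h := sobSq_trunc hS 0 u
  rw [sobSq_zero_exponent] at h
  exact (ENNReal.ofReal_eq_ofReal_iff (by positivity)
    (Finset.sum_nonneg fun k _ => sobTerm_nonneg 0 u k)).mp h

end Forms

/-! ### Finite-dimensional spaces of test fields -/

section TestSpace

open scoped ComplexConjugate

variable {L : ℝ} [hL : Fact (0 < L)]

/-- The fields of `V₀` whose frequencies lie in `S`. -/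
def testSpace (L : ℝ) [Fact (0 < L)] (S : Finset (Fin 3 → ℤ)) : Submodule ℝ (L2Field L) where
  carrier := {v | v ∈ V₀ L ∧ ∀ k, k ∉ S → ∀ j, coeff v k j = 0}
  add_mem' := fun {u v} hu hv => ⟨add_mem_V₀ hu.1 hv.1, fun k hk j => by
    rw [coeff_add, hu.2 k hk, hv.2 k hk, add_zero]⟩
  zero_mem' := ⟨zero_mem_V₀, fun _ _ _ => coeff_zero _ _⟩
  smul_mem' := fun c u hu => ⟨smul_mem_V₀ c hu.1, fun k hk j => by
    rw [coeff_smul, hu.2 k hk, mul_zero]⟩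

instance (S : Finset (Fin 3 → ℤ)) : FiniteDimensional ℝ (testSpace L S) := by
  let φ : testSpace L S →ₗ[ℝ] (S → Fin 3 → ℂ) :=
    { toFun := fun v k j => coeff v.1 k.1 j
      map_add' := fun u v => by ext k j; exact coeff_add _ _ _ _
      map_smul' := fun c u => by ext k j; exact coeff_smul _ _ _ _ }
  refine FiniteDimensional.of_injective φ fun u v huv => ?_
  refine Subtype.ext (ext_coeff fun k j => ?_)
  by_cases hk : k ∈ S
  · exact congr_fun (congr_fun huv ⟨k, hk⟩) j
  · rw [u.2.2 k hk, v.2.2 k hk]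

variable {S : Finset (Fin 3 → ℤ)}

lemma trunc_mem_testSpace (hS : ∀ k, k ∈ S → -k ∈ S) {u : L2Field L} (hu : u ∈ V₀ L) :
    trunc S u ∈ testSpace L S :=
  ⟨trunc_mem hS hu, fun k hk j => by rw [coeff_trunc hS, if_neg hk]⟩

lemma trunc_eq_of_mem_testSpace (hS : ∀ k, k ∈ S → -k ∈ S) {v : L2Field L}
    (hv : v ∈ testSpace L S) : trunc S v = v :=
  ext_coeff fun k j => by
    rw [coeff_trunc hS]
    split_ifs with h
    · rfl
    · exact (hv.2 k h j).symm

lemma mem_V_of_mem_testSpace (hS : ∀ k, k ∈ S → -k ∈ S) {v : L2Field L}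
    (hv : v ∈ testSpace L S) (s : ℝ) : v ∈ V L s :=
  trunc_eq_of_mem_testSpace hS hv ▸ trunc_mem_V hS hv.1 s

lemma inner_trunc (hS : ∀ k, k ∈ S → -k ∈ S) (u : L2Field L) {v : L2Field L}
    (hv : v ∈ testSpace L S) : inner ℝ (trunc S u) v = inner ℝ u v := by
  rw [inner_eq_partForm _ hv.2, inner_eq_partForm _ hv.2]
  unfold partForm
  refine Finset.sum_congr rfl fun k hk => ?_
  simp only [coeff_trunc hS, if_pos hk]

/-- An orthonormal basis of the test space, as vectors of `L²`. -/
def testBasis (L : ℝ) [Fact (0 < L)] (S : Finset (Fin 3 → ℤ))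
    (i : Fin (Module.finrank ℝ (testSpace L S))) : L2Field L :=
  (stdOrthonormalBasis ℝ (testSpace L S) i : testSpace L S)

lemma testBasis_mem (i : Fin (Module.finrank ℝ (testSpace L S))) :
    testBasis L S i ∈ testSpace L S := Subtype.coe_prop _

/-- On V₀ the truncation is the orthogonal projection onto the test space. Through this formula the
weak continuity of a solution becomes norm continuity of its truncations. -/
lemma trunc_eq_sum (hS : ∀ k, k ∈ S → -k ∈ S) {u : L2Field L} (hu : u ∈ V₀ L) :
    trunc S u = ∑ i, inner ℝ u (testBasis L S i) • testBasis L S i := by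
  have h := (stdOrthonormalBasis ℝ (testSpace L S)).sum_repr' ⟨_, trunc_mem_testSpace hS hu⟩
  have h2 := congr_arg (Subtype.val) h
  rw [Submodule.coe_sum] at h2
  refine h2.symm.trans (Finset.sum_congr rfl fun i _ => ?_)
  rw [← inner_trunc hS u (testBasis_mem i), real_inner_comm]
  rfl

lemma norm_trunc_sq_eq_sum (hS : ∀ k, k ∈ S → -k ∈ S) {u : L2Field L} (hu : u ∈ V₀ L) :
    ‖trunc S u‖ ^ 2 = ∑ i, (inner ℝ u (testBasis L S i)) ^ 2 := by
  rw [← real_inner_self_eq_norm_sq]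
  conv_lhs => rw [trunc_eq_sum hS hu]
  rw [sum_inner]
  refine Finset.sum_congr rfl fun i _ => ?_
  rw [inner_smul_left, ← trunc_eq_sum hS hu, real_inner_comm (trunc S u),
    inner_trunc hS u (testBasis_mem i)]
  simp [sq]

lemma continuous_coeff (k : Fin 3 → ℤ) (j : Fin 3) :
    Continuous fun u : L2Field L => coeff u k j := by
  have h3 := pow_pos hL.out 3
  let φ : L2Field L →ₗ[ℝ] ℂ :=
    { toFun := fun u => coeff u k j
      map_add' := fun u v => coeff_add _ _ _ _
      map_smul' := fun c u => coeff_smul _ _ _ _ }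
  refine (φ.mkContinuous (Real.sqrt (L ^ 3))⁻¹ fun u => ?_).continuous
  change ‖coeff u k j‖ ≤ _
  have h1 : ‖coeff u k j‖ ^ 2 ≤ amp u k ^ 2 := by
    rw [amp_sq]
    exact Finset.single_le_sum (f := fun j => ‖coeff u k j‖ ^ 2)
      (fun i _ => sq_nonneg _) (Finset.mem_univ j)
  have h2 : L ^ 3 * amp u k ^ 2 ≤ ‖u‖ ^ 2 := by
    have := (hasSum_norm_sq u).summable.le_tsum k (fun i _ => by positivity)
    rwa [(hasSum_norm_sq u).tsum_eq] at this
  have hs := Real.sqrt_pos.mpr h3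
  rw [inv_mul_eq_div, le_div_iff₀ hs]
  refine abs_le_of_sq_le_sq' ?_ (norm_nonneg u) |>.2
  rw [mul_pow, Real.sq_sqrt h3.le]
  nlinarith

end TestSpace

/-! ### The energy identity for finitely many modes -/

section Energy

variable {L : ℝ} [hL : Fact (0 < L)] {S : Finset (Fin 3 → ℤ)}

lemma continuousOn_trunc (hS : ∀ k, k ∈ S → -k ∈ S) {u : ℝ → L2Field L} (hu : MemX0 u) :
    ContinuousOn (fun s => trunc S (u s)) (Ici 0) := by
  have h : ContinuousOn
      (fun s => ∑ i, (inner ℝ (u s) (testBasis L S i) : ℝ) • testBasis L S i) (Ici 0) :=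
    continuousOn_finsetSum _ fun i _ =>
      (hu.weakly_continuous _ (testBasis_mem i).1).smul continuousOn_const
  exact h.congr fun s hs => trunc_eq_sum hS (hu.mem s hs)

lemma continuousOn_coeff {u : ℝ → L2Field L} (hu : MemX0 u) (k : Fin 3 → ℤ) (j : Fin 3) :
    ContinuousOn (fun s => coeff (u s) k j) (Ici 0) := by
  have h := (continuous_coeff k j).comp_continuousOn
    (continuousOn_trunc (S := box (height k)) neg_mem_box hu)
  refine h.congr fun s _ => ?_
  rw [Function.comp_apply, coeff_trunc neg_mem_box, if_pos (mem_box_iff.mpr le_rfl)]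

lemma continuousOn_partForm (s : ℝ) {u w : ℝ → L2Field L}
    (hu : ∀ k j, ContinuousOn (fun t => coeff (u t) k j) (Ici 0))
    (hw : ∀ k j, ContinuousOn (fun t => coeff (w t) k j) (Ici 0)) :
    ContinuousOn (fun t => partForm S s (u t) (w t)) (Ici 0) := by
  unfold partForm
  refine continuousOn_finsetSum _ fun k _ => continuousOn_const.mul
    (continuousOn_finsetSum _ fun j _ => Complex.continuous_re.comp_continuousOn ?_)
  exact (hu k j).mul (Complex.continuous_conj.comp_continuousOn (hw k j))

lemma continuousOn_sum_sobTerm (s : ℝ) {u : ℝ → L2Field L}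
    (hu : ∀ k j, ContinuousOn (fun t => coeff (u t) k j) (Ici 0)) :
    ContinuousOn (fun t => ∑ k ∈ S, sobTerm s (u t) k) (Ici 0) := by
  simp only [← partForm_self]
  exact continuousOn_partForm s hu hu

lemma aemeasurable_sobSq (s : ℝ) {u : ℝ → L2Field L}
    (hu : ∀ k j, ContinuousOn (fun t => coeff (u t) k j) (Ici 0)) (t : ℝ) :
    AEMeasurable (fun r => sobSq s (u r)) (volume.restrict (Icc 0 t)) := by
  simp only [sobSq_eq]
  refine AEMeasurable.tsum fun k => ENNReal.measurable_ofReal.comp_aemeasurable ?_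
  have := continuousOn_sum_sobTerm (S := {k}) s hu
  simp only [Finset.sum_singleton] at this
  exact (this.mono fun x hx => hx.1).aemeasurable measurableSet_Icc

lemma continuousOn_triTerm {u v : ℝ → L2Field L} (hu : MemX0 u) (hv : MemX0 v) (w : L2Field L)
    (l k : Fin 3 → ℤ) : ContinuousOn (fun t => triTerm (u t) (v t) w l k) (Ici 0) := by
  unfold triTerm
  refine Complex.continuous_re.comp_continuousOn ?_
  refine (continuousOn_const.mul ?_).mul ?_
  · exact continuousOn_finsetSum _ fun i _ => continuousOn_const.mul (continuousOn_coeff hu _ i)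
  · exact continuousOn_finsetSum _ fun j _ => continuousOn_const.mul
      (Complex.continuous_conj.comp_continuousOn (continuousOn_coeff hv k j))

lemma aestronglyMeasurable_tri {u v : ℝ → L2Field L} (hu : MemX0 u) (hv : MemX0 v)
    (w : L2Field L) (t : ℝ) :
    AEStronglyMeasurable (fun s => tri S (u s) (v s) w) (volume.restrict (Icc 0 t)) := by
  unfold tri
  have hsub : Icc 0 t ⊆ Ici (0 : ℝ) := fun x hx => hx.1
  refine Finset.aestronglyMeasurable_fun_sum _ fun l _ => ?_
  refine aestronglyMeasurable_of_tendsto_ae (u := atTop)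
    (f := fun N s => ∑ k ∈ box N, triTerm (u s) (v s) w l k) ?_ ?_
  · intro N
    refine Finset.aestronglyMeasurable_fun_sum _ fun k _ => ?_
    exact ((continuousOn_triTerm hu hv w l k).mono hsub).aestronglyMeasurable measurableSet_Icc
  · refine (ae_restrict_iff' measurableSet_Icc).mpr (ae_of_all _ fun s hs => ?_)
    exact (summable_triTerm (hu.mem s hs.1) (v s) w l).hasSum.comp tendsto_box

lemma intervalIntegrable_tri {u : ℝ → L2Field L} (hu : MemX0 u) (w : L2Field L) {t : ℝ}
    (ht : 0 ≤ t) : IntervalIntegrable (fun s => tri S (u s) (u s) w) volume 0 t := by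
  obtain ⟨C, hC⟩ := hu.bounded
  rw [intervalIntegrable_iff_integrableOn_Icc_of_le ht]
  have hK : 0 ≤ ∑ l ∈ S, Real.sqrt (eigenvalue L l) * amp w l :=
    Finset.sum_nonneg fun l _ => mul_nonneg (Real.sqrt_nonneg _) (amp_nonneg _ _)
  refine Integrable.of_bound (aestronglyMeasurable_tri hu hu w t)
    ((∑ l ∈ S, Real.sqrt (eigenvalue L l) * amp w l) * (C ^ 2 + C ^ 2)) ?_
  refine (ae_restrict_iff' measurableSet_Icc).mpr (ae_of_all _ fun s hs => ?_)
  refine (abs_tri_le (hu.mem s hs.1) _ _).trans ?_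
  have := hC s hs.1
  gcongr

/-- The rate of change of `(u, w)` along a solution, for `w` supported in `S`. -/
def rate (ν l ε : ℝ) (S : Finset (Fin 3 → ℤ)) (f u w : L2Field L) : ℝ :=
  partForm S 0 f w - ε * partForm S l u w - ν * partForm S 1 u w - tri S u u w

lemma rate_smul (ν l ε c : ℝ) (f u w : L2Field L) :
    rate ν l ε S f u (c • w) = c * rate ν l ε S f u w := by
  simp only [rate, partForm_smul_right, tri_smul_right]; ring

lemma rate_sum (ν l ε : ℝ) (f : L2Field L) {u : L2Field L} (hu : u ∈ V₀ L) {ι : Type*}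
    (A : Finset ι) (w : ι → L2Field L) :
    rate ν l ε S f u (∑ i ∈ A, w i) = ∑ i ∈ A, rate ν l ε S f u (w i) := by
  classical
  induction A using Finset.induction_on with
  | empty =>
    have := rate_smul (S := S) ν l ε 0 f u 0
    simpa using this
  | insert a A ha ih =>
    rw [Finset.sum_insert ha, Finset.sum_insert ha, ← ih]
    simp only [rate, partForm_add_right, tri_add_right hu]
    ring

lemma rate_trunc (hS : ∀ k, k ∈ S → -k ∈ S) (ν l ε : ℝ) (f u w : L2Field L) :
    rate ν l ε S f u (trunc S w) = rate ν l ε S f u w := by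
  have h : ∀ k ∈ S, ∀ j, coeff (trunc S w) k j = coeff w k j := fun k hk j => by
    rw [coeff_trunc hS, if_pos hk]
  simp only [rate, partForm_congr_right _ _ h, tri_congr_right _ _ h]

lemma intervalIntegrable_rate {ν l ε : ℝ} {f : L2Field L} {u : ℝ → L2Field L} (hu : MemX0 u)
    (w : L2Field L) {t : ℝ} (ht : 0 ≤ t) :
    IntervalIntegrable (fun s => rate ν l ε S f (u s) w) volume 0 t := by
  have hsub : uIcc 0 t ⊆ Ici (0 : ℝ) := by rw [uIcc_of_le ht]; exact fun x hx => hx.1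
  have h1 : ∀ r, IntervalIntegrable (fun s => partForm S r (u s) w) volume 0 t := fun r =>
    ((continuousOn_partForm r (continuousOn_coeff hu) fun k j => continuousOn_const).mono hsub).intervalIntegrable
  unfold rate
  exact ((intervalIntegrable_const.sub ((h1 l).const_mul ε)).sub ((h1 1).const_mul ν)).sub
    (intervalIntegrable_tri hu w ht)

lemma inner_sub_eq_integral_rate (hS : ∀ k, k ∈ S → -k ∈ S) {ν l ε : ℝ} {f : L2Field L}
    {u : ℝ → L2Field L} (hu : IsWeakSolution ν l ε f u) {v : L2Field L} (hv : v ∈ testSpace L S)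
    {t : ℝ} (ht : 0 ≤ t) :
    inner ℝ (u t) v - inner ℝ (u 0) v = ∫ s in (0 : ℝ)..t, rate ν l ε S f (u s) v := by
  have hsub : uIcc 0 t ⊆ Ici (0 : ℝ) := by rw [uIcc_of_le ht]; exact fun x hx => hx.1
  have h1 : ∀ r, IntervalIntegrable (fun s => partForm S r (u s) v) volume 0 t := fun r =>
    ((continuousOn_partForm r (continuousOn_coeff hu.memX0)
      fun k j => continuousOn_const).mono hsub).intervalIntegrable
  have heq := hu.equation v (mem_V_of_mem_testSpace hS hv 1)
    (fun _ => mem_V_of_mem_testSpace hS hv l) 0 t le_rfl ht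
  simp only [powForm_eq_partForm _ _ hv.2, inner_eq_partForm f hv.2] at heq
  -- The Fourier expression agrees with the trilinear form at times with u(s) in V_1, hence at
  -- almost every time; elsewhere `weakDeriv` may be the default 0.
  have htri : ∫ s in (0 : ℝ)..t, trilinear (u s) (u s) v =
      ∫ s in (0 : ℝ)..t, tri S (u s) (u s) v := by
    have hfin := ae_lt_top' (aemeasurable_sobSq 1 (continuousOn_coeff hu.memX0) t)
      (hu.memX0.locally_square_integrable t).ne
    rw [intervalIntegral.integral_of_le ht, intervalIntegral.integral_of_le ht]
    apply integral_congr_ae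
    filter_upwards [ae_mono (Measure.restrict_mono Ioc_subset_Icc_self le_rfl) hfin] with s hs
    exact trilinear_eq_tri (u s) hs hv.2
  rw [htri, inner_sub_left] at heq
  unfold rate
  rw [intervalIntegral.integral_sub ((intervalIntegrable_const.sub ((h1 l).const_mul ε)).sub
    ((h1 1).const_mul ν)) (intervalIntegrable_tri hu.memX0 v ht),
    intervalIntegral.integral_sub (intervalIntegrable_const.sub ((h1 l).const_mul ε))
    ((h1 1).const_mul ν), intervalIntegral.integral_sub intervalIntegrable_const
    ((h1 l).const_mul ε), intervalIntegral.integral_const_mul, intervalIntegral.integral_const_mul]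
  linarith

/-- As `g` is merely integrable, `y` is only absolutely continuous, and the chain rule is replaced
by integration by parts for absolutely continuous functions. -/
lemma sq_sub_sq_eq_integral {y g : ℝ → ℝ} {t : ℝ} (ht : 0 ≤ t)
    (hg : IntervalIntegrable g volume 0 t)
    (hy : ∀ s ∈ Icc 0 t, y s = y 0 + ∫ r in (0 : ℝ)..s, g r) :
    y t ^ 2 - y 0 ^ 2 = 2 * ∫ s in (0 : ℝ)..t, g s * y s := by
  set Z : ℝ → ℝ := fun s => ∫ r in (0 : ℝ)..s, g r with hZ
  have hac : AbsolutelyContinuousOnInterval Z 0 t :=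
    hg.absolutelyContinuousOnInterval_intervalIntegral left_mem_uIcc
  have h1 := hac.integral_deriv_mul_eq_sub hac
  have h2 : ∫ s in (0 : ℝ)..t, deriv Z s * Z s + Z s * deriv Z s =
      ∫ s in (0 : ℝ)..t, 2 * (g s * Z s) := by
    apply intervalIntegral.integral_congr_ae
    filter_upwards [hg.ae_hasDerivAt_integral] with s hs hs'
    have := (hs (uIoc_subset_uIcc hs') 0 left_mem_uIcc).deriv
    rw [hZ, this]; ring
  have hgZ : IntervalIntegrable (fun s => g s * Z s) volume 0 t :=
    hg.mul_continuousOn hac.continuousOn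
  have h3 : ∫ s in (0 : ℝ)..t, g s * y s = y 0 * Z t + ∫ s in (0 : ℝ)..t, g s * Z s := by
    rw [hZ, ← intervalIntegral.integral_const_mul, ← intervalIntegral.integral_add
      (hg.const_mul _) hgZ]
    apply intervalIntegral.integral_congr
    intro s hs
    rw [uIcc_of_le ht] at hs
    dsimp only
    rw [hy s hs]; ring
  have h0 : Z 0 = 0 := intervalIntegral.integral_same
  rw [h2, intervalIntegral.integral_const_mul, h0] at h1
  rw [h3, hy t ⟨ht, le_rfl⟩]
  change (y 0 + Z t) ^ 2 - _ = _
  linarith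

/-- The energy identity for the modes in `S` of the difference of two solutions. -/
lemma energy_identity (hS : ∀ k, k ∈ S → -k ∈ S) {ν l ε ε' : ℝ} {f f' : L2Field L}
    {u u' : ℝ → L2Field L} (hu : IsWeakSolution ν l ε f u) (hu' : IsWeakSolution ν l ε' f' u')
    {t : ℝ} (ht : 0 ≤ t) :
    IntervalIntegrable (fun s => rate ν l ε S f (u s) (u s - u' s) -
      rate ν l ε' S f' (u' s) (u s - u' s)) volume 0 t ∧
    ‖trunc S (u t - u' t)‖ ^ 2 - ‖trunc S (u 0 - u' 0)‖ ^ 2 =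
      2 * ∫ s in (0 : ℝ)..t, (rate ν l ε S f (u s) (u s - u' s) -
        rate ν l ε' S f' (u' s) (u s - u' s)) := by
  set e := testBasis L S
  set y : Fin (Module.finrank ℝ (testSpace L S)) → ℝ → ℝ := fun i s => inner ℝ (u s - u' s) (e i)
  set g : Fin (Module.finrank ℝ (testSpace L S)) → ℝ → ℝ := fun i s =>
    rate ν l ε S f (u s) (e i) - rate ν l ε' S f' (u' s) (e i)
  have hwV : ∀ s, 0 ≤ s → u s - u' s ∈ V₀ L := fun s hs =>
    sub_mem_V₀ (hu.memX0.mem s hs) (hu'.memX0.mem s hs)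
  have hg : ∀ i, IntervalIntegrable (g i) volume 0 t := fun i =>
    (intervalIntegrable_rate hu.memX0 _ ht).sub (intervalIntegrable_rate hu'.memX0 _ ht)
  have hy : ∀ i, ∀ s ∈ Icc 0 t, y i s = y i 0 + ∫ r in (0 : ℝ)..s, g i r := by
    intro i s hs
    have h1 := inner_sub_eq_integral_rate hS hu (testBasis_mem i) hs.1
    have h2 := inner_sub_eq_integral_rate hS hu' (testBasis_mem i) hs.1
    simp only [g]
    rw [intervalIntegral.integral_sub (intervalIntegrable_rate hu.memX0 _ hs.1)
      (intervalIntegrable_rate hu'.memX0 _ hs.1), ← h1, ← h2]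
    simp only [y, inner_sub_left]
    ring
  have hyc : ∀ i, ContinuousOn (y i) (uIcc 0 t) := by
    intro i
    rw [uIcc_of_le ht]
    simp only [y, inner_sub_left]
    exact ((hu.memX0.weakly_continuous _ (testBasis_mem i).1).sub
      (hu'.memX0.weakly_continuous _ (testBasis_mem i).1)).mono fun x hx => hx.1
  -- Linearity of `rate` in the test field reassembles the scalar identities: the sum of y_i e_i is
  -- P_S w, and `rate` sees only the modes in `S`.
  have hrate : ∀ s ∈ Icc 0 t, ∑ i, g i s * y i s =
      rate ν l ε S f (u s) (u s - u' s) - rate ν l ε' S f' (u' s) (u s - u' s) := by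
    intro s hs
    rw [← rate_trunc hS, ← rate_trunc hS (w := u s - u' s) (u := u' s),
      trunc_eq_sum hS (hwV s hs.1),
      rate_sum _ _ _ _ (hu.memX0.mem s hs.1), rate_sum _ _ _ _ (hu'.memX0.mem s hs.1),
      ← Finset.sum_sub_distrib]
    refine Finset.sum_congr rfl fun i _ => ?_
    rw [rate_smul, rate_smul]
    simp only [g, y]; ring
  have hint : ∀ i, IntervalIntegrable (fun s => g i s * y i s) volume 0 t := fun i =>
    (hg i).mul_continuousOn (hyc i)
  have hI : IntervalIntegrable (fun s => ∑ i, g i s * y i s) volume 0 t := by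
    have := IntervalIntegrable.sum Finset.univ fun i _ => hint i
    refine this.congr fun s _ => ?_
    simp
  constructor
  · refine hI.congr fun s hs => ?_
    rw [uIoc_of_le ht] at hs
    exact hrate s ⟨hs.1.le, hs.2⟩
  · rw [norm_trunc_sq_eq_sum hS (hwV t ht), norm_trunc_sq_eq_sum hS (hwV 0 le_rfl),
      ← Finset.sum_sub_distrib]
    rw [Finset.sum_congr rfl fun i _ => sq_sub_sq_eq_integral ht (hg i) (hy i), ← Finset.mul_sum,
      ← intervalIntegral.integral_finsetSum fun i _ => hint i]
    congr 1
    apply intervalIntegral.integral_congr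
    intro s hs
    rw [uIcc_of_le ht] at hs
    exact hrate s hs

/-- The integrand of the energy identity. -/
lemma rate_sub_rate (hS : ∀ k, k ∈ S → -k ∈ S) (ν l ε ε' : ℝ) (f f' : L2Field L)
    {u u' : L2Field L} (hu : u ∈ V₀ L) (hu' : u' ∈ V₀ L) :
    rate ν l ε S f u (u - u') - rate ν l ε' S f' u' (u - u') =
      partForm S 0 (f - f') (u - u') - ε * (∑ k ∈ S, sobTerm l (u - u') k)
        + (ε' - ε) * partForm S l u' (u - u') - ν * (∑ k ∈ S, sobTerm 1 (u - u') k)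
        - tri S u ((u - u') - trunc S (u - u')) (u - u') - tri S (u - u') u' (u - u') := by
  have h := tri_difference hS hu hu'
  have h1 : ∀ s, (∑ k ∈ S, sobTerm s (u - u') k) =
      partForm S s u (u - u') - partForm S s u' (u - u') := fun s => by
    rw [← partForm_self, partForm_sub_left]
  rw [h1, h1, partForm_sub_left]
  unfold rate
  linear_combination -h

end Energy

/-! ### Gronwall's inequality with an integrable coefficient -/

section Gronwall

lemma absolutelyContinuousOnInterval_lipschitz_comp {f h : ℝ → ℝ} {a b : ℝ} {K : ℝ≥0}
    (hf : AbsolutelyContinuousOnInterval f a b) (hh : LipschitzOnWith K h (f '' uIcc a b)) :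
    AbsolutelyContinuousOnInterval (fun x => h (f x)) a b := by
  rw [absolutelyContinuousOnInterval_iff] at hf ⊢
  intro r hr
  obtain ⟨δ, hδ, H⟩ := hf (r / (K + 1)) (by positivity)
  refine ⟨δ, hδ, fun E hE hlt => ?_⟩
  have h1 := H E hE hlt
  have h2 : ∑ i ∈ Finset.range E.1, dist (h (f (E.2 i).1)) (h (f (E.2 i).2)) ≤
      ∑ i ∈ Finset.range E.1, K * dist (f (E.2 i).1) (f (E.2 i).2) := by
    refine Finset.sum_le_sum fun i hi => ?_
    have hmem := hE.1 i hi
    exact hh.dist_le_mul _ (mem_image_of_mem _ hmem.1) _ (mem_image_of_mem _ hmem.2)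
  rw [← Finset.mul_sum] at h2
  rw [lt_div_iff₀ (by positivity)] at h1
  have h3 : 0 ≤ ∑ i ∈ Finset.range E.1, dist (f (E.2 i).1) (f (E.2 i).2) :=
    Finset.sum_nonneg fun _ _ => dist_nonneg
  nlinarith

/-- With A the primitive of `a` and F that of a φ, the function (c + F) exp(-A) is absolutely
continuous with derivative a exp(-A) (φ - c - F) ≤ 0 almost everywhere, hence at most its initial
value c. -/
lemma gronwall_integral {φ a : ℝ → ℝ} {c T : ℝ} (hT : 0 ≤ T) (hφ : ContinuousOn φ (Icc 0 T))
    (ha : IntervalIntegrable a volume 0 T) (ha0 : ∀ s ∈ Icc 0 T, 0 ≤ a s)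
    (h : ∀ t ∈ Icc 0 T, φ t ≤ c + ∫ s in (0 : ℝ)..t, a s * φ s) :
    φ T ≤ c * Real.exp (∫ s in (0 : ℝ)..T, a s) := by
  have haφ : IntervalIntegrable (fun s => a s * φ s) volume 0 T :=
    ha.mul_continuousOn (by rwa [uIcc_of_le hT])
  set A : ℝ → ℝ := fun t => ∫ s in (0 : ℝ)..t, a s with hA
  set F : ℝ → ℝ := fun t => ∫ s in (0 : ℝ)..t, a s * φ s with hF
  have hAac : AbsolutelyContinuousOnInterval A 0 T :=
    ha.absolutelyContinuousOnInterval_intervalIntegral left_mem_uIcc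
  have hFac : AbsolutelyContinuousOnInterval F 0 T :=
    haφ.absolutelyContinuousOnInterval_intervalIntegral left_mem_uIcc
  have hcac : AbsolutelyContinuousOnInterval (fun _ : ℝ => c) 0 T :=
    (LipschitzWith.const c).lipschitzOnWith.absolutelyContinuousOnInterval
  have hEac : AbsolutelyContinuousOnInterval (fun t => Real.exp (-A t)) 0 T := by
    -- The primitive A is nonnegative because `a` is, so only the half-line where exp(-x) is
    -- 1-Lipschitz matters.
    have hlip : LipschitzOnWith 1 (fun x => Real.exp (-x)) (Ici 0) := by
      refine Convex.lipschitzOnWith_of_nnnorm_hasDerivWithin_le (convex_Ici 0)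
        (f' := fun x => -Real.exp (-x)) (fun x _ => ?_) fun x hx => ?_
      · have := ((hasDerivAt_id x).neg.exp).hasDerivWithinAt (s := Ici 0)
        simpa using this
      · rw [← NNReal.coe_le_coe, coe_nnnorm, norm_neg, Real.norm_eq_abs, Real.abs_exp]
        have hx' : (0 : ℝ) ≤ x := hx
        simpa using hx'
    refine absolutelyContinuousOnInterval_lipschitz_comp (h := fun x => Real.exp (-x)) hAac
      (hlip.mono ?_)
    rintro _ ⟨t, ht, rfl⟩
    rw [uIcc_of_le hT] at ht
    exact intervalIntegral.integral_nonneg ht.1 fun s hs => ha0 s ⟨hs.1, hs.2.trans ht.2⟩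
  have hGac := hcac.add hFac
  have h1 := hGac.integral_deriv_mul_eq_sub hEac
  have h2 : ∫ t in (0 : ℝ)..T, (deriv ((fun _ : ℝ => c) + F) t * Real.exp (-A t) +
      ((fun _ : ℝ => c) + F) t * deriv (fun t => Real.exp (-A t)) t) ≤ 0 := by
    rw [← neg_nonneg, ← intervalIntegral.integral_neg, intervalIntegral.integral_of_le hT]
    apply integral_nonneg_of_ae
    rw [Filter.EventuallyLE, ae_restrict_iff' measurableSet_Ioc]
    filter_upwards [ha.ae_hasDerivAt_integral, haφ.ae_hasDerivAt_integral] with t hat hφt ht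
    have ht' : t ∈ uIcc 0 T := by rw [uIcc_of_le hT]; exact Ioc_subset_Icc_self ht
    have d1 : HasDerivAt A (a t) t := hat ht' 0 left_mem_uIcc
    have d2 : HasDerivAt F (a t * φ t) t := hφt ht' 0 left_mem_uIcc
    have d3 : HasDerivAt ((fun _ : ℝ => c) + F) (0 + a t * φ t) t := (hasDerivAt_const t c).add d2
    have d4 : HasDerivAt (fun t => Real.exp (-A t)) (Real.exp (-A t) * -a t) t := d1.fun_neg.exp
    rw [d3.deriv, d4.deriv]
    have hle := h t (Ioc_subset_Icc_self ht)
    have h0 := ha0 t (Ioc_subset_Icc_self ht)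
    have he := Real.exp_pos (-A t)
    change 0 ≤ -((0 + a t * φ t) * Real.exp (-A t) + (c + F t) * (Real.exp (-A t) * -a t))
    have : 0 ≤ a t * Real.exp (-A t) * (c + F t - φ t) :=
      mul_nonneg (mul_nonneg h0 he.le) (by linarith)
    linarith
  rw [h1] at h2
  have hF0 : F 0 = 0 := intervalIntegral.integral_same
  have hA0 : A 0 = 0 := intervalIntegral.integral_same
  simp only [Pi.add_apply, hF0, hA0, neg_zero, Real.exp_zero, add_zero, mul_one, sub_nonpos] at h2
  have h3 := h T ⟨hT, le_rfl⟩
  have h4 : c + F T ≤ c * Real.exp (A T) := by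
    rw [Real.exp_neg, ← div_eq_mul_inv, div_le_iff₀ (Real.exp_pos _)] at h2
    exact h2
  exact h3.trans h4

/-- Energy form of Gronwall's inequality. -/
lemma energy_gronwall {φ X a b r : ℝ → ℝ} {κ T : ℝ} (hT : 0 ≤ T)
    (hφ : ContinuousOn φ (Icc 0 T)) (hφ0 : ∀ s ∈ Icc 0 T, 0 ≤ φ s)
    (hX : IntervalIntegrable X volume 0 T) (hX0 : ∀ s ∈ Icc 0 T, 0 ≤ X s) (hκ : 0 ≤ κ)
    (ha : IntervalIntegrable a volume 0 T) (ha0 : ∀ s ∈ Icc 0 T, 0 ≤ a s)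
    (hb : IntervalIntegrable b volume 0 T) (hb0 : ∀ s ∈ Icc 0 T, 0 ≤ b s)
    (hr : IntervalIntegrable r volume 0 T)
    (hid : ∀ t ∈ Icc 0 T, φ t - φ 0 = 2 * ∫ s in (0 : ℝ)..t, r s)
    (hle : ∀ᵐ s ∂volume.restrict (Icc 0 T), 2 * r s + κ * X s ≤ a s * φ s + b s) :
    (∀ t ∈ Icc 0 T, φ t ≤ (φ 0 + ∫ s in (0 : ℝ)..T, b s) * Real.exp (∫ s in (0 : ℝ)..T, a s)) ∧
    κ * ∫ s in (0 : ℝ)..T, X s ≤ (φ 0 + ∫ s in (0 : ℝ)..T, b s) *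
      (1 + (∫ s in (0 : ℝ)..T, a s) * Real.exp (∫ s in (0 : ℝ)..T, a s)) := by
  have haφ : IntervalIntegrable (fun s => a s * φ s) volume 0 T :=
    ha.mul_continuousOn (by rwa [uIcc_of_le hT])
  have hsub : ∀ t ∈ Icc 0 T, uIcc 0 t ⊆ uIcc 0 T := fun t ht => by
    rw [uIcc_of_le ht.1, uIcc_of_le hT]; exact Icc_subset_Icc_right ht.2
  have key : ∀ t ∈ Icc 0 T, φ t + κ * (∫ s in (0 : ℝ)..t, X s) ≤
      φ 0 + (∫ s in (0 : ℝ)..T, b s) + ∫ s in (0 : ℝ)..t, a s * φ s := by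
    intro t ht
    have s1 := hr.mono_set (hsub t ht)
    have s2 := hX.mono_set (hsub t ht)
    have s3 := haφ.mono_set (hsub t ht)
    have s4 := hb.mono_set (hsub t ht)
    have h1 : ∫ s in (0 : ℝ)..t, (2 * r s + κ * X s) ≤ ∫ s in (0 : ℝ)..t, (a s * φ s + b s) := by
      refine intervalIntegral.integral_mono_ae_restrict ht.1
        ((s1.const_mul 2).add (s2.const_mul κ)) (s3.add s4) ?_
      exact ae_mono (Measure.restrict_mono (Icc_subset_Icc_right ht.2) le_rfl) hle
    rw [intervalIntegral.integral_add (s1.const_mul 2) (s2.const_mul κ),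
      intervalIntegral.integral_add s3 s4, intervalIntegral.integral_const_mul,
      intervalIntegral.integral_const_mul, ← hid t ht] at h1
    have h2 : ∫ s in (0 : ℝ)..t, b s ≤ ∫ s in (0 : ℝ)..T, b s := by
      refine intervalIntegral.integral_mono_interval le_rfl ht.1 ht.2 ?_ hb
      exact (ae_restrict_iff' measurableSet_Ioc).mpr
        (ae_of_all _ fun s hs => hb0 s (Ioc_subset_Icc_self hs))
    linarith
  have hXt : ∀ t ∈ Icc 0 T, 0 ≤ ∫ s in (0 : ℝ)..t, X s := fun t ht =>
    intervalIntegral.integral_nonneg ht.1 fun s hs => hX0 s ⟨hs.1, hs.2.trans ht.2⟩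
  have hc0 : 0 ≤ φ 0 + ∫ s in (0 : ℝ)..T, b s :=
    add_nonneg (hφ0 0 ⟨le_rfl, hT⟩) (intervalIntegral.integral_nonneg hT hb0)
  have hφle : ∀ t ∈ Icc 0 T,
      φ t ≤ (φ 0 + ∫ s in (0 : ℝ)..T, b s) * Real.exp (∫ s in (0 : ℝ)..T, a s) := by
    intro t ht
    have h1 := gronwall_integral ht.1 (hφ.mono (Icc_subset_Icc_right ht.2))
      (ha.mono_set (hsub t ht)) (fun s hs => ha0 s ⟨hs.1, hs.2.trans ht.2⟩)
      (c := φ 0 + ∫ s in (0 : ℝ)..T, b s) (fun s hs => by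
        have hs' : s ∈ Icc 0 T := ⟨hs.1, hs.2.trans ht.2⟩
        have := key s hs'
        have := mul_nonneg hκ (hXt s hs')
        linarith)
    refine h1.trans (mul_le_mul_of_nonneg_left (Real.exp_le_exp.mpr ?_) hc0)
    refine intervalIntegral.integral_mono_interval le_rfl ht.1 ht.2 ?_ ha
    exact (ae_restrict_iff' measurableSet_Ioc).mpr
      (ae_of_all _ fun s hs => ha0 s (Ioc_subset_Icc_self hs))
  refine ⟨hφle, ?_⟩
  set c := φ 0 + ∫ s in (0 : ℝ)..T, b s
  set A := ∫ s in (0 : ℝ)..T, a s with hA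
  have h1 := key T ⟨hT, le_rfl⟩
  -- The pointwise bound is fed back into the integrated inequality, in which the dissipation has
  -- been kept on the left.
  have h2 : ∫ s in (0 : ℝ)..T, a s * φ s ≤ A * (c * Real.exp A) := by
    rw [hA, ← intervalIntegral.integral_mul_const]
    refine intervalIntegral.integral_mono_on hT haφ (ha.mul_const _) fun s hs => ?_
    exact mul_le_mul_of_nonneg_left (hφle s hs) (ha0 s hs)
  have h3 := hφ0 T ⟨hT, le_rfl⟩
  linarith

end Gronwall

/-! ### High frequencies -/

section HighFrequencies

variable {L : ℝ} [hL : Fact (0 < L)]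

lemma abs_le_of_enorm_sq_le {x a b c : ℝ} {A B C : ℝ≥0∞} (ha : 0 ≤ a) (hb : 0 ≤ b) (hc : 0 ≤ c)
    (h : ‖x‖ₑ ^ 2 ≤ A * B * C) (hA : A ≤ ENNReal.ofReal (a ^ 2)) (hB : B ≤ ENNReal.ofReal (b ^ 2))
    (hC : C ≤ ENNReal.ofReal (c ^ 2)) : |x| ≤ a * b * c := by
  have h1 : ‖x‖ₑ ^ 2 ≤ ENNReal.ofReal ((a * b * c) ^ 2) := by
    refine h.trans ((mul_le_mul' (mul_le_mul' hA hB) hC).trans_eq ?_)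
    rw [← ENNReal.ofReal_mul (by positivity), ← ENNReal.ofReal_mul (by positivity)]
    congr 1; ring
  rw [Real.enorm_eq_ofReal_abs, ← ENNReal.ofReal_pow (abs_nonneg x),
    ENNReal.ofReal_le_ofReal_iff (by positivity)] at h1
  exact abs_le_of_sq_le_sq' h1 (by positivity) |>.2

/-- A lower bound for the square root of the eigenvalues outside `box N`. -/
def freq (L : ℝ) (N : ℕ) : ℝ := 2 * Real.pi / L * (N + 1)

lemma freq_pos (N : ℕ) : 0 < freq L N := by
  have := two_pi_div_pos (L := L)
  unfold freq; positivity

lemma freq_zero {L : ℝ} : freq L 0 = 2 * Real.pi / L := by simp [freq]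

lemma tendsto_freq : Tendsto (freq L) atTop atTop := by
  unfold freq
  exact (tendsto_atTop_add_const_right _ _ tendsto_natCast_atTop_atTop).const_mul_atTop
    two_pi_div_pos

lemma sobTerm_le_high {N : ℕ} {k : Fin 3 → ℤ} (hk : k ∉ box N) {s r : ℝ} (hsr : s ≤ r)
    (u : L2Field L) : sobTerm s u k ≤ (freq L N ^ 2) ^ (s - r) * sobTerm r u k := by
  have h3 := pow_pos hL.out 3
  have h1 := le_eigenvalue (L := L) hk
  have hf := pow_pos (freq_pos (L := L) N) 2
  have hpos : 0 < eigenvalue L k := hf.trans_le h1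
  have h2 : eigenvalue L k ^ (s - r) ≤ (freq L N ^ 2) ^ (s - r) :=
    Real.rpow_le_rpow_of_nonpos hf h1 (by linarith)
  have h4 : eigenvalue L k ^ s = eigenvalue L k ^ (s - r) * eigenvalue L k ^ r := by
    rw [← Real.rpow_add hpos]; ring_nf
  have h5 := Real.rpow_nonneg hpos.le r
  unfold sobTerm
  rw [h4]
  calc L ^ 3 * (eigenvalue L k ^ (s - r) * eigenvalue L k ^ r) * amp u k ^ 2
      = eigenvalue L k ^ (s - r) * (L ^ 3 * eigenvalue L k ^ r * amp u k ^ 2) := by ring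
    _ ≤ _ := by gcongr

lemma sobTerm_zero_mode (s : ℝ) {u : L2Field L} (hu : u ∈ V₀ L) : sobTerm s u 0 = 0 := by
  simp [sobTerm, amp_zero_mode hu]

lemma sobTerm_poincare {s r : ℝ} (hsr : s ≤ r) {u : L2Field L} (hu : u ∈ V₀ L)
    (k : Fin 3 → ℤ) : sobTerm s u k ≤ (freq L 0 ^ 2) ^ (s - r) * sobTerm r u k := by
  by_cases hk : k = 0
  · rw [hk, sobTerm_zero_mode s hu, sobTerm_zero_mode r hu, mul_zero]
  · exact sobTerm_le_high (mem_box_zero.not.mpr hk) hsr u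

lemma sobSq_poincare {s r : ℝ} (hsr : s ≤ r) {u : L2Field L} (hu : u ∈ V₀ L) :
    sobSq s u ≤ ENNReal.ofReal ((freq L 0 ^ 2) ^ (s - r)) * sobSq r u := by
  simp only [sobSq_eq]
  rw [← ENNReal.tsum_mul_left]
  refine ENNReal.tsum_le_tsum fun k => ?_
  rw [← ENNReal.ofReal_mul (Real.rpow_nonneg (sq_nonneg _) _)]
  exact ENNReal.ofReal_le_ofReal (sobTerm_poincare hsr hu k)

lemma sobSq_high_le (N : ℕ) {s r : ℝ} (hsr : s ≤ r) (u : L2Field L) :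
    sobSq s (u - trunc (box N) u) ≤ ENNReal.ofReal ((freq L N ^ 2) ^ (s - r)) * sobSq r u := by
  simp only [sobSq_eq]
  rw [← ENNReal.tsum_mul_left]
  refine ENNReal.tsum_le_tsum fun k => ?_
  rw [← ENNReal.ofReal_mul (Real.rpow_nonneg (sq_nonneg _) _)]
  apply ENNReal.ofReal_le_ofReal
  by_cases hk : k ∈ box N
  · have : sobTerm s (u - trunc (box N) u) k = 0 := by
      simp [sobTerm, amp_sub_trunc neg_mem_box, hk]
    rw [this]
    exact mul_nonneg (Real.rpow_nonneg (sq_nonneg _) _) (sobTerm_nonneg r u k)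
  · have : sobTerm s (u - trunc (box N) u) k = sobTerm s u k := by
      simp [sobTerm, amp_sub_trunc neg_mem_box, hk]
    rw [this]
    exact sobTerm_le_high hk hsr u

lemma sum_sobTerm_le_of_sobSq_le (S : Finset (Fin 3 → ℤ)) {s M : ℝ} (hM : 0 ≤ M) {u : L2Field L}
    (h : sobSq s u ≤ ENNReal.ofReal M) : ∑ k ∈ S, sobTerm s u k ≤ M := by
  rw [sobSq_eq] at h
  have := (ENNReal.sum_le_tsum S).trans h
  rw [← ENNReal.ofReal_sum_of_nonneg fun k _ => sobTerm_nonneg s u k] at this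
  exact (ENNReal.ofReal_le_ofReal_iff hM).mp this

lemma sum_sobTerm_nonneg (S : Finset (Fin 3 → ℤ)) (s : ℝ) (u : L2Field L) :
    0 ≤ ∑ k ∈ S, sobTerm s u k := Finset.sum_nonneg fun k _ => sobTerm_nonneg s u k

lemma sum_sobTerm_zero_le (S : Finset (Fin 3 → ℤ)) (u : L2Field L) :
    ∑ k ∈ S, sobTerm 0 u k ≤ ‖u‖ ^ 2 :=
  sum_sobTerm_le_of_sobSq_le S (sq_nonneg _) (sobSq_zero_exponent u).le

lemma abs_partForm_zero_le (S : Finset (Fin 3 → ℤ)) (f w : L2Field L) :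
    |partForm S 0 f w| ≤ ‖f‖ * Real.sqrt (∑ k ∈ S, sobTerm 0 w k) := by
  refine (abs_partForm_le 0 f w).trans ?_
  gcongr
  exact Real.sqrt_le_iff.mpr ⟨norm_nonneg f, sum_sobTerm_zero_le S f⟩

/-- Interpolation: each term of order 1/2 is the geometric mean of those of orders 0 and 1, and
Cauchy–Schwarz sums them. -/
lemma sum_sobTerm_half_le (S : Finset (Fin 3 → ℤ)) (w : L2Field L) :
    ∑ k ∈ S, sobTerm (1 / 2) w k ≤
      Real.sqrt (∑ k ∈ S, sobTerm 0 w k) * Real.sqrt (∑ k ∈ S, sobTerm 1 w k) := by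
  have h1 : ∀ k, sobTerm (1 / 2) w k = Real.sqrt (sobTerm 0 w k) * Real.sqrt (sobTerm 1 w k) := by
    intro k
    have h3 := pow_pos hL.out 3
    have h0 := eigenvalue_nonneg (L := L) k
    have ha := amp_nonneg w k
    rw [← Real.sqrt_mul (sobTerm_nonneg 0 w k)]
    have : sobTerm 0 w k * sobTerm 1 w k = (L ^ 3 * Real.sqrt (eigenvalue L k) * amp w k ^ 2) ^ 2 := by
      simp only [sobTerm, Real.rpow_zero, Real.rpow_one, mul_pow, Real.sq_sqrt h0]
      ring
    rw [this, Real.sqrt_sq (by positivity), sobTerm, Real.sqrt_eq_rpow]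
  simp only [h1]
  refine (Real.sum_mul_le_sqrt_mul_sqrt _ _ _).trans_eq ?_
  simp only [Real.sq_sqrt (sobTerm_nonneg _ _ _)]

end HighFrequencies

/-! ### Solutions in a ball of `V₁` -/

section Ball

variable {L : ℝ} [hL : Fact (0 < L)]

/-- Here `a`, `h`, `x` stand for the norms of P_N w of orders 0, 1/2, 1 and `F` for ‖f - f'‖. Three
applications of Young's inequality spend ν/2 · x² each: one on the force, two on the nonlinear term,
first to reach h² ≤ a x and then to split a x. The second split produces 2R⁴/ν³. -/
lemma young_ball {ν R F a x h μ : ℝ} (hν : 0 < ν) (hμ : 0 < μ)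
    (hF : 0 ≤ F) (hax : μ * a ≤ x) (hh : h ^ 2 ≤ a * x) :
    2 * F * a + 2 * R * h * x ≤
      3 / 2 * ν * x ^ 2 + 2 / (ν * μ ^ 2) * F ^ 2 + 2 * R ^ 4 / ν ^ 3 * a ^ 2 := by
  have h1 : 2 * F * a ≤ ν / 2 * x ^ 2 + 2 / (ν * μ ^ 2) * F ^ 2 := by
    have e1 : 2 * F * a ≤ 2 * (F / μ) * x := by
      have : 2 * (F / μ) * (μ * a) = 2 * F * a := by field_simp
      rw [← this]; gcongr
    have e2 : 2 / (ν * μ ^ 2) * F ^ 2 = 2 / ν * (F / μ) ^ 2 := by field_simp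
    rw [e2]
    have e3 : ν / 2 * x ^ 2 + 2 / ν * (F / μ) ^ 2 - 2 * (F / μ) * x =
        (ν * x - 2 * (F / μ)) ^ 2 / (2 * ν) := by field_simp; ring
    have e4 : 0 ≤ (ν * x - 2 * (F / μ)) ^ 2 / (2 * ν) := by positivity
    linarith
  have h2 : 2 * R * h * x ≤ ν / 2 * x ^ 2 + 2 * R ^ 2 / ν * h ^ 2 := by
    have e3 : ν / 2 * x ^ 2 + 2 * R ^ 2 / ν * h ^ 2 - 2 * R * h * x =
        (ν * x - 2 * R * h) ^ 2 / (2 * ν) := by field_simp; ring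
    have e4 : 0 ≤ (ν * x - 2 * R * h) ^ 2 / (2 * ν) := by positivity
    linarith
  have h3 : 2 * R ^ 2 / ν * h ^ 2 ≤ 2 * R ^ 2 / ν * (a * x) := by gcongr
  have h4 : 2 * R ^ 2 / ν * (a * x) ≤ ν / 2 * x ^ 2 + 2 * R ^ 4 / ν ^ 3 * a ^ 2 := by
    have e3 : ν / 2 * x ^ 2 + 2 * R ^ 4 / ν ^ 3 * a ^ 2 - 2 * R ^ 2 / ν * (a * x) =
        (ν ^ 2 * x - 2 * R ^ 2 * a) ^ 2 / (2 * ν ^ 3) := by field_simp; ring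
    have e4 : 0 ≤ (ν ^ 2 * x - 2 * R ^ 2 * a) ^ 2 / (2 * ν ^ 3) := by positivity
    linarith
  linarith

lemma sobSq_one_sub_le {R : ℝ} {u u' : L2Field L} (hu : sobSq 1 u ≤ ENNReal.ofReal (R ^ 2))
    (hu' : sobSq 1 u' ≤ ENNReal.ofReal (R ^ 2)) :
    sobSq 1 (u - u') ≤ ENNReal.ofReal ((2 * R) ^ 2) := by
  refine (sobSq_sub_le 1 u u').trans ?_
  have h2 : ∀ a : ℝ, 2 * ENNReal.ofReal a = ENNReal.ofReal (2 * a) := fun a => by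
    rw [ENNReal.ofReal_mul zero_le_two, ENNReal.ofReal_ofNat]
  refine (add_le_add (mul_le_mul_right hu 2) (mul_le_mul_right hu' 2)).trans_eq ?_
  rw [h2, ← ENNReal.ofReal_add (by positivity) (by positivity)]
  congr 1; ring

lemma sobSq_half_high_le {R : ℝ} (N : ℕ) {w : L2Field L}
    (hw : sobSq 1 w ≤ ENNReal.ofReal (R ^ 2)) :
    sobSq (1 / 2) (w - trunc (box N) w) ≤ ENNReal.ofReal ((R / Real.sqrt (freq L N)) ^ 2) := by
  have hf := freq_pos (L := L) N
  refine (sobSq_high_le N (by norm_num : (1 / 2 : ℝ) ≤ 1) w).trans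
    ((mul_le_mul_right hw _).trans_eq ?_)
  rw [← ENNReal.ofReal_mul (by positivity), div_pow, Real.sq_sqrt hf.le, ← Real.rpow_natCast,
    ← Real.rpow_mul hf.le]
  norm_num
  rw [Real.rpow_neg_one]
  congr 1; ring

/-- Only b(P_N w, u', P_N w) has to be handled by Gronwall; the two terms that contain w - P_N w are
small with the cutoff. Of the dissipation 2ν, Young's inequality uses 3ν/2. -/
lemma rate_bound_ball {ν l ε ε' R : ℝ} (hν : 0 < ν) (hR : 0 ≤ R) (N : ℕ) (f f' : L2Field L)
    {u u' : L2Field L} (hu : u ∈ V₀ L) (hu' : u' ∈ V₀ L)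
    (hb : sobSq 1 u ≤ ENNReal.ofReal (R ^ 2)) (hb' : sobSq 1 u' ≤ ENNReal.ofReal (R ^ 2)) :
    2 * (rate ν l ε (box N) f u (u - u') - rate ν l ε' (box N) f' u' (u - u')) +
        ν / 2 * ∑ k ∈ box N, sobTerm 1 (u - u') k ≤
      2 * R ^ 4 / ν ^ 3 * (∑ k ∈ box N, sobTerm 0 (u - u') k) +
      (16 * R ^ 3 / Real.sqrt (freq L N) +
        2 / (ν * (2 * Real.pi / L) ^ 2) * ‖f - f'‖ ^ 2 +
        (2 * (ε' - ε) * partForm (box N) l u' (u - u') -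
          2 * ε * ∑ k ∈ box N, sobTerm l (u - u') k)) := by
  rw [rate_sub_rate neg_mem_box ν l ε ε' f f' hu hu']
  have hw := sub_mem_V₀ hu hu'
  have hbw := sobSq_one_sub_le hb hb'
  set w := u - u'
  set S := box N
  set d := 2 * R / Real.sqrt (freq L N) with hd
  have hf := freq_pos (L := L) N
  have hd0 : 0 ≤ d := by positivity
  have hQ : sobSq (1 / 2) (w - trunc S w) ≤ ENNReal.ofReal (d ^ 2) :=
    sobSq_half_high_le N hbw
  have hQV : w - trunc S w ∈ V₀ L := sub_mem_V₀ hw (trunc_mem neg_mem_box hw)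
  set x := Real.sqrt (∑ k ∈ S, sobTerm 1 w k)
  set a := Real.sqrt (∑ k ∈ S, sobTerm 0 w k)
  set h := Real.sqrt (∑ k ∈ S, sobTerm (1 / 2) w k)
  have hx0 : 0 ≤ x := Real.sqrt_nonneg _
  have ha0 : 0 ≤ a := Real.sqrt_nonneg _
  have hh0 : 0 ≤ h := Real.sqrt_nonneg _
  have hx2 : x ^ 2 = ∑ k ∈ S, sobTerm 1 w k := Real.sq_sqrt (sum_sobTerm_nonneg S 1 w)
  have ha2 : a ^ 2 = ∑ k ∈ S, sobTerm 0 w k := Real.sq_sqrt (sum_sobTerm_nonneg S 0 w)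
  have hh2 : h ^ 2 = ∑ k ∈ S, sobTerm (1 / 2) w k := Real.sq_sqrt (sum_sobTerm_nonneg S _ w)
  have hz1 : sobSq 1 (trunc S w) ≤ ENNReal.ofReal (x ^ 2) := by
    rw [hx2, sobSq_trunc neg_mem_box]
  have hzh : sobSq (1 / 2) (trunc S w) ≤ ENNReal.ofReal (h ^ 2) := by
    rw [hh2, sobSq_trunc neg_mem_box]
  have hxR : x ≤ 2 * R :=
    Real.sqrt_le_iff.mpr ⟨by positivity, sum_sobTerm_le_of_sobSq_le S (by positivity) hbw⟩
  have hax : 2 * Real.pi / L * a ≤ x := by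
    have hμ := two_pi_div_pos (L := L)
    apply Real.le_sqrt_of_sq_le
    rw [mul_pow, ha2, Finset.mul_sum]
    refine Finset.sum_le_sum fun k _ => ?_
    have := sobTerm_poincare zero_le_one hw k
    rw [freq_zero, zero_sub, Real.rpow_neg_one] at this
    rwa [← le_inv_mul_iff₀ (by positivity)]
  have hhax : h ^ 2 ≤ a * x := hh2 ▸ sum_sobTerm_half_le S w
  -- Moving the derivative to the test field leaves only the norm of order 1/2 on the high modes,
  -- which gains half a power of the frequency.
  have t1 : |tri S u (w - trunc S w) w| ≤ R * d * x :=
    abs_le_of_enorm_sq_le hR hd0 hx0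
      (enorm_tri_sq_le_test neg_mem_box (s := 1) (by norm_num) (by norm_num) hu hQV) hb
      (by norm_num at hQ ⊢; exact hQ) hz1
  have t2 : |tri S (trunc S w) u' w| ≤ h * x * R :=
    abs_le_of_enorm_sq_le hh0 hx0 hR
      (enorm_tri_sq_le_gradient neg_mem_box (s := 1 / 2) (by norm_num) (by norm_num)
        (trunc_mem neg_mem_box hw) hw) hzh (by norm_num at hz1 ⊢; exact hz1) hb'
  have t3 : |tri S (w - trunc S w) u' w| ≤ d * x * R :=
    abs_le_of_enorm_sq_le hd0 hx0 hR
      (enorm_tri_sq_le_gradient neg_mem_box (s := 1 / 2) (by norm_num) (by norm_num)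
        hQV hw) hQ (by norm_num at hz1 ⊢; exact hz1) hb'
  have t4 : tri S w u' w = tri S (trunc S w) u' w + tri S (w - trunc S w) u' w := by
    rw [tri_sub_left hw (trunc_mem neg_mem_box hw)]; ring
  have t5 : |partForm S 0 (f - f') w| ≤ ‖f - f'‖ * a := abs_partForm_zero_le S _ _
  have hy := young_ball (R := R) hν (two_pi_div_pos (L := L)) (norm_nonneg (f - f')) hax hhax
  have hdx : d * x ≤ d * (2 * R) := by gcongr
  have hRdx : R * (d * x) ≤ R * (d * (2 * R)) := by gcongr
  -- Each of the two cutoff terms is at most R d x ≤ 2R² d, and both enter with the factor 2.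
  have e16 : 16 * R ^ 3 / Real.sqrt (freq L N) = 8 * R ^ 2 * d := by rw [hd]; ring
  rw [e16, ← hx2, ← ha2]
  have b1 := neg_abs_le (tri S u (w - trunc S w) w)
  have b2 := neg_abs_le (tri S (trunc S w) u' w)
  have b3 := neg_abs_le (tri S (w - trunc S w) u' w)
  have b5 := le_abs_self (partForm S 0 (f - f') w)
  rw [t4]
  nlinarith

end Ball

/-! ### The Gronwall bound and the convergence in a ball of `V₁` -/

section BallEstimates

variable {L : ℝ} [hL : Fact (0 < L)]

lemma trunc_sub {S : Finset (Fin 3 → ℤ)} (hS : ∀ k, k ∈ S → -k ∈ S) (u v : L2Field L) :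
    trunc S (u - v) = trunc S u - trunc S v := by
  refine ext_coeff fun k j => ?_
  rw [coeff_sub, coeff_trunc hS, coeff_trunc hS, coeff_trunc hS, coeff_sub]
  split_ifs <;> simp

lemma norm_sq_eq_trunc_add {S : Finset (Fin 3 → ℤ)} (hS : ∀ k, k ∈ S → -k ∈ S) (u : L2Field L) :
    ‖u‖ ^ 2 = ‖trunc S u‖ ^ 2 + ‖u - trunc S u‖ ^ 2 := by
  have h := sobSq_eq_trunc_add hS 0 u
  simp only [sobSq_zero_exponent] at h
  rw [← ENNReal.ofReal_add (by positivity) (by positivity)] at h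
  exact (ENNReal.ofReal_eq_ofReal_iff (by positivity) (by positivity)).mp h

lemma norm_trunc_le {S : Finset (Fin 3 → ℤ)} (hS : ∀ k, k ∈ S → -k ∈ S) (u : L2Field L) :
    ‖trunc S u‖ ≤ ‖u‖ := by
  have := norm_sq_eq_trunc_add hS u
  exact abs_le_of_sq_le_sq' (by nlinarith [sq_nonneg ‖u - trunc S u‖]) (norm_nonneg u) |>.2

lemma tendsto_norm_trunc_sq (u : L2Field L) :
    Tendsto (fun N => ‖trunc (box N) u‖ ^ 2) atTop (𝓝 (‖u‖ ^ 2)) := by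
  have h := (hasSum_norm_sq u).comp tendsto_box
  refine h.congr fun N => ?_
  rw [norm_trunc_sq neg_mem_box]
  simp [sobTerm]

lemma continuousOn_coeff_sub {u u' : ℝ → L2Field L} (hu : MemX0 u) (hu' : MemX0 u')
    (k : Fin 3 → ℤ) (j : Fin 3) : ContinuousOn (fun t => coeff (u t - u' t) k j) (Ici 0) := by
  simp only [coeff_sub]
  exact (continuousOn_coeff hu k j).sub (continuousOn_coeff hu' k j)

lemma intervalIntegrable_sum_sobTerm (S : Finset (Fin 3 → ℤ)) (s : ℝ) {u : ℝ → L2Field L}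
    (hu : ∀ k j, ContinuousOn (fun t => coeff (u t) k j) (Ici 0)) {T : ℝ} (hT : 0 ≤ T) :
    IntervalIntegrable (fun t => ∑ k ∈ S, sobTerm s (u t) k) volume 0 T := by
  have hsub : uIcc 0 T ⊆ Ici (0 : ℝ) := by rw [uIcc_of_le hT]; exact fun x hx => hx.1
  exact ((continuousOn_sum_sobTerm s hu).mono hsub).intervalIntegrable

lemma ofReal_integral_sum_sobTerm (S : Finset (Fin 3 → ℤ)) (s : ℝ) {u : ℝ → L2Field L}
    (hu : ∀ k j, ContinuousOn (fun t => coeff (u t) k j) (Ici 0)) {T : ℝ} (hT : 0 ≤ T) :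
    ENNReal.ofReal (∫ t in (0 : ℝ)..T, ∑ k ∈ S, sobTerm s (u t) k) =
      ∫⁻ t in Icc 0 T, ENNReal.ofReal (∑ k ∈ S, sobTerm s (u t) k) := by
  rw [intervalIntegral.integral_of_le hT, ← integral_Icc_eq_integral_Ioc,
    ofReal_integral_eq_lintegral_ofReal]
  · exact (intervalIntegrable_iff_integrableOn_Icc_of_le hT).mp
      (intervalIntegrable_sum_sobTerm S s hu hT)
  · exact ae_of_all _ fun t => sum_sobTerm_nonneg S s (u t)

variable {ν l ε ε' R T : ℝ} {f f' : L2Field L} {u u' : ℝ → L2Field L}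

/-- Gronwall's inequality for the low modes of the difference of two solutions in a ball. -/
lemma ball_gronwall (hν : 0 < ν) (hR : 0 ≤ R) (hu : IsWeakSolution ν l ε f u)
    (hu' : IsWeakSolution ν l ε' f' u') (hb : ∀ t, 0 ≤ t → sobSq 1 (u t) ≤ ENNReal.ofReal (R ^ 2))
    (hb' : ∀ t, 0 ≤ t → sobSq 1 (u' t) ≤ ENNReal.ofReal (R ^ 2)) (hT : 0 ≤ T) (N : ℕ) {b : ℝ → ℝ}
    (hbi : IntervalIntegrable b volume 0 T) (hb0 : ∀ s, 0 ≤ s → 0 ≤ b s)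
    (hle : ∀ s, 0 ≤ s → 2 * (ε' - ε) * partForm (box N) l (u' s) (u s - u' s) -
      2 * ε * ∑ k ∈ box N, sobTerm l (u s - u' s) k ≤ b s) :
    (∀ t ∈ Icc 0 T, ‖trunc (box N) (u t - u' t)‖ ^ 2 ≤ (‖u 0 - u' 0‖ ^ 2 +
      (T * (16 * R ^ 3 / Real.sqrt (freq L N) + 2 / (ν * (2 * Real.pi / L) ^ 2) * ‖f - f'‖ ^ 2) +
        ∫ s in (0 : ℝ)..T, b s)) * Real.exp (2 * R ^ 4 / ν ^ 3 * T)) ∧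
    ν / 2 * (∫ s in (0 : ℝ)..T, ∑ k ∈ box N, sobTerm 1 (u s - u' s) k) ≤ (‖u 0 - u' 0‖ ^ 2 +
      (T * (16 * R ^ 3 / Real.sqrt (freq L N) + 2 / (ν * (2 * Real.pi / L) ^ 2) * ‖f - f'‖ ^ 2) +
        ∫ s in (0 : ℝ)..T, b s)) *
        (1 + 2 * R ^ 4 / ν ^ 3 * T * Real.exp (2 * R ^ 4 / ν ^ 3 * T)) := by
  set K := 16 * R ^ 3 / Real.sqrt (freq L N) +
    2 / (ν * (2 * Real.pi / L) ^ 2) * ‖f - f'‖ ^ 2 with hK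
  have hμ := two_pi_div_pos (L := L)
  have hK0 : 0 ≤ K := by positivity
  have hc := continuousOn_coeff_sub hu.memX0 hu'.memX0
  have hid := fun t (ht : t ∈ Icc 0 T) => energy_identity (S := box N) neg_mem_box hu hu' ht.1
  have h := energy_gronwall (φ := fun s => ‖trunc (box N) (u s - u' s)‖ ^ 2)
    (X := fun s => ∑ k ∈ box N, sobTerm 1 (u s - u' s) k) (a := fun _ => 2 * R ^ 4 / ν ^ 3)
    (b := fun s => K + b s) (κ := ν / 2) hT
    (by
      simp only [norm_trunc_sq neg_mem_box]
      exact (continuousOn_sum_sobTerm 0 hc).mono fun x hx => hx.1)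
    (fun s _ => by positivity) (intervalIntegrable_sum_sobTerm _ 1 hc hT)
    (fun s _ => sum_sobTerm_nonneg _ _ _) (by positivity) intervalIntegrable_const
    (fun s _ => by positivity) (intervalIntegrable_const.add hbi)
    (fun s hs => add_nonneg hK0 (hb0 s hs.1)) (hid T ⟨hT, le_rfl⟩).1 (fun t ht => (hid t ht).2)
    ((ae_restrict_iff' measurableSet_Icc).mpr (ae_of_all _ fun s hs => by
      have h1 := rate_bound_ball (l := l) (ε := ε) (ε' := ε') hν hR N f f'
        (hu.memX0.mem s hs.1) (hu'.memX0.mem s hs.1) (hb s hs.1) (hb' s hs.1)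
      have h2 := hle s hs.1
      simp only [norm_trunc_sq neg_mem_box]
      linarith))
  rw [intervalIntegral.integral_add intervalIntegrable_const hbi, intervalIntegral.integral_const,
    intervalIntegral.integral_const, sub_zero, smul_eq_mul, smul_eq_mul, mul_comm T (_ / _)] at h
  have h0 : ‖trunc (box N) (u 0 - u' 0)‖ ^ 2 ≤ ‖u 0 - u' 0‖ ^ 2 := by
    have := norm_trunc_le (S := box N) neg_mem_box (u 0 - u' 0)
    gcongr
  refine ⟨fun t ht => (h.1 t ht).trans ?_, h.2.trans ?_⟩
  · gcongr
  · gcongr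

/-- Completing the square lets the dissipation 2ε ‖P_S w‖_l² absorb the cross term, at the price of
the factor 1/(2ε). If ε = ε' there is no cross term, and the quotient is 0 even for ε = 0. -/
lemma viscosity_term_le {S : Finset (Fin 3 → ℤ)} (hε : 0 ≤ ε) (h : 0 < ε ∨ ε = ε')
    (v w : L2Field L) :
    2 * (ε' - ε) * partForm S l v w - 2 * ε * ∑ k ∈ S, sobTerm l w k ≤
      (ε - ε') ^ 2 / (2 * ε) * ∑ k ∈ S, sobTerm l v k := by
  have hw := sum_sobTerm_nonneg S l w
  rcases h with h | h
  · have h1 := abs_partForm_le (S := S) l v w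
    set x := Real.sqrt (∑ k ∈ S, sobTerm l v k)
    set y := Real.sqrt (∑ k ∈ S, sobTerm l w k)
    have hx : x ^ 2 = ∑ k ∈ S, sobTerm l v k := Real.sq_sqrt (sum_sobTerm_nonneg S l v)
    have hy : y ^ 2 = ∑ k ∈ S, sobTerm l w k := Real.sq_sqrt hw
    rw [← hx, ← hy]
    have h2 : 2 * (ε' - ε) * partForm S l v w ≤ 2 * |ε' - ε| * (x * y) := by
      have := le_abs_self ((ε' - ε) * partForm S l v w)
      rw [abs_mul] at this
      have h3 := mul_le_mul_of_nonneg_left h1 (abs_nonneg (ε' - ε))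
      linarith
    have h4 : (ε - ε') ^ 2 = |ε' - ε| ^ 2 := by rw [sq_abs]; ring
    have h5 : (ε - ε') ^ 2 / (2 * ε) * x ^ 2 + 2 * ε * y ^ 2 - 2 * |ε' - ε| * (x * y) =
        (|ε' - ε| * x - 2 * ε * y) ^ 2 / (2 * ε) := by
      rw [h4]; field_simp; ring
    have h6 : 0 ≤ (|ε' - ε| * x - 2 * ε * y) ^ 2 / (2 * ε) := by positivity
    linarith
  · subst h
    simp only [sub_self, mul_zero, zero_mul, zero_sub]
    have := mul_nonneg hε hw
    norm_num
    linarith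

lemma gronwall_bound (hν : 0 < ν) (hε : 0 ≤ ε) (hεε' : 0 < ε ∨ ε = ε') (hR : 0 ≤ R)
    (hu : IsWeakSolution ν l ε f u)
    (hu' : IsWeakSolution ν l ε' f' u') (hb : ∀ t, 0 ≤ t → sobSq 1 (u t) ≤ ENNReal.ofReal (R ^ 2))
    (hb' : ∀ t, 0 ≤ t → sobSq 1 (u' t) ≤ ENNReal.ofReal (R ^ 2)) {t : ℝ} (ht : t ∈ Icc 0 T) :
    ENNReal.ofReal (‖u t - u' t‖ ^ 2) ≤
      ENNReal.ofReal (Real.exp (2 * R ^ 4 / ν ^ 3 * T)) *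
        (ENNReal.ofReal (‖u 0 - u' 0‖ ^ 2
            + 2 * T / (ν * (2 * Real.pi / L) ^ 2) * ‖f - f'‖ ^ 2)
          + ENNReal.ofReal ((ε - ε') ^ 2 / (2 * ε)) *
            ∫⁻ s in Icc 0 T, sobSq l (u' s)) := by
  have hT : 0 ≤ T := ht.1.trans ht.2
  have hμ := two_pi_div_pos (L := L)
  have hκ : 0 ≤ (ε - ε') ^ 2 / (2 * ε) := by positivity
  have hc' := continuousOn_coeff hu'.memX0
  have hlim1 : Tendsto (fun N => ENNReal.ofReal (‖trunc (box N) (u t - u' t)‖ ^ 2)) atTop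
      (𝓝 (ENNReal.ofReal (‖u t - u' t‖ ^ 2))) :=
    ENNReal.tendsto_ofReal (tendsto_norm_trunc_sq _)
  have hlim2 : Tendsto (fun N => ENNReal.ofReal (Real.exp (2 * R ^ 4 / ν ^ 3 * T)) *
        (ENNReal.ofReal (‖u 0 - u' 0‖ ^ 2
            + 2 * T / (ν * (2 * Real.pi / L) ^ 2) * ‖f - f'‖ ^ 2 +
              T * (16 * R ^ 3 / Real.sqrt (freq L N)))
          + ENNReal.ofReal ((ε - ε') ^ 2 / (2 * ε)) * ∫⁻ s in Icc 0 T, sobSq l (u' s))) atTop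
      (𝓝 (ENNReal.ofReal (Real.exp (2 * R ^ 4 / ν ^ 3 * T)) *
        (ENNReal.ofReal (‖u 0 - u' 0‖ ^ 2
            + 2 * T / (ν * (2 * Real.pi / L) ^ 2) * ‖f - f'‖ ^ 2 + T * 0)
          + ENNReal.ofReal ((ε - ε') ^ 2 / (2 * ε)) *
            ∫⁻ s in Icc 0 T, sobSq l (u' s)))) := by
    refine ENNReal.Tendsto.const_mul ?_ (Or.inr ENNReal.ofReal_ne_top)
    refine (ENNReal.tendsto_ofReal ?_).add tendsto_const_nhds
    refine tendsto_const_nhds.add (Tendsto.const_mul T ?_)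
    exact tendsto_const_nhds.div_atTop (Real.tendsto_sqrt_atTop.comp tendsto_freq)
  rw [mul_zero, add_zero] at hlim2
  refine le_of_tendsto_of_tendsto' hlim1 hlim2 fun N => ?_
  have h := (ball_gronwall hν hR hu hu' hb hb' hT N
    (b := fun s => (ε - ε') ^ 2 / (2 * ε) * ∑ k ∈ box N, sobTerm l (u' s) k)
    ((intervalIntegrable_sum_sobTerm _ l hc' hT).const_mul _)
    (fun s _ => mul_nonneg hκ (sum_sobTerm_nonneg _ _ _))
    (fun s _ => viscosity_term_le hε hεε' _ _)).1 t ht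
  have hi : ENNReal.ofReal (∫ s in (0 : ℝ)..T,
      (ε - ε') ^ 2 / (2 * ε) * ∑ k ∈ box N, sobTerm l (u' s) k) ≤
      ENNReal.ofReal ((ε - ε') ^ 2 / (2 * ε)) * ∫⁻ s in Icc 0 T, sobSq l (u' s) := by
    rw [intervalIntegral.integral_const_mul, ENNReal.ofReal_mul hκ,
      ofReal_integral_sum_sobTerm _ l hc' hT]
    gcongr with s
    rw [← sobSq_trunc neg_mem_box]
    exact sobSq_trunc_le neg_mem_box l (u' s)
  have hI0 : 0 ≤ ∫ s in (0 : ℝ)..T,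
      (ε - ε') ^ 2 / (2 * ε) * ∑ k ∈ box N, sobTerm l (u' s) k :=
    intervalIntegral.integral_nonneg hT fun s _ => mul_nonneg hκ (sum_sobTerm_nonneg _ _ _)
  refine (ENNReal.ofReal_le_ofReal h).trans ?_
  rw [mul_comm, ENNReal.ofReal_mul (Real.exp_pos _).le]
  refine mul_le_mul_right ?_ _
  refine le_trans (le_of_eq ?_) (add_le_add_right hi _)
  rw [← ENNReal.ofReal_add (by positivity) hI0]
  congr 1
  ring

lemma sobSq_zero_field (s : ℝ) : sobSq s (0 : L2Field L) = 0 := by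
  simp [sobSq, coeff_zero]

lemma trilinear_zero (v w : L2Field L) : trilinear 0 v w = 0 := by
  refine Finset.sum_eq_zero fun i _ => Finset.sum_eq_zero fun j _ => ?_
  refine integral_eq_zero_of_ae ?_
  filter_upwards [Lp.coeFn_zero (EuclideanSpace ℝ (Fin 3)) 2 (volume : Measure (Box L))] with x hx
  rw [hx]
  simp

/-- Comparison with the zero solution turns the energy identity for differences into one for a
single solution. -/
lemma isWeakSolution_zero (ν l ε : ℝ) :
    IsWeakSolution ν l ε (0 : L2Field L) (fun _ => (0 : L2Field L)) where
  memX0 := {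
    mem := fun _ _ => zero_mem_V₀
    bounded := ⟨0, fun _ _ => by simp⟩
    weakly_continuous := fun v _ => by simpa using continuousOn_const
    locally_square_integrable := fun T => by simp [sobSq_zero_field] }
  regular := fun _ T => by simp [sobSq_zero_field]
  equation := fun v _ _ t₀ t _ _ => by simp [trilinear_zero, powForm, coeff_zero]
  energy := Eventually.of_forall fun t₀ t _ => by simp [sobSq_zero_field]

/-- High frequencies of solutions in a ball are small in `L²(0, T; V₁)`. -/
lemma tail_ball (hν : 0 < ν) (hε : 0 ≤ ε) (hR : 0 ≤ R) (hu : IsWeakSolution ν l ε f u)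
    (hb : ∀ t, 0 ≤ t → sobSq 1 (u t) ≤ ENNReal.ofReal (R ^ 2)) (hT : 0 ≤ T) (M : ℕ) :
    ∫⁻ s in Icc 0 T, sobSq 1 (u s - trunc (box M) (u s)) ≤
      ENNReal.ofReal ((R ^ 2 / freq L M ^ 2 +
        2 * T * (R ^ 3 / Real.sqrt (freq L M) + ‖f‖ * (R / freq L M))) / (2 * ν)) := by
  have hf := freq_pos (L := L) M
  have hc := continuousOn_coeff hu.memX0
  set B := R ^ 2 / freq L M ^ 2 + 2 * T * (R ^ 3 / Real.sqrt (freq L M) + ‖f‖ * (R / freq L M))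
  have key : ∀ N, ∫⁻ s in Icc 0 T,
      ENNReal.ofReal (∑ k ∈ box N \ box M, sobTerm 1 (u s) k) ≤ ENNReal.ofReal (B / (2 * ν)) := by
    intro N
    -- On the shell between the two cubes, the initial energy, the work of the force and the
    -- nonlinear term are all small in terms of `freq L M`. The ε term has a favourable sign, so the
    -- bound is uniform in ε; N tends to infinity at the end.
    set S := box N \ box M with hSdef
    have hS : ∀ k, k ∈ S → -k ∈ S := by
      intro k hk
      rw [hSdef, Finset.mem_sdiff] at hk ⊢
      exact ⟨neg_mem_box k hk.1, fun h => hk.2 (by simpa using neg_mem_box _ h)⟩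
    have hlow : ∀ {s : ℝ}, s ≤ 1 → ∀ v : L2Field L, ∑ k ∈ S, sobTerm s v k ≤
        (freq L M ^ 2) ^ (s - 1) * ∑ k ∈ S, sobTerm 1 v k := by
      intro s hs v
      rw [Finset.mul_sum]
      exact Finset.sum_le_sum fun k hk => sobTerm_le_high (Finset.mem_sdiff.mp hk).2 hs v
    have hE1 : ∀ t, 0 ≤ t → ∑ k ∈ S, sobTerm 1 (u t) k ≤ R ^ 2 := fun t ht =>
      sum_sobTerm_le_of_sobSq_le S (by positivity) (hb t ht)
    have hE0 : ∀ t, 0 ≤ t → ∑ k ∈ S, sobTerm 0 (u t) k ≤ (R / freq L M) ^ 2 := by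
      intro t ht
      refine (hlow zero_le_one _).trans ?_
      rw [zero_sub, Real.rpow_neg_one, div_pow, inv_mul_eq_div]
      gcongr
      exact hE1 t ht
    have hEh : ∀ t, 0 ≤ t →
        ∑ k ∈ S, sobTerm (1 / 2) (u t) k ≤ (R / Real.sqrt (freq L M)) ^ 2 := by
      intro t ht
      refine (hlow (by norm_num) _).trans ?_
      have e : (freq L M ^ 2) ^ ((1 : ℝ) / 2 - 1) = (freq L M)⁻¹ := by
        rw [← Real.rpow_natCast, ← Real.rpow_mul hf.le, ← Real.rpow_neg_one]
        norm_num
      rw [e, div_pow, Real.sq_sqrt hf.le, inv_mul_eq_div]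
      gcongr
      exact hE1 t ht
    obtain ⟨hint, hid⟩ := energy_identity hS hu (isWeakSolution_zero ν l ε) hT
    have hrate : ∀ s ∈ Icc 0 T, rate ν l ε S f (u s) (u s - 0) - rate ν l ε S 0 0 (u s - 0) ≤
        (R ^ 3 / Real.sqrt (freq L M) + ‖f‖ * (R / freq L M)) -
          ν * ∑ k ∈ S, sobTerm 1 (u s) k := by
      intro s hs
      have h0 : rate ν l ε S 0 0 (u s - 0) = 0 := by
        simp [rate, partForm, tri, triTerm, coeff_zero]
      have hV := hu.memX0.mem s hs.1
      have t1 : |tri S (u s) (u s) (u s)| ≤ R * (R / Real.sqrt (freq L M)) * R :=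
        abs_le_of_enorm_sq_le hR (by positivity) hR
          (enorm_tri_sq_le_gradient hS (s := 1) (by norm_num) (by norm_num) hV hV) (hb s hs.1)
          (by
            rw [sobSq_trunc hS]
            norm_num
            exact ENNReal.ofReal_le_ofReal (by simpa using hEh s hs.1)) (hb s hs.1)
      have t2 : |partForm S 0 f (u s)| ≤ ‖f‖ * (R / freq L M) := by
        refine (abs_partForm_zero_le S f (u s)).trans ?_
        gcongr
        exact Real.sqrt_le_iff.mpr ⟨by positivity, hE0 s hs.1⟩
      rw [h0, sub_zero, sub_zero, rate, partForm_self, partForm_self]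
      have b1 := neg_abs_le (tri S (u s) (u s) (u s))
      have b2 := le_abs_self (partForm S 0 f (u s))
      have b3 := mul_nonneg hε (sum_sobTerm_nonneg S l (u s))
      have e : R * (R / Real.sqrt (freq L M)) * R = R ^ 3 / Real.sqrt (freq L M) := by ring
      linarith
    have hX := intervalIntegrable_sum_sobTerm S 1 hc hT
    have h1 := intervalIntegral.integral_mono_on hT hint
      (intervalIntegrable_const.sub (hX.const_mul ν)) hrate
    rw [intervalIntegral.integral_sub intervalIntegrable_const (hX.const_mul ν),
      intervalIntegral.integral_const, intervalIntegral.integral_const_mul, smul_eq_mul,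
      sub_zero] at h1
    rw [sub_zero, sub_zero, norm_trunc_sq hS, norm_trunc_sq hS] at hid
    have h2 := hE0 0 le_rfl
    rw [div_pow] at h2
    have h3 := sum_sobTerm_nonneg S 0 (u T)
    rw [← ofReal_integral_sum_sobTerm _ 1 hc hT]
    apply ENNReal.ofReal_le_ofReal
    rw [le_div_iff₀ (by positivity)]
    simp only [B]
    linarith
  have hmeas : ∀ k, AEMeasurable
      (fun s => ENNReal.ofReal (sobTerm 1 (u s - trunc (box M) (u s)) k))
      (volume.restrict (Icc 0 T)) := by
    intro k
    have := continuousOn_sum_sobTerm (S := {k}) 1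
      (u := fun s => u s - trunc (box M) (u s)) (fun k j => by
        simp only [coeff_sub, coeff_trunc neg_mem_box]
        split_ifs
        · simpa using continuousOn_const
        · simpa using hc k j)
    simp only [Finset.sum_singleton] at this
    exact ENNReal.measurable_ofReal.comp_aemeasurable
      ((this.mono fun x hx => hx.1).aemeasurable measurableSet_Icc)
  simp only [sobSq_eq]
  rw [lintegral_tsum hmeas]
  refine le_of_tendsto' (ENNReal.summable.hasSum.comp tendsto_box) fun N => ?_
  rw [Function.comp_apply, ← lintegral_finsetSum' _ fun k _ => hmeas k]
  refine le_trans (lintegral_mono fun s => ?_) (key N)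
  rw [ENNReal.ofReal_sum_of_nonneg fun k _ => sobTerm_nonneg _ _ _,
    ← Finset.sum_subset (Finset.sdiff_subset (s := box N) (t := box M)) fun k hk hk' => ?_]
  · refine (Finset.sum_congr rfl fun k hk => ?_).le
    rw [sobTerm, sobTerm, amp_sub_trunc neg_mem_box, if_neg (Finset.mem_sdiff.mp hk).2]
  · have : k ∈ box M := by
      by_contra h
      exact hk' (Finset.mem_sdiff.mpr ⟨hk, h⟩)
    rw [sobTerm, amp_sub_trunc neg_mem_box, if_pos this]
    simp

end BallEstimates

/-! ### Continuous dependence in a ball of `V₁` -/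

section BallConvergence

variable {L : ℝ} [hL : Fact (0 < L)] {ν l : ℝ}

lemma tendstoX0_of_nonneg {u : ℕ → ℝ → L2Field L} {u₀ : ℝ → L2Field L}
    (h : ∀ T : ℝ, 0 ≤ T → TendstoUniformlyOn u u₀ atTop (Icc 0 T) ∧
      Tendsto (fun n => ∫⁻ s in Icc 0 T, sobSq 1 (u n s - u₀ s)) atTop (𝓝 0)) :
    TendstoX0 u u₀ := by
  intro T
  rcases le_or_gt 0 T with hT | hT
  · exact h T hT
  · rw [Icc_eq_empty_of_lt hT]
    simp [tendstoUniformlyOn_empty]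

/-- The order of the limits: the cutoff N is fixed first, then n grows. The convergence in n may
thus depend on N in any way. -/
lemma exists_eventually_lt {G : ℕ → ℕ → ℝ} {g : ℕ → ℝ}
    (hG : ∀ N, Tendsto (G N) atTop (𝓝 (g N))) (hg : Tendsto g atTop (𝓝 0)) {δ : ℝ} (hδ : 0 < δ) :
    ∃ N, ∀ᶠ n in atTop, G N n < δ := by
  obtain ⟨N, hN⟩ := (hg.eventually_lt_const hδ).exists
  exact ⟨N, (hG N).eventually_lt_const hN⟩

lemma tendstoUniformlyOn_of_norm_sq_le {u : ℕ → ℝ → L2Field L} {u₀ : ℝ → L2Field L} {A : Set ℝ}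
    {G : ℕ → ℕ → ℝ} {g : ℕ → ℝ} (hG : ∀ N, Tendsto (G N) atTop (𝓝 (g N)))
    (hg : Tendsto g atTop (𝓝 0)) (h : ∀ N, ∀ᶠ n in atTop, ∀ t ∈ A, ‖u n t - u₀ t‖ ^ 2 ≤ G N n) :
    TendstoUniformlyOn u u₀ atTop A := by
  rw [Metric.tendstoUniformlyOn_iff]
  intro δ hδ
  obtain ⟨N, hN⟩ := exists_eventually_lt hG hg (pow_pos hδ 2)
  filter_upwards [hN, h N] with n hn hn' t ht
  rw [dist_eq_norm, norm_sub_rev]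
  exact lt_of_pow_lt_pow_left₀ 2 hδ.le ((hn' t ht).trans_lt hn)

lemma tendsto_zero_of_le_ofReal {a : ℕ → ℝ≥0∞} {G : ℕ → ℕ → ℝ} {g : ℕ → ℝ}
    (hG : ∀ N, Tendsto (G N) atTop (𝓝 (g N))) (hg : Tendsto g atTop (𝓝 0))
    (h : ∀ N, ∀ᶠ n in atTop, a n ≤ ENNReal.ofReal (G N n)) : Tendsto a atTop (𝓝 0) := by
  rw [ENNReal.tendsto_nhds_zero]
  intro δ hδ
  obtain ⟨d, hd0, hd⟩ := ENNReal.lt_iff_exists_real_btwn.mp hδ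
  have hd' : 0 < d := ENNReal.ofReal_pos.mp (by simpa using hd.1)
  obtain ⟨N, hN⟩ := exists_eventually_lt hG hg hd'
  filter_upwards [hN, h N] with n hn hn'
  exact hn'.trans ((ENNReal.ofReal_le_ofReal hn.le).trans hd.2.le)

/-- The constant in `‖P_S u‖_l² ≤ C ‖P_S u‖₁²`. -/
def viscosityConst (L l : ℝ) (S : Finset (Fin 3 → ℤ)) : ℝ := ∑ k ∈ S, eigenvalue L k ^ (l - 1)

lemma viscosityConst_nonneg {L l : ℝ} (S : Finset (Fin 3 → ℤ)) : 0 ≤ viscosityConst L l S :=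
  Finset.sum_nonneg fun k _ => Real.rpow_nonneg (eigenvalue_nonneg k) _

lemma sum_sobTerm_le_viscosityConst (S : Finset (Fin 3 → ℤ)) {u : L2Field L} (hu : u ∈ V₀ L) :
    ∑ k ∈ S, sobTerm l u k ≤ viscosityConst L l S * ∑ k ∈ S, sobTerm 1 u k := by
  rw [Finset.mul_sum]
  refine Finset.sum_le_sum fun k hk => ?_
  rcases eq_or_ne k 0 with rfl | h0
  · rw [sobTerm_zero_mode _ hu, sobTerm_zero_mode _ hu, mul_zero]
  · have hp := eigenvalue_pos (L := L) h0
    have h1 : eigenvalue L k ^ (l - 1) ≤ viscosityConst L l S :=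
      Finset.single_le_sum (f := fun k => eigenvalue L k ^ (l - 1))
        (fun k _ => Real.rpow_nonneg (eigenvalue_nonneg k) _) hk
    have e : sobTerm l u k = eigenvalue L k ^ (l - 1) * sobTerm 1 u k := by
      rw [sobTerm, sobTerm, Real.rpow_sub_one hp.ne', Real.rpow_one]
      field_simp
    rw [e]
    exact mul_le_mul_of_nonneg_right h1 (sobTerm_nonneg _ _ _)

/-- A ball in V_1 gives no bound in V_l, but on finitely many modes the norms are comparable. The
constant grows with `S`, which is harmless since the form will be multiplied by ε_0 - ε_n at fixed
`S`. -/
lemma abs_partForm_viscosity_le {R : ℝ} (S : Finset (Fin 3 → ℤ)) {u u' : L2Field L}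
    (hu : u ∈ V₀ L) (hu' : u' ∈ V₀ L) (hb : sobSq 1 u ≤ ENNReal.ofReal (R ^ 2))
    (hb' : sobSq 1 u' ≤ ENNReal.ofReal (R ^ 2)) :
    |partForm S l u' (u - u')| ≤ 2 * (viscosityConst L l S * R ^ 2) := by
  have hΛ := viscosityConst_nonneg (L := L) (l := l) S
  have h1 : ∑ k ∈ S, sobTerm l u' k ≤ viscosityConst L l S * R ^ 2 :=
    (sum_sobTerm_le_viscosityConst S hu').trans
      (mul_le_mul_of_nonneg_left (sum_sobTerm_le_of_sobSq_le S (by positivity) hb') hΛ)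
  have h2 : ∑ k ∈ S, sobTerm l (u - u') k ≤ viscosityConst L l S * (2 * R) ^ 2 :=
    (sum_sobTerm_le_viscosityConst S (sub_mem_V₀ hu hu')).trans
      (mul_le_mul_of_nonneg_left
        (sum_sobTerm_le_of_sobSq_le S (by positivity) (sobSq_one_sub_le hb hb')) hΛ)
  refine (abs_partForm_le l u' (u - u')).trans ((mul_le_mul (Real.sqrt_le_sqrt h1)
    (Real.sqrt_le_sqrt h2) (Real.sqrt_nonneg _) (Real.sqrt_nonneg _)).trans_eq ?_)
  rw [← Real.sqrt_mul (by positivity), show viscosityConst L l S * R ^ 2 *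
    (viscosityConst L l S * (2 * R) ^ 2) = (2 * (viscosityConst L l S * R ^ 2)) ^ 2 by ring,
    Real.sqrt_sq (by positivity)]

lemma tendsto_div_freq (c : ℝ) : Tendsto (fun N => c / freq L N) atTop (𝓝 0) :=
  tendsto_const_nhds.div_atTop tendsto_freq

lemma tendsto_div_sqrt_freq (c : ℝ) : Tendsto (fun N => c / Real.sqrt (freq L N)) atTop (𝓝 0) :=
  tendsto_const_nhds.div_atTop (Real.tendsto_sqrt_atTop.comp tendsto_freq)

/-- Gronwall's inequality controls the modes in `box N`, with an error that vanishes as n → ∞ and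
then N → ∞. The remaining modes are small uniformly in time in L², by the V_1 bound, and in L²(0, T;
V_1), by `tail_ball`. No lower bound on ε_n is involved, so the limit ε_n → 0 is covered. -/
theorem tendstoX0_of_ball {R : ℝ} (hν : 0 < ν) (hR : 0 ≤ R) {ε : ℕ → ℝ} {ε₀ : ℝ}
    {f : ℕ → L2Field L} {f₀ : L2Field L} {u : ℕ → ℝ → L2Field L} {u₀ : ℝ → L2Field L}
    (hε : ∀ n, 0 ≤ ε n) (hε₀ : 0 ≤ ε₀) (hu : ∀ n, IsWeakSolution ν l (ε n) (f n) (u n))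
    (hb : ∀ n t, 0 ≤ t → sobSq 1 (u n t) ≤ ENNReal.ofReal (R ^ 2))
    (hu₀ : IsWeakSolution ν l ε₀ f₀ u₀)
    (hb₀ : ∀ t, 0 ≤ t → sobSq 1 (u₀ t) ≤ ENNReal.ofReal (R ^ 2))
    (hεt : Tendsto ε atTop (𝓝 ε₀)) (hft : Tendsto f atTop (𝓝 f₀))
    (h0 : Tendsto (fun n => u n 0) atTop (𝓝 (u₀ 0))) : TendstoX0 u u₀ := by
  refine tendstoX0_of_nonneg fun T hT => ?_
  set E := Real.exp (2 * R ^ 4 / ν ^ 3 * T) with hE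
  set c₀ := 2 / (ν * (2 * Real.pi / L) ^ 2)
  set D : ℕ → ℕ → ℝ := fun N n => ‖u n 0 - u₀ 0‖ ^ 2 +
    (T * (16 * R ^ 3 / Real.sqrt (freq L N) + c₀ * ‖f n - f₀‖ ^ 2) +
      T * (2 * |ε₀ - ε n| * (2 * (viscosityConst L l (box N) * R ^ 2)))) with hD
  have key : ∀ N n, (∀ t ∈ Icc 0 T, ‖trunc (box N) (u n t - u₀ t)‖ ^ 2 ≤ D N n * E) ∧
      ν / 2 * (∫ s in (0 : ℝ)..T, ∑ k ∈ box N, sobTerm 1 (u n s - u₀ s) k) ≤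
        D N n * (1 + 2 * R ^ 4 / ν ^ 3 * T * E) := by
    intro N n
    have h := ball_gronwall hν hR (hu n) hu₀ (hb n) hb₀ hT N
      (b := fun _ => 2 * |ε₀ - ε n| * (2 * (viscosityConst L l (box N) * R ^ 2)))
      intervalIntegrable_const
      (fun s _ => by have := viscosityConst_nonneg (L := L) (l := l) (box N); positivity)
      (fun s hs => by
        have h1 := abs_partForm_viscosity_le (l := l) (box N) ((hu n).memX0.mem s hs)
          (hu₀.memX0.mem s hs) (hb n s hs) (hb₀ s hs)
        have h2 := mul_nonneg (hε n) (sum_sobTerm_nonneg (box N) l (u n s - u₀ s))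
        have h3 := le_abs_self ((ε₀ - ε n) * partForm (box N) l (u₀ s) (u n s - u₀ s))
        rw [abs_mul] at h3
        have h4 := mul_le_mul_of_nonneg_left h1 (abs_nonneg (ε₀ - ε n))
        linarith)
    rw [intervalIntegral.integral_const, smul_eq_mul, sub_zero] at h
    exact h
  have hD1 : ∀ N, Tendsto (D N) atTop (𝓝 (T * (16 * R ^ 3 / Real.sqrt (freq L N)))) := by
    intro N
    have t1 : Tendsto (fun n => ‖u n 0 - u₀ 0‖) atTop (𝓝 0) := by
      simpa using (h0.sub_const (u₀ 0)).norm
    have t2 : Tendsto (fun n => ‖f n - f₀‖) atTop (𝓝 0) := by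
      simpa using (hft.sub_const f₀).norm
    have t3 : Tendsto (fun n => |ε₀ - ε n|) atTop (𝓝 0) := by
      simpa using (tendsto_const_nhds (x := ε₀)).sub hεt |>.abs
    have := (t1.pow 2).add (((((t2.pow 2).const_mul c₀).const_add
      (16 * R ^ 3 / Real.sqrt (freq L N))).const_mul T).add
        (((t3.const_mul 2).mul_const (2 * (viscosityConst L l (box N) * R ^ 2))).const_mul T))
    simpa using this
  have hD2 : Tendsto (fun N => T * (16 * R ^ 3 / Real.sqrt (freq L N))) atTop (𝓝 0) := by
    simpa using (tendsto_div_sqrt_freq (L := L) (16 * R ^ 3)).const_mul T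
  constructor
  · refine tendstoUniformlyOn_of_norm_sq_le (G := fun N n => D N n * E + (2 * R / freq L N) ^ 2)
      (fun N => ((hD1 N).mul_const E).add_const _) (by
        simpa using (hD2.mul_const E).add ((tendsto_div_freq (L := L) (2 * R)).pow 2))
      fun N => Eventually.of_forall fun n t ht => ?_
    rw [norm_sq_eq_trunc_add (neg_mem_box (N := N))]
    refine add_le_add ((key N n).1 t ht) ?_
    have h1 := (sobSq_high_le N zero_le_one (u n t - u₀ t)).trans
      (mul_le_mul_right (sobSq_one_sub_le (hb n t ht.1) (hb₀ t ht.1)) _)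
    have hf := freq_pos (L := L) N
    rw [sobSq_zero_exponent, ← ENNReal.ofReal_mul (by positivity), zero_sub,
      Real.rpow_neg_one, inv_mul_eq_div, ← div_pow] at h1
    exact (ENNReal.ofReal_le_ofReal_iff (by positivity)).mp h1
  · set B : ℕ → L2Field L → ℝ := fun N g => (R ^ 2 / freq L N ^ 2 +
      2 * T * (R ^ 3 / Real.sqrt (freq L N) + ‖g‖ * (R / freq L N))) / (2 * ν) with hB
    have hB1 : ∀ g, Tendsto (fun N => B N g) atTop (𝓝 0) := by
      intro g
      have h1 := (tendsto_div_freq (L := L) R).pow 2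
      have h2 := ((tendsto_div_sqrt_freq (L := L) (R ^ 3)).add
        ((tendsto_div_freq (L := L) R).const_mul ‖g‖)).const_mul (2 * T)
      simpa [hB, div_pow] using (h1.add h2).div_const (2 * ν)
    have hB2 : ∀ N, Tendsto (fun n => B N (f n)) atTop (𝓝 (B N f₀)) := by
      intro N
      exact ((((hft.norm.mul_const _).const_add _).const_mul _).const_add _).div_const _
    have hB0 : ∀ N g, 0 ≤ B N g := fun N g => by
      have := freq_pos (L := L) N
      positivity
    have hD0 : ∀ N n, 0 ≤ D N n := fun N n => by
      have := viscosityConst_nonneg (L := L) (l := l) (box N)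
      positivity
    have hE0 : 0 < E := Real.exp_pos _
    refine tendsto_zero_of_le_ofReal (G := fun N n =>
        D N n * (1 + 2 * R ^ 4 / ν ^ 3 * T * E) * (2 / ν) + (2 * B N (f n) + 2 * B N f₀))
      (fun N => (((hD1 N).mul_const _).mul_const _).add
        (((hB2 N).const_mul 2).add_const _)) ?_ fun N => Eventually.of_forall fun n => ?_
    · simpa using ((hD2.mul_const (1 + 2 * R ^ 4 / ν ^ 3 * T * E)).mul_const (2 / ν)).add
        (((hB1 f₀).const_mul 2).add ((hB1 f₀).const_mul 2))
    · have hc := continuousOn_coeff_sub (hu n).memX0 hu₀.memX0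
      -- In V_1 the ball bounds the high modes without making them small; their smallness is
      -- obtained for each solution separately, after integration in time.
      have hQ : ∀ s, sobSq 1 (u n s - u₀ s) ≤
          ENNReal.ofReal (∑ k ∈ box N, sobTerm 1 (u n s - u₀ s) k) +
          (2 * sobSq 1 (u n s - trunc (box N) (u n s)) +
            2 * sobSq 1 (u₀ s - trunc (box N) (u₀ s))) := by
        intro s
        rw [sobSq_eq_trunc_add (neg_mem_box (N := N)), sobSq_trunc neg_mem_box]
        gcongr
        rw [trunc_sub neg_mem_box, sub_sub_sub_comm]
        exact sobSq_sub_le _ _ _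
      refine (lintegral_mono hQ).trans ?_
      have hm1 : AEMeasurable (fun s => ENNReal.ofReal
          (∑ k ∈ box N, sobTerm 1 (u n s - u₀ s) k)) (volume.restrict (Icc 0 T)) :=
        ENNReal.measurable_ofReal.comp_aemeasurable
          (((continuousOn_sum_sobTerm 1 hc).mono fun x hx => hx.1).aemeasurable measurableSet_Icc)
      have hm2 : ∀ v : ℝ → L2Field L, MemX0 v → AEMeasurable
          (fun s => 2 * sobSq 1 (v s - trunc (box N) (v s))) (volume.restrict (Icc 0 T)) := by
        intro v hv
        refine (aemeasurable_sobSq 1 (fun k j => ?_) T).const_mul 2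
        simp only [coeff_sub, coeff_trunc neg_mem_box]
        split_ifs
        · simpa using continuousOn_const
        · simpa using continuousOn_coeff hv k j
      rw [lintegral_add_left' hm1, lintegral_add_left' (hm2 _ (hu n).memX0),
        lintegral_const_mul' _ _ (by simp), lintegral_const_mul' _ _ (by simp),
        ← ofReal_integral_sum_sobTerm _ 1 hc hT,
        ENNReal.ofReal_add (mul_nonneg (mul_nonneg (hD0 N n) (by positivity)) (by positivity))
          (by have := hB0 N (f n); have := hB0 N f₀; positivity),
        ENNReal.ofReal_add (by have := hB0 N (f n); positivity) (by have := hB0 N f₀; positivity),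
        ENNReal.ofReal_mul zero_le_two, ENNReal.ofReal_mul zero_le_two, ENNReal.ofReal_ofNat]
      gcongr
      · have := (key N n).2
        calc _ = ν / 2 * (∫ s in (0 : ℝ)..T, ∑ k ∈ box N, sobTerm 1 (u n s - u₀ s) k) *
              (2 / ν) := by field_simp
          _ ≤ _ := by gcongr
      · exact tail_ball hν (hε n) hR (hu n) (hb n) hT N
      · exact tail_ball hν hε₀ hR hu₀ hb₀ hT N

end BallConvergence

/-! ### Estimates for positive `ε` -/

section ViscousEstimates

variable {L : ℝ} [hL : Fact (0 < L)] {ν l ε ε' : ℝ} {f f' : L2Field L}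

/-- The constant in `‖u‖_{5/4}² ≤ C ‖u‖_l²`. -/
def poincareConst (L l : ℝ) : ℝ := (freq L 0 ^ 2) ^ (5 / 4 - l)

lemma poincareConst_pos : 0 < poincareConst L l :=
  Real.rpow_pos_of_pos (pow_pos (freq_pos 0) 2) _

lemma sobSq_five_fourths_le (hl : 5 / 4 ≤ l) {u : L2Field L} (hu : u ∈ V₀ L) {Y : ℝ} (hY : 0 ≤ Y)
    (h : sobSq l u ≤ ENNReal.ofReal Y) :
    sobSq (5 / 4) u ≤ ENNReal.ofReal (Real.sqrt (poincareConst L l * Y) ^ 2) := by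
  have hκ := poincareConst_pos (L := L) (l := l)
  rw [Real.sq_sqrt (by positivity), ENNReal.ofReal_mul hκ.le]
  exact (sobSq_poincare hl hu).trans (mul_le_mul_right h _)

/-- Here `E` is ‖P_N w‖_l², `Y` and `Y'` bound ‖u‖_l² and ‖u'‖_l², `x` is ‖P_N w‖ and `q` is ‖w -
P_N w‖. One share ε E absorbs the mismatch of the viscosities, the other b(P_N w, u', P_N w). The
terms with `q` are not absorbed: E ≤ 2Y + 2Y' makes them an integrable function times `q`. -/
lemma young_viscous {ε δ κ F Y Y' E x q : ℝ} (hε : 0 < ε) (hκ : 0 < κ) (hY : 0 ≤ Y)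
    (hY' : 0 ≤ Y') (hE : 0 ≤ E) (hq : 0 ≤ q) (hEY : E ≤ 2 * Y + 2 * Y') :
    2 * F * x + 2 * (δ * (Real.sqrt Y' * Real.sqrt E)) +
        2 * (Real.sqrt (κ * Y') * Real.sqrt (κ * E) * x) +
        2 * (Real.sqrt (κ * Y') * Real.sqrt (κ * E) * q) +
        2 * (Real.sqrt (κ * Y) * Real.sqrt (κ * E) * q) ≤
      2 * ε * E + (1 + κ ^ 2 / ε * Y') * x ^ 2 +
        (F ^ 2 + (δ ^ 2 / ε * Y' + 4 * κ * (Y + Y') * q)) := by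
  have sY' := Real.sq_sqrt hY'
  have sE := Real.sq_sqrt hE
  have kY := Real.sq_sqrt (mul_nonneg hκ.le hY)
  have kY' := Real.sq_sqrt (mul_nonneg hκ.le hY')
  have kE := Real.sq_sqrt (mul_nonneg hκ.le hE)
  set a := Real.sqrt (κ * Y)
  set a' := Real.sqrt (κ * Y')
  set z := Real.sqrt (κ * E)
  set y := Real.sqrt Y'
  set e := Real.sqrt E
  have h1 : 2 * F * x ≤ F ^ 2 + x ^ 2 := two_mul_le_add_sq F x
  have h2 : 2 * (δ * (y * e)) ≤ ε * E + δ ^ 2 / ε * Y' := by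
    have : ε * E + δ ^ 2 / ε * Y' - 2 * (δ * (y * e)) = (ε * e - δ * y) ^ 2 / ε := by
      rw [← sE, ← sY']; field_simp; ring
    have h : 0 ≤ (ε * e - δ * y) ^ 2 / ε := by positivity
    linarith
  have h3 : 2 * (a' * z * x) ≤ ε * E + κ ^ 2 / ε * Y' * x ^ 2 := by
    have e1 : E = z ^ 2 / κ := by rw [kE]; field_simp
    have e2 : Y' = a' ^ 2 / κ := by rw [kY']; field_simp
    have : ε * E + κ ^ 2 / ε * Y' * x ^ 2 - 2 * (a' * z * x) =
        (ε * z - κ * a' * x) ^ 2 / (ε * κ) := by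
      rw [e1, e2]; field_simp; ring
    have h : 0 ≤ (ε * z - κ * a' * x) ^ 2 / (ε * κ) := by positivity
    linarith
  have h4 : 2 * (a' * z) + 2 * (a * z) ≤ 4 * κ * (Y + Y') := by
    have : κ * E ≤ κ * (2 * Y + 2 * Y') := mul_le_mul_of_nonneg_left hEY hκ.le
    nlinarith [sq_nonneg (a + a' - z), sq_nonneg (a - a')]
  have h5 := mul_le_mul_of_nonneg_right h4 hq
  nlinarith

/-- For l ≥ 5/4 the norm of V_l dominates that of V_{5/4}, so every trilinear term is at most two
V_l norms times an L² norm. The coefficient of ‖P_N w‖² involves `u'` alone. -/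
lemma rate_bound_viscous (hl : 5 / 4 ≤ l) (hε : 0 < ε) (N : ℕ) {u u' : L2Field L}
    (hu : u ∈ V₀ L) (hu' : u' ∈ V₀ L) {Y Y' : ℝ} (hY : 0 ≤ Y) (hY' : 0 ≤ Y')
    (hb : sobSq l u ≤ ENNReal.ofReal Y) (hb' : sobSq l u' ≤ ENNReal.ofReal Y') :
    2 * (rate ν l ε (box N) f u (u - u') - rate ν l ε' (box N) f' u' (u - u')) +
        2 * ν * ∑ k ∈ box N, sobTerm 1 (u - u') k ≤
      (1 + poincareConst L l ^ 2 / ε * Y') * (∑ k ∈ box N, sobTerm 0 (u - u') k) +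
      (‖f - f'‖ ^ 2 + ((ε' - ε) ^ 2 / ε * Y' +
        4 * poincareConst L l * (Y + Y') * ‖(u - u') - trunc (box N) (u - u')‖)) := by
  have hκ := poincareConst_pos (L := L) (l := l)
  have hw := sub_mem_V₀ hu hu'
  set w := u - u' with hwdef
  set κ := poincareConst L l
  set E := ∑ k ∈ box N, sobTerm l w k with hE
  have hE0 : 0 ≤ E := sum_sobTerm_nonneg _ _ _
  have hz : trunc (box N) w ∈ V₀ L := trunc_mem neg_mem_box hw
  have hEz : sobSq l (trunc (box N) w) = ENNReal.ofReal E := sobSq_trunc neg_mem_box l w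
  have hEY : E ≤ 2 * Y + 2 * Y' := by
    refine sum_sobTerm_le_of_sobSq_le _ (by positivity) ((sobSq_sub_le l u u').trans ?_)
    rw [ENNReal.ofReal_add (by positivity) (by positivity), ENNReal.ofReal_mul zero_le_two,
      ENNReal.ofReal_mul zero_le_two, ENNReal.ofReal_ofNat]
    gcongr
  set x := Real.sqrt (∑ k ∈ box N, sobTerm 0 w k) with hx
  have hx2 : x ^ 2 = ∑ k ∈ box N, sobTerm 0 w k := Real.sq_sqrt (sum_sobTerm_nonneg _ _ _)
  have b := sobSq_five_fourths_le hl hu hY hb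
  have b' := sobSq_five_fourths_le hl hu' hY' hb'
  have bz := sobSq_five_fourths_le hl hz hE0 hEz.le
  have t1 := abs_le_of_enorm_sq_le (Real.sqrt_nonneg _) (Real.sqrt_nonneg _) (Real.sqrt_nonneg _)
    (enorm_tri_sq_le_of_left (u := trunc (box N) w) (S := box N) neg_mem_box hw hu') b' bz
    (show _ ≤ ENNReal.ofReal (x ^ 2) by rw [sobSq_trunc neg_mem_box, hx2])
  have t2 := abs_le_of_enorm_sq_le (Real.sqrt_nonneg _) (Real.sqrt_nonneg _) (norm_nonneg _)
    (enorm_tri_sq_le_of_left (u := w - trunc (box N) w) (S := box N) neg_mem_box hw hu') b' bz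
    (sobSq_zero_exponent _).le
  have t3 := abs_le_of_enorm_sq_le (Real.sqrt_nonneg _) (Real.sqrt_nonneg _) (norm_nonneg _)
    (enorm_tri_sq_le_of_mid (v := w - trunc (box N) w) (S := box N) neg_mem_box hu hw) b bz
    (sobSq_zero_exponent _).le
  have hsplit : tri (box N) w u' w =
      tri (box N) (trunc (box N) w) u' w + tri (box N) (w - trunc (box N) w) u' w := by
    rw [tri_sub_left hw hz]; ring
  have p0 : partForm (box N) 0 (f - f') w ≤ ‖f - f'‖ * x :=
    (le_abs_self _).trans (abs_partForm_zero_le _ _ _)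
  have p1 : (ε' - ε) * partForm (box N) l u' w ≤
      |ε' - ε| * (Real.sqrt Y' * Real.sqrt E) := by
    refine (le_abs_self _).trans ?_
    rw [abs_mul]
    refine mul_le_mul_of_nonneg_left ((abs_partForm_le l u' w).trans ?_) (abs_nonneg _)
    gcongr
    exact sum_sobTerm_le_of_sobSq_le _ hY' hb'
  have y := young_viscous (δ := |ε' - ε|) (F := ‖f - f'‖) (x := x) hε hκ hY hY' hE0
    (norm_nonneg (w - trunc (box N) w)) hEY
  rw [sq_abs] at y
  rw [rate_sub_rate neg_mem_box ν l ε ε' f f' hu hu', ← hwdef, hsplit, ← hx2]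
  have n1 := neg_abs_le (tri (box N) (trunc (box N) w) u' w)
  have n2 := neg_abs_le (tri (box N) (w - trunc (box N) w) u' w)
  have n3 := neg_abs_le (tri (box N) u (w - trunc (box N) w) w)
  linarith

lemma aemeasurable_norm {u : ℝ → L2Field L}
    (hu : ∀ k j, ContinuousOn (fun t => coeff (u t) k j) (Ici 0)) (t : ℝ) :
    AEMeasurable (fun s => ‖u s‖) (volume.restrict (Icc 0 t)) := by
  have h := (aemeasurable_sobSq 0 hu t).ennreal_toReal.sqrt
  refine h.congr (Eventually.of_forall fun s => ?_)
  simp only [sobSq_zero_exponent]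
  rw [ENNReal.toReal_ofReal (by positivity), Real.sqrt_sq (norm_nonneg _)]

lemma continuousOn_coeff_sub_trunc (N : ℕ) {u : ℝ → L2Field L}
    (hu : ∀ k j, ContinuousOn (fun t => coeff (u t) k j) (Ici 0)) (k : Fin 3 → ℤ) (j : Fin 3) :
    ContinuousOn (fun t => coeff (u t - trunc (box N) (u t)) k j) (Ici 0) := by
  simp only [coeff_sub, coeff_trunc neg_mem_box]
  split_ifs
  · simpa using continuousOn_const
  · simpa using hu k j

lemma tendsto_norm_sub_trunc (u : L2Field L) :
    Tendsto (fun N => ‖u - trunc (box N) u‖) atTop (𝓝 0) := by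
  have h : Tendsto (fun N => ‖u - trunc (box N) u‖ ^ 2) atTop (𝓝 0) := by
    have := (tendsto_norm_trunc_sq u).const_sub (‖u‖ ^ 2)
    rw [sub_self] at this
    refine this.congr fun N => ?_
    rw [norm_sq_eq_trunc_add (neg_mem_box (N := N)) u]
    ring
  have h2 := h.sqrt
  simpa [Real.sqrt_sq (norm_nonneg _)] using h2

lemma norm_sub_trunc_le (N : ℕ) (u : L2Field L) : ‖u - trunc (box N) u‖ ≤ ‖u‖ := by
  have := norm_sq_eq_trunc_add (neg_mem_box (N := N)) u
  exact abs_le_of_sq_le_sq' (by nlinarith [sq_nonneg ‖trunc (box N) u‖]) (norm_nonneg u) |>.2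

lemma integrableOn_sobSq {u : ℝ → L2Field L} (hu : MemX0 u) {s T : ℝ}
    (h : ∫⁻ r in Icc 0 T, sobSq s (u r) < ∞) :
    IntegrableOn (fun r => (sobSq s (u r)).toReal) (Icc 0 T) :=
  integrable_toReal_of_lintegral_ne_top (aemeasurable_sobSq s (continuousOn_coeff hu) T) h.ne

/-- Dominated convergence, without a rate: in contrast to the ball, N → ∞ has to be taken for a
fixed pair of solutions. -/
lemma integral_high_modes {u : ℝ → L2Field L}
    (hu : ∀ k j, ContinuousOn (fun t => coeff (u t) k j) (Ici 0)) {C : ℝ}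
    (hC : ∀ t, 0 ≤ t → ‖u t‖ ≤ C) {y : ℝ → ℝ} {T : ℝ} (hy : IntegrableOn y (Icc 0 T)) :
    (∀ N, IntegrableOn (fun s => y s * ‖u s - trunc (box N) (u s)‖) (Icc 0 T)) ∧
    Tendsto (fun N => ∫ s in Icc 0 T, y s * ‖u s - trunc (box N) (u s)‖) atTop (𝓝 0) := by
  have hm : ∀ N, AEStronglyMeasurable (fun s => y s * ‖u s - trunc (box N) (u s)‖)
      (volume.restrict (Icc 0 T)) := fun N => hy.aestronglyMeasurable.mul
    (aemeasurable_norm (continuousOn_coeff_sub_trunc N hu) T).aestronglyMeasurable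
  have hbd : ∀ N, ∀ᵐ s ∂volume.restrict (Icc 0 T),
      ‖y s * ‖u s - trunc (box N) (u s)‖‖ ≤ ‖y s‖ * C := by
    intro N
    filter_upwards [ae_restrict_mem measurableSet_Icc] with s hs
    rw [norm_mul, norm_norm]
    exact mul_le_mul_of_nonneg_left ((norm_sub_trunc_le N _).trans (hC s hs.1)) (norm_nonneg _)
  refine ⟨fun N => (hy.norm.mul_const C).mono' (hm N) (hbd N), ?_⟩
  have := tendsto_integral_of_dominated_convergence (μ := volume.restrict (Icc 0 T))
    (F := fun N s => y s * ‖u s - trunc (box N) (u s)‖) (f := fun _ => 0) (fun s => ‖y s‖ * C) hm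
    (hy.norm.mul_const C) hbd (Eventually.of_forall fun s => by
      simpa using (tendsto_norm_sub_trunc (u s)).const_mul (y s))
  simpa using this

end ViscousEstimates

/-! ### Continuous dependence for positive `ε` -/

section ViscousConvergence

variable {L : ℝ} [hL : Fact (0 < L)] {ν l ε ε' T : ℝ} {f f' : L2Field L} {u u' : ℝ → L2Field L}

lemma exists_norm_sub_le (hu : MemX0 u) (hu' : MemX0 u') :
    ∃ C : ℝ, ∀ t, 0 ≤ t → ‖u t - u' t‖ ≤ C := by
  obtain ⟨C, hC⟩ := hu.bounded
  obtain ⟨C', hC'⟩ := hu'.bounded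
  exact ⟨C + C', fun t ht => (norm_sub_le _ _).trans (add_le_add (hC t ht) (hC' t ht))⟩

lemma ae_sobSq_lt_top (hu : MemX0 u) {s : ℝ} (h : ∫⁻ r in Icc 0 T, sobSq s (u r) < ∞) :
    ∀ᵐ r ∂volume.restrict (Icc 0 T), sobSq s (u r) < ∞ :=
  ae_lt_top' (aemeasurable_sobSq s (continuousOn_coeff hu) T) h.ne

lemma lintegral_sobSq_le_of_forall_box (hc : ∀ k j, ContinuousOn (fun t => coeff (u t) k j) (Ici 0))
    (s : ℝ) (hT : 0 ≤ T) {B : ℕ → ℝ} {b : ℝ} (hB : Tendsto B atTop (𝓝 b))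
    (h : ∀ N, ∫ r in (0 : ℝ)..T, ∑ k ∈ box N, sobTerm s (u r) k ≤ B N) :
    ∫⁻ r in Icc 0 T, sobSq s (u r) ≤ ENNReal.ofReal b := by
  have hmeas : ∀ k, AEMeasurable (fun r => ENNReal.ofReal (sobTerm s (u r) k))
      (volume.restrict (Icc 0 T)) := by
    intro k
    have := continuousOn_sum_sobTerm (S := {k}) s hc
    simp only [Finset.sum_singleton] at this
    exact ENNReal.measurable_ofReal.comp_aemeasurable
      ((this.mono fun x hx => hx.1).aemeasurable measurableSet_Icc)
  simp only [sobSq_eq]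
  rw [lintegral_tsum hmeas]
  refine le_of_tendsto_of_tendsto' (ENNReal.summable.hasSum.comp tendsto_box)
    (ENNReal.tendsto_ofReal hB) fun N => ?_
  rw [Function.comp_apply, ← lintegral_finsetSum' _ fun k _ => hmeas k]
  refine le_trans (le_of_eq ?_) (ENNReal.ofReal_le_ofReal (h N))
  rw [ofReal_integral_sum_sobTerm _ s hc hT]
  simp only [ENNReal.ofReal_sum_of_nonneg fun k _ => sobTerm_nonneg s _ k]

/-- The regularity of both solutions serves to remove the cutoff, but the final bound contains only
the integral of ‖u'‖_l². With the limit solution as `u'` it is uniform along a sequence. -/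
theorem viscous_gronwall (hν : 0 < ν) (hl : 5 / 4 ≤ l) (hε : 0 < ε) (hε' : 0 < ε')
    (hu : IsWeakSolution ν l ε f u) (hu' : IsWeakSolution ν l ε' f' u') (hT : 0 ≤ T) {A D I : ℝ}
    (hI : I = ∫ s in Icc 0 T, (sobSq l (u' s)).toReal)
    (hA : A = T + poincareConst L l ^ 2 / ε * I)
    (hD : D = ‖u 0 - u' 0‖ ^ 2 + (T * ‖f - f'‖ ^ 2 + (ε' - ε) ^ 2 / ε * I)) :
    (∀ t ∈ Icc 0 T, ‖u t - u' t‖ ^ 2 ≤ D * Real.exp A) ∧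
    ∫⁻ s in Icc 0 T, sobSq 1 (u s - u' s) ≤
      ENNReal.ofReal (D * (1 + A * Real.exp A) / (2 * ν)) := by
  set κ := poincareConst L l
  set w : ℝ → L2Field L := fun s => u s - u' s with hw
  have hc := continuousOn_coeff_sub hu.memX0 hu'.memX0
  obtain ⟨C, hC⟩ := exists_norm_sub_le hu.memX0 hu'.memX0
  set Y : ℝ → ℝ := fun s => (sobSq l (u s)).toReal with hYd
  set Y' : ℝ → ℝ := fun s => (sobSq l (u' s)).toReal with hYd'
  have hY : IntegrableOn Y (Icc 0 T) := integrableOn_sobSq hu.memX0 (hu.regular hε T)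
  have hY' : IntegrableOn Y' (Icc 0 T) := integrableOn_sobSq hu'.memX0 (hu'.regular hε' T)
  have hy : IntegrableOn (fun s => 4 * κ * (Y s + Y' s)) (Icc 0 T) := (hY.add hY').const_mul _
  obtain ⟨hg, hglim⟩ := integral_high_modes hc hC hy
  have hY0 : ∀ s, 0 ≤ Y s := fun s => ENNReal.toReal_nonneg
  have hY0' : ∀ s, 0 ≤ Y' s := fun s => ENNReal.toReal_nonneg
  have hκ : 0 < κ := poincareConst_pos
  have conv : ∀ y : ℝ → ℝ, ∫ s in (0 : ℝ)..T, y s = ∫ s in Icc 0 T, y s := fun y => by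
    rw [intervalIntegral.integral_of_le hT, integral_Icc_eq_integral_Ioc]
  have hconst : ∀ c : ℝ, IntegrableOn (fun _ : ℝ => c) (Icc 0 T) := fun c =>
    integrableOn_const (by simp)
  have ha : IntegrableOn (fun s => 1 + κ ^ 2 / ε * Y' s) (Icc 0 T) :=
    (hconst 1).add (hY'.const_mul _)
  have hAeq : ∫ s in (0 : ℝ)..T, (1 + κ ^ 2 / ε * Y' s) = A := by
    rw [conv, integral_add (hconst 1) (hY'.const_mul _), integral_const_mul, ← hI, hA]
    simp [hT]
  set G : ℕ → ℝ := fun N => ∫ s in Icc 0 T, 4 * κ * (Y s + Y' s) * ‖w s - trunc (box N) (w s)‖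
    with hG
  have hb : ∀ N, IntegrableOn (fun s => ‖f - f'‖ ^ 2 + ((ε' - ε) ^ 2 / ε * Y' s +
      4 * κ * (Y s + Y' s) * ‖w s - trunc (box N) (w s)‖)) (Icc 0 T) := fun N =>
    (hconst _).add ((hY'.const_mul _).add (hg N))
  have hBeq : ∀ N, ∫ s in (0 : ℝ)..T, (‖f - f'‖ ^ 2 + ((ε' - ε) ^ 2 / ε * Y' s +
      4 * κ * (Y s + Y' s) * ‖w s - trunc (box N) (w s)‖)) =
      T * ‖f - f'‖ ^ 2 + ((ε' - ε) ^ 2 / ε * I + G N) := by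
    intro N
    have i2 : IntegrableOn (fun s => (ε' - ε) ^ 2 / ε * Y' s +
        4 * κ * (Y s + Y' s) * ‖w s - trunc (box N) (w s)‖) (Icc 0 T) :=
      (hY'.const_mul _).add (hg N)
    rw [conv, integral_add (hconst _) i2, integral_add (hY'.const_mul _) (hg N),
      integral_const_mul, ← hI]
    simp [hT, hG, hw]
  have ii : ∀ {y : ℝ → ℝ}, IntegrableOn y (Icc 0 T) → IntervalIntegrable y volume 0 T :=
    fun h => (intervalIntegrable_iff_integrableOn_Icc_of_le hT).mpr h
  have key : ∀ N, (∀ t ∈ Icc 0 T, ‖trunc (box N) (w t)‖ ^ 2 ≤ (D + G N) * Real.exp A) ∧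
      2 * ν * (∫ s in (0 : ℝ)..T, ∑ k ∈ box N, sobTerm 1 (w s) k) ≤
        (D + G N) * (1 + A * Real.exp A) := by
    intro N
    have hφ : ContinuousOn (fun t => ‖trunc (box N) (w t)‖ ^ 2) (Icc 0 T) := by
      simp only [norm_trunc_sq neg_mem_box]
      exact (continuousOn_sum_sobTerm 0 hc).mono fun x hx => hx.1
    have hX := intervalIntegrable_sum_sobTerm (box N) 1 hc hT
    have h := energy_gronwall hT hφ (fun s _ => by positivity) hX
      (fun s _ => sum_sobTerm_nonneg _ _ _) (κ := 2 * ν) (by positivity) (ii ha)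
      (fun s _ => by have := hY0' s; positivity) (ii (hb N))
      (fun s _ => by have := hY0 s; have := hY0' s; positivity)
      (energy_identity neg_mem_box hu hu' hT).1
      (fun t ht => (energy_identity neg_mem_box hu hu' ht.1).2)
      (by
        filter_upwards [ae_restrict_mem measurableSet_Icc,
          ae_sobSq_lt_top hu.memX0 (hu.regular hε T),
          ae_sobSq_lt_top hu'.memX0 (hu'.regular hε' T)] with s hs h1 h2
        simp only [norm_trunc_sq neg_mem_box]
        exact rate_bound_viscous hl hε N (hu.memX0.mem s hs.1) (hu'.memX0.mem s hs.1)
          (hY0 s) (hY0' s) (ENNReal.ofReal_toReal h1.ne).ge (ENNReal.ofReal_toReal h2.ne).ge)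
    rw [hAeq, hBeq] at h
    have hA0 : 0 ≤ A := by
      rw [← hAeq, conv]
      exact integral_nonneg fun s => by have := hY0' s; positivity
    have hle : ‖trunc (box N) (w 0)‖ ^ 2 +
        (T * ‖f - f'‖ ^ 2 + ((ε' - ε) ^ 2 / ε * I + G N)) ≤ D + G N := by
      have := pow_le_pow_left₀ (norm_nonneg _) (norm_trunc_le (neg_mem_box (N := N)) (w 0)) 2
      rw [hD]
      linarith
    exact ⟨fun t ht => (h.1 t ht).trans (by gcongr), h.2.trans (by gcongr)⟩
  have hGD : Tendsto (fun N => D + G N) atTop (𝓝 D) := by simpa using hglim.const_add D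
  constructor
  · exact fun t ht => le_of_tendsto_of_tendsto' (tendsto_norm_trunc_sq (w t))
      (hGD.mul_const _) fun N => (key N).1 t ht
  · refine lintegral_sobSq_le_of_forall_box hc 1 hT
      ((hGD.mul_const (1 + A * Real.exp A)).div_const (2 * ν)) fun N => ?_
    rw [le_div_iff₀ (by positivity)]
    linarith [(key N).2]

theorem tendstoX0_of_pos (hν : 0 < ν) (hl : 5 / 4 ≤ l) {ε : ℕ → ℝ} {ε₀ : ℝ}
    {f : ℕ → L2Field L} {f₀ : L2Field L} {u : ℕ → ℝ → L2Field L} {u₀ : ℝ → L2Field L}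
    (hε₀ : 0 < ε₀) (hu : ∀ n, IsWeakSolution ν l (ε n) (f n) (u n))
    (hu₀ : IsWeakSolution ν l ε₀ f₀ u₀)
    (hεt : Tendsto ε atTop (𝓝 ε₀)) (hft : Tendsto f atTop (𝓝 f₀))
    (h0 : Tendsto (fun n => u n 0) atTop (𝓝 (u₀ 0))) : TendstoX0 u u₀ := by
  refine tendstoX0_of_nonneg fun T hT => ?_
  set I := ∫ s in Icc 0 T, (sobSq l (u₀ s)).toReal with hI
  set A : ℕ → ℝ := fun n => T + poincareConst L l ^ 2 / ε n * I with hA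
  set D : ℕ → ℝ := fun n => ‖u n 0 - u₀ 0‖ ^ 2 +
    (T * ‖f n - f₀‖ ^ 2 + (ε₀ - ε n) ^ 2 / ε n * I) with hD
  have hev : ∀ᶠ n in atTop, 0 < ε n := hεt.eventually_const_lt hε₀
  have hAt : Tendsto A atTop (𝓝 (T + poincareConst L l ^ 2 / ε₀ * I)) :=
    ((tendsto_const_nhds.div hεt hε₀.ne').mul_const I).const_add T
  have hDt : Tendsto D atTop (𝓝 0) := by
    have t1 : Tendsto (fun n => ‖u n 0 - u₀ 0‖) atTop (𝓝 0) := by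
      simpa using (h0.sub_const (u₀ 0)).norm
    have t2 : Tendsto (fun n => ‖f n - f₀‖) atTop (𝓝 0) := by
      simpa using (hft.sub_const f₀).norm
    have t3 : Tendsto (fun n => ε₀ - ε n) atTop (𝓝 0) := by
      simpa using (tendsto_const_nhds (x := ε₀)).sub hεt
    simpa using (t1.pow 2).add (((t2.pow 2).const_mul T).add
      (((t3.pow 2).div hεt hε₀.ne').mul_const I))
  have hexp := hAt.rexp
  have g1 := hDt.mul hexp
  have g2 := (hDt.mul ((hAt.mul hexp).const_add 1)).div_const (2 * ν)
  rw [zero_mul] at g1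
  rw [zero_mul, zero_div] at g2
  constructor
  -- The cutoff index is a dummy here, since `viscous_gronwall` is already free of it.
  · refine tendstoUniformlyOn_of_norm_sq_le (G := fun _ => _) (fun _ => g1) tendsto_const_nhds
      fun _ => ?_
    filter_upwards [hev] with n hn
    exact (viscous_gronwall hν hl hn hε₀ (hu n) hu₀ hT hI rfl rfl).1
  · refine tendsto_zero_of_le_ofReal (G := fun _ => _) (fun _ => g2) tendsto_const_nhds
      fun _ => ?_
    filter_upwards [hev] with n hn
    exact (viscous_gronwall hν hl hn hε₀ (hu n) hu₀ hT hI rfl rfl).2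

end ViscousConvergence

/-! ### Strong continuity of weak solutions -/

section StrongContinuity

variable {L : ℝ} [hL : Fact (0 < L)] {ν l ε : ℝ} {f : L2Field L} {u : ℝ → L2Field L}

/-- The truncations are continuous and, by the V_1 bound, converge uniformly in time at the rate R /
`freq L N`. -/
lemma continuousOn_of_ball (hu : MemX0 u) {R : ℝ}
    (hb : ∀ t, 0 ≤ t → sobSq 1 (u t) ≤ ENNReal.ofReal (R ^ 2)) : ContinuousOn u (Ici 0) := by
  refine TendstoUniformlyOn.continuousOn (F := fun N t => trunc (box N) (u t)) (p := atTop)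
    (tendstoUniformlyOn_of_norm_sq_le (G := fun N n => (R / freq L n) ^ 2) (g := fun _ => 0)
      (fun _ => by simpa using (tendsto_div_freq (L := L) R).pow 2) tendsto_const_nhds
      fun _ => Eventually.of_forall fun n t ht => ?_)
    (Eventually.of_forall fun N => continuousOn_trunc neg_mem_box hu).frequently
  have h1 := (sobSq_high_le n zero_le_one (u t)).trans (mul_le_mul_right (hb t ht) _)
  have hf := freq_pos (L := L) n
  rw [sobSq_zero_exponent, ← ENNReal.ofReal_mul (by positivity), zero_sub,
    Real.rpow_neg_one, inv_mul_eq_div, ← div_pow] at h1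
  rw [norm_sub_rev]
  exact (ENNReal.ofReal_le_ofReal_iff (by positivity)).mp h1

lemma continuousOn_of_continuousOn_norm_sq (hu : MemX0 u)
    (h : ContinuousOn (fun t => ‖u t‖ ^ 2) (Ici 0)) : ContinuousOn u (Ici 0) := by
  intro t₀ ht₀
  have h1 := h t₀ ht₀
  have h2 := hu.weakly_continuous (u t₀) (hu.mem t₀ ht₀) t₀ ht₀
  have h3 : Tendsto (fun t => ‖u t - u t₀‖ ^ 2) (𝓝[Ici 0] t₀) (𝓝 0) := by
    have := ((h1.tendsto.sub (h2.tendsto.const_mul 2)).add_const (‖u t₀‖ ^ 2))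
    rw [real_inner_self_eq_norm_sq,
      show ‖u t₀‖ ^ 2 - 2 * ‖u t₀‖ ^ 2 + ‖u t₀‖ ^ 2 = 0 by ring] at this
    exact this.congr fun t => (norm_sub_sq_real _ _).symm
  have h4 := h3.sqrt
  simp only [Real.sqrt_sq (norm_nonneg _), Real.sqrt_zero] at h4
  exact tendsto_iff_norm_sub_tendsto_zero.mpr h4

lemma tendsto_sum_sobTerm {s : ℝ} {v : L2Field L} (h : sobSq s v < ∞) :
    Tendsto (fun N => ∑ k ∈ box N, sobTerm s v k) atTop (𝓝 (sobSq s v).toReal) := by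
  rw [sobSq_eq] at h ⊢
  have := ENNReal.hasSum_toReal h.ne
  rw [← ENNReal.tsum_toReal_eq fun k => ENNReal.ofReal_ne_top] at this
  simp only [ENNReal.toReal_ofReal (sobTerm_nonneg s v _)] at this
  exact this.comp tendsto_box

lemma sum_sobTerm_le_toReal (S : Finset (Fin 3 → ℤ)) {s : ℝ} {v : L2Field L} (h : sobSq s v < ∞) :
    ∑ k ∈ S, sobTerm s v k ≤ (sobSq s v).toReal :=
  sum_sobTerm_le_of_sobSq_le S ENNReal.toReal_nonneg (ENNReal.ofReal_toReal h.ne).ge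

/-- The cancellation b(v, P_N v, P_N v) = 0 leaves only the high modes in the middle argument, so
the energy flux through the cutoff vanishes as N → ∞. -/
lemma abs_tri_self_le (hl : 5 / 4 ≤ l) (N : ℕ) {v : L2Field L} (hv : v ∈ V₀ L)
    (h : sobSq l v < ∞) :
    |tri (box N) v v v| ≤
      poincareConst L l * (sobSq l v).toReal * ‖v - trunc (box N) v‖ := by
  have hκ := poincareConst_pos (L := L) (l := l)
  have hY : 0 ≤ (sobSq l v).toReal := ENNReal.toReal_nonneg
  have e : tri (box N) v v v = tri (box N) v (v - trunc (box N) v) v := by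
    rw [tri_sub_mid hv, tri_trunc_self neg_mem_box hv, sub_zero]
  rw [e]
  have b := sobSq_five_fourths_le hl hv hY (ENNReal.ofReal_toReal h.ne).ge
  have := abs_le_of_enorm_sq_le (Real.sqrt_nonneg _) (Real.sqrt_nonneg _) (norm_nonneg _)
    (enorm_tri_sq_le_of_mid (v := v - trunc (box N) v) (S := box N) neg_mem_box hv hv) b
    ((sobSq_trunc_le neg_mem_box _ _).trans b) (sobSq_zero_exponent _).le
  rwa [Real.mul_self_sqrt (by positivity)] at this

lemma rate_self_sub_rate_zero (S : Finset (Fin 3 → ℤ)) (v : L2Field L) :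
    rate ν l ε S f v v - rate ν l ε S 0 0 v =
      partForm S 0 f v - ε * (∑ k ∈ S, sobTerm l v k) - ν * (∑ k ∈ S, sobTerm 1 v k) -
        tri S v v v := by
  have h0 : rate ν l ε S 0 0 v = 0 := by
    simp [rate, partForm, tri, triTerm, coeff_zero]
  rw [h0, sub_zero, rate, partForm_self, partForm_self]

/-- The energy equality for positive `ε`. -/
lemma energy_equality (hν : 0 < ν) (hl : 5 / 4 ≤ l) (hε : 0 < ε) (hu : IsWeakSolution ν l ε f u)
    {T : ℝ} (hT : 0 ≤ T) :
    IntegrableOn (fun s => inner ℝ f (u s) - ε * (sobSq l (u s)).toReal -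
      ν * (sobSq 1 (u s)).toReal) (Icc 0 T) ∧
    ‖u T‖ ^ 2 = ‖u 0‖ ^ 2 + 2 * ∫ s in (0 : ℝ)..T, (inner ℝ f (u s) -
      ε * (sobSq l (u s)).toReal - ν * (sobSq 1 (u s)).toReal) := by
  have hκ := poincareConst_pos (L := L) (l := l)
  obtain ⟨C, hC⟩ := hu.memX0.bounded
  have hY : IntegrableOn (fun s => (sobSq l (u s)).toReal) (Icc 0 T) :=
    integrableOn_sobSq hu.memX0 (hu.regular hε T)
  have hX : IntegrableOn (fun s => (sobSq 1 (u s)).toReal) (Icc 0 T) :=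
    integrableOn_sobSq hu.memX0 (hu.memX0.locally_square_integrable T)
  have hid := fun N => energy_identity (neg_mem_box (N := N)) hu (isWeakSolution_zero ν l ε) hT
  simp only [sub_zero, rate_self_sub_rate_zero] at hid
  set r : ℕ → ℝ → ℝ := fun N s => partForm (box N) 0 f (u s) -
    ε * (∑ k ∈ box N, sobTerm l (u s) k) - ν * (∑ k ∈ box N, sobTerm 1 (u s) k) -
      tri (box N) (u s) (u s) (u s) with hr
  have hrm : ∀ N, IntegrableOn (r N) (Icc 0 T) := fun N =>
    (intervalIntegrable_iff_integrableOn_Icc_of_le hT).mp (hid N).1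
  have hfin : ∀ᵐ s ∂volume.restrict (Icc 0 T),
      s ∈ Icc 0 T ∧ sobSq l (u s) < ∞ ∧ sobSq 1 (u s) < ∞ := by
    filter_upwards [ae_restrict_mem measurableSet_Icc, ae_sobSq_lt_top hu.memX0 (hu.regular hε T),
      ae_sobSq_lt_top hu.memX0 (hu.memX0.locally_square_integrable T)] with s hs h1 h2
    exact ⟨hs, h1, h2⟩
  -- A majorant independent of N. Its last term bounds the nonlinear flux by ‖u‖_l² times the L²
  -- bound, which is integrable in time since u lies in L²(0, T; V_l).
  have hbi : IntegrableOn (fun s => ‖f‖ * C + ε * (sobSq l (u s)).toReal +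
      ν * (sobSq 1 (u s)).toReal + poincareConst L l * (sobSq l (u s)).toReal * C) (Icc 0 T) :=
    (((integrableOn_const (by simp)).add (hY.const_mul _)).add (hX.const_mul _)).add
      ((hY.const_mul _).mul_const _)
  have hbd : ∀ N, ∀ᵐ s ∂volume.restrict (Icc 0 T), ‖r N s‖ ≤ ‖f‖ * C +
      ε * (sobSq l (u s)).toReal + ν * (sobSq 1 (u s)).toReal +
        poincareConst L l * (sobSq l (u s)).toReal * C := by
    intro N
    filter_upwards [hfin] with s ⟨hs, h1, h2⟩
    have hCs := hC s hs.1
    have t1 : |partForm (box N) 0 f (u s)| ≤ ‖f‖ * C :=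
      (abs_partForm_zero_le _ _ _).trans (mul_le_mul_of_nonneg_left
        ((Real.sqrt_le_left (norm_nonneg _)|>.mpr (sum_sobTerm_zero_le _ _)).trans hCs)
        (norm_nonneg _))
    have t2 := mul_le_mul_of_nonneg_left (sum_sobTerm_le_toReal (box N) h1) hε.le
    have t3 := mul_le_mul_of_nonneg_left (sum_sobTerm_le_toReal (box N) h2) hν.le
    have t2' := mul_nonneg hε.le (sum_sobTerm_nonneg (box N) l (u s))
    have t3' := mul_nonneg hν.le (sum_sobTerm_nonneg (box N) 1 (u s))
    have t4 : |tri (box N) (u s) (u s) (u s)| ≤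
        poincareConst L l * (sobSq l (u s)).toReal * C :=
      (abs_tri_self_le hl N (hu.memX0.mem s hs.1) h1).trans
        (mul_le_mul_of_nonneg_left ((norm_sub_trunc_le N _).trans hCs)
          (mul_nonneg hκ.le ENNReal.toReal_nonneg))
    rw [abs_le] at t1 t4
    rw [Real.norm_eq_abs, abs_le, hr]
    constructor <;> dsimp only <;> linarith
  have hlim : ∀ᵐ s ∂volume.restrict (Icc 0 T), Tendsto (fun N => r N s) atTop
      (𝓝 (inner ℝ f (u s) - ε * (sobSq l (u s)).toReal - ν * (sobSq 1 (u s)).toReal)) := by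
    filter_upwards [hfin] with s ⟨hs, h1, h2⟩
    have t1 : Tendsto (fun N => partForm (box N) 0 f (u s)) atTop (𝓝 (inner ℝ f (u s))) := by
      refine ((hasSum_inner f (u s)).comp tendsto_box).congr fun N => ?_
      simp [partForm]
    have t4 : Tendsto (fun N => tri (box N) (u s) (u s) (u s)) atTop (𝓝 0) := by
      refine squeeze_zero_norm (fun N => abs_tri_self_le hl N (hu.memX0.mem s hs.1) h1) ?_
      simpa using (tendsto_norm_sub_trunc (u s)).const_mul
        (poincareConst L l * (sobSq l (u s)).toReal)
    simpa using ((t1.sub ((tendsto_sum_sobTerm h1).const_mul ε)).sub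
      ((tendsto_sum_sobTerm h2).const_mul ν)).sub t4
  have hint : IntegrableOn (fun s => inner ℝ f (u s) - ε * (sobSq l (u s)).toReal -
      ν * (sobSq 1 (u s)).toReal) (Icc 0 T) := by
    refine hbi.mono' (aestronglyMeasurable_of_tendsto_ae atTop
      (fun N => (hrm N).aestronglyMeasurable) hlim) ?_
    filter_upwards [hlim, ae_all_iff.mpr hbd] with s h1 h2
    exact le_of_tendsto' h1.norm h2
  refine ⟨hint, ?_⟩
  have hI := tendsto_integral_of_dominated_convergence _
    (fun N => (hrm N).aestronglyMeasurable) hbi hbd hlim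
  rw [integral_Icc_eq_integral_Ioc, ← intervalIntegral.integral_of_le hT] at hI
  have h1 := (tendsto_norm_trunc_sq (u 0)).add (hI.const_mul 2)
  refine tendsto_nhds_unique (tendsto_norm_trunc_sq (u T)) (h1.congr fun N => ?_)
  rw [integral_Icc_eq_integral_Ioc, ← intervalIntegral.integral_of_le hT, ← (hid N).2]
  ring

/-- The energy equality exhibits ‖u‖² as a primitive of an integrable function, hence continuous;
weak continuity does the rest. -/
lemma continuousOn_of_pos (hν : 0 < ν) (hl : 5 / 4 ≤ l) (hε : 0 < ε)
    (hu : IsWeakSolution ν l ε f u) : ContinuousOn u (Ici 0) := by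
  refine continuousOn_of_continuousOn_norm_sq hu.memX0 fun t₀ ht₀ => ?_
  have ht₀' : (0 : ℝ) ≤ t₀ := ht₀
  have hT : 0 ≤ t₀ + 1 := by linarith
  have hc : ContinuousOn (fun t => ‖u t‖ ^ 2) (Icc 0 (t₀ + 1)) := by
    have h := intervalIntegral.continuousOn_primitive_interval
      (by rw [uIcc_of_le hT]; exact (energy_equality hν hl hε hu hT).1)
    rw [uIcc_of_le hT] at h
    exact ((h.const_mul 2).const_add (‖u 0‖ ^ 2)).congr fun t ht =>
      (energy_equality hν hl hε hu ht.1).2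
  refine (hc t₀ ⟨ht₀, by linarith⟩).mono_of_mem_nhdsWithin ?_
  rw [← Ici_inter_Iic]
  exact inter_mem self_mem_nhdsWithin (mem_nhdsWithin_of_mem_nhds (Iic_mem_nhds (by linarith)))

end StrongContinuity

/-! ### The semiflow -/

section Semiflow

variable {L : ℝ} [hL : Fact (0 < L)] {ν l ε : ℝ} {R : ℝ≥0∞} {f : L2Field L} {u u' : ℝ → L2Field L}

lemma lintegral_shift_lt_top {g : ℝ → ℝ≥0∞} {τ : ℝ} (hτ : 0 ≤ τ)
    (h : ∀ T : ℝ, ∫⁻ s in Icc 0 T, g s < ∞) (T : ℝ) : ∫⁻ s in Icc 0 T, g (τ + s) < ∞ := by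
  have e := (measurePreserving_add_left volume τ).setLIntegral_comp_preimage_emb
    (measurableEmbedding_addLeft τ) g (Icc τ (τ + T))
  rw [preimage_const_add_Icc, sub_self, add_sub_cancel_left] at e
  rw [e]
  exact (lintegral_mono_set (Icc_subset_Icc_left hτ)).trans_lt (h (τ + T))

lemma MemX0.shift (hu : MemX0 u) {τ : ℝ} (hτ : 0 ≤ τ) : MemX0 fun t => u (τ + t) where
  mem _ ht := hu.mem _ (add_nonneg hτ ht)
  bounded := hu.bounded.imp fun _ hC _ ht => hC _ (add_nonneg hτ ht)
  weakly_continuous v hv := (hu.weakly_continuous v hv).comp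
    (continuous_const.add continuous_id).continuousOn fun _ ht => add_nonneg hτ ht
  locally_square_integrable := lintegral_shift_lt_top hτ hu.locally_square_integrable

lemma IsWeakSolution.shift (hu : IsWeakSolution ν l ε f u) {τ : ℝ} (hτ : 0 ≤ τ) :
    IsWeakSolution ν l ε f fun t => u (τ + t) where
  memX0 := hu.memX0.shift hτ
  regular hε := lintegral_shift_lt_top hτ (hu.regular hε)
  equation v hv hv' t₀ t h0 h := by
    have := hu.equation v hv hv' (τ + t₀) (τ + t) (add_nonneg hτ h0) (by linarith)
    simpa only [← intervalIntegral.integral_comp_add_left] using this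
  energy := by
    have h := (ae_restrict_iff' measurableSet_Ioi).mp hu.energy
    refine (ae_restrict_iff' measurableSet_Ioi).mpr ?_
    filter_upwards [(measurePreserving_add_left volume τ).quasiMeasurePreserving.ae h]
      with t₀ ht₀ hpos t ht
    have := ht₀ (add_pos_of_nonneg_of_pos hτ hpos) (τ + t) (by linarith)
    simpa only [← intervalIntegral.integral_comp_add_left] using this

lemma InBall.shift (hu : InBall R u) {τ : ℝ} (hτ : 0 ≤ τ) : InBall R fun t => u (τ + t) :=
  fun _ ht => hu _ (add_nonneg hτ ht)

lemma InBall.sobSq_le (hu : InBall R u) (hR : R ≠ ∞) {t : ℝ} (ht : 0 ≤ t) :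
    sobSq 1 (u t) ≤ ENNReal.ofReal (R.toReal ^ 2) := by
  rw [ENNReal.ofReal_pow ENNReal.toReal_nonneg, ENNReal.ofReal_toReal hR]
  exact hu t ht

theorem tendstoX0_of_weakSolution {ε : ℕ → ℝ} {ε₀ : ℝ} {f : ℕ → L2Field L} {f₀ : L2Field L}
    {u : ℕ → ℝ → L2Field L} {u₀ : ℝ → L2Field L} (hν : 0 < ν) (hl : 5 / 4 ≤ l)
    (hε : ∀ n, 0 ≤ ε n) (hε₀ : 0 ≤ ε₀) (hR : R ≠ ∞ ∨ 0 < ε₀)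
    (hu : ∀ n, IsWeakSolution ν l (ε n) (f n) (u n)) (hb : ∀ n, InBall R (u n))
    (hu₀ : IsWeakSolution ν l ε₀ f₀ u₀) (hb₀ : InBall R u₀)
    (hεt : Tendsto ε atTop (𝓝 ε₀)) (hft : Tendsto f atTop (𝓝 f₀))
    (h0 : Tendsto (fun n => u n 0) atTop (𝓝 (u₀ 0))) : TendstoX0 u u₀ := by
  rcases hR with hR | hpos
  · exact tendstoX0_of_ball hν ENNReal.toReal_nonneg hε hε₀ hu
      (fun n t ht => (hb n).sobSq_le hR ht) hu₀ (fun t ht => hb₀.sobSq_le hR ht) hεt hft h0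
  · exact tendstoX0_of_pos hν hl hpos hu hu₀ hεt hft h0

lemma IsWeakSolution.continuousOn (hν : 0 < ν) (hl : 5 / 4 ≤ l) (hR : R ≠ ∞ ∨ 0 < ε)
    (hu : IsWeakSolution ν l ε f u) (hb : InBall R u) : ContinuousOn u (Ici 0) := by
  rcases hR with hR | hpos
  · exact continuousOn_of_ball hu.memX0 fun t ht => hb.sobSq_le hR ht
  · exact continuousOn_of_pos hν hl hpos hu

/-- Uniqueness is continuous dependence for the constant sequence `u` with limit `u'`. -/
lemma IsWeakSolution.eq_of_eq_zero (hν : 0 < ν) (hl : 5 / 4 ≤ l) (hε : 0 ≤ ε)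
    (hR : R ≠ ∞ ∨ 0 < ε) (hu : IsWeakSolution ν l ε f u) (hb : InBall R u)
    (hu' : IsWeakSolution ν l ε f u') (hb' : InBall R u') (h0 : u 0 = u' 0) {t : ℝ} (ht : 0 ≤ t) :
    u t = u' t := by
  have h := (tendstoX0_of_weakSolution (u := fun _ => u) hν hl (fun _ => hε) hε hR (fun _ => hu)
    (fun _ => hb) hu' hb' tendsto_const_nhds tendsto_const_nhds
    (by rw [← h0]; exact tendsto_const_nhds) t).1.tendsto_at ⟨ht, le_rfl⟩
  exact tendsto_nhds_unique tendsto_const_nhds h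

/-- The weak solution through a point of the phase space. -/
def solution (p : phaseSpace L ν l ε R) : ℝ → L2Field L := p.2.choose

lemma solution_spec (p : phaseSpace L ν l ε R) :
    IsWeakSolution ν l ε p.1.1 (solution p) ∧ InBall R (solution p) ∧ solution p 0 = p.1.2 :=
  p.2.choose_spec

/-- The solution operator `(f, φ) ↦ (f, S(f, t) φ)`. -/
def flow (p : phaseSpace L ν l ε R) (t : ℝ≥0) : phaseSpace L ν l ε R :=
  ⟨(p.1.1, solution p t), fun s => solution p (t + s), (solution_spec p).1.shift t.2,
    (solution_spec p).2.1.shift t.2, by simp⟩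

lemma flow_eq (hν : 0 < ν) (hl : 5 / 4 ≤ l) (hε : 0 ≤ ε) (hR : R ≠ ∞ ∨ 0 < ε)
    (hu : IsWeakSolution ν l ε f u) (hb : InBall R u) {p : phaseSpace L ν l ε R}
    (hp : (p : L2Field L × L2Field L) = (f, u 0)) (t : ℝ≥0) :
    (flow p t : L2Field L × L2Field L) = (f, u t) := by
  obtain ⟨h1, h2, h3⟩ := solution_spec p
  have e1 : p.1.1 = f := by rw [hp]
  have e2 : p.1.2 = u 0 := by rw [hp]
  rw [e1] at h1
  rw [e2] at h3
  exact Prod.ext e1 (h1.eq_of_eq_zero hν hl hε hR h2 hu hb h3 t.2)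

/-- Uniform convergence on a compact time interval and continuity in time of the limit solution
allow data and time to vary together. The interval reaches one unit beyond the limit time, so it
eventually contains the times of the sequence. -/
lemma continuous_flow (hν : 0 < ν) (hl : 5 / 4 ≤ l) (hε : 0 ≤ ε) (hR : R ≠ ∞ ∨ 0 < ε) :
    Continuous fun q : phaseSpace L ν l ε R × ℝ≥0 => flow q.1 q.2 := by
  rw [continuous_iff_seqContinuous]
  intro x q hx
  have hp : Tendsto (fun n => ((x n).1 : L2Field L × L2Field L)) atTop (𝓝 q.1) :=
    (continuous_subtype_val.comp continuous_fst).tendsto q |>.comp hx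
  have ht : Tendsto (fun n => ((x n).2 : ℝ)) atTop (𝓝 (q.2 : ℝ)) :=
    (NNReal.continuous_coe.comp continuous_snd).tendsto q |>.comp hx
  have hf : Tendsto (fun n => (x n).1.1.1) atTop (𝓝 q.1.1.1) := (continuous_fst.tendsto _).comp hp
  have hφ : Tendsto (fun n => (x n).1.1.2) atTop (𝓝 q.1.1.2) := (continuous_snd.tendsto _).comp hp
  obtain ⟨s1, s2, s3⟩ := solution_spec q.1
  have hX := (tendstoX0_of_weakSolution (u := fun n => solution (x n).1) hν hl (fun _ => hε) hε hR
    (fun n => (solution_spec (x n).1).1) (fun n => (solution_spec (x n).1).2.1) s1 s2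
    tendsto_const_nhds hf (by simpa only [(solution_spec _).2.2] using hφ) (q.2 + 1)).1
  refine tendsto_subtype_rng.mpr (hf.prodMk_nhds (hX.tendsto_comp
    (((s1.continuousOn hν hl hR s2).mono fun s hs => hs.1) q.2 ⟨q.2.2, by linarith⟩) ?_))
  refine tendsto_nhdsWithin_iff.mpr ⟨ht, ?_⟩
  filter_upwards [ht.eventually_lt_const (show (q.2 : ℝ) < q.2 + 1 by linarith)] with n hn
  exact ⟨(x n).2.2, hn.le⟩

lemma isSemiflow_flow (hν : 0 < ν) (hl : 5 / 4 ≤ l) (hε : 0 ≤ ε) (hR : R ≠ ∞ ∨ 0 < ε) :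
    IsSemiflow (flow : phaseSpace L ν l ε R → ℝ≥0 → phaseSpace L ν l ε R) where
  zero p := Subtype.ext (Prod.ext rfl (by simpa [flow] using (solution_spec p).2.2))
  -- The translate of a solution by `s` is a solution issuing from `flow p s`; by uniqueness it is
  -- the one that the flow follows.
  add p s t := by
    obtain ⟨h1, h2, -⟩ := solution_spec p
    refine Subtype.ext ?_
    rw [flow_eq hν hl hε hR (h1.shift s.2) (h2.shift s.2) (p := flow p s) (by simp [flow])]
    simp [flow]
  continuousOn := (continuous_flow hν hl hε hR).continuousOn

end Semiflow

end PeriodicNS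

end

/-! ### The semiflow, the continuous family and the Gronwall bound -/

open PeriodicNS in
theorem mainTheorem3 :
    -- the maps `π^ε` are semiflows, continuous up to `t = 0`
    (∀ (L : ℝ) [Fact (0 < L)] (ν l ε : ℝ) (R : ℝ≥0∞), 0 < ν → 5 / 4 ≤ l → 0 ≤ ε →
      (R ≠ ∞ ∨ 0 < ε) →
      ∃ σ : phaseSpace L ν l ε R → ℝ≥0 → phaseSpace L ν l ε R,
        IsSemiflow σ ∧
        Continuous (fun p : phaseSpace L ν l ε R × ℝ≥0 => σ p.1 p.2) ∧
        ∀ (f : L2Field L) (u : ℝ → L2Field L), IsWeakSolution ν l ε f u → InBall R u →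
          ∀ p : phaseSpace L ν l ε R, (p : L2Field L × L2Field L) = (f, u 0) →
            ∀ t : ℝ≥0, (σ p t : L2Field L × L2Field L) = (f, u t)) ∧
    -- continuity in `ε`, in the initial datum and in the force
    (∀ (L : ℝ) [Fact (0 < L)] (ν l : ℝ) (R : ℝ≥0∞) (ε : ℕ → ℝ) (ε₀ : ℝ)
      (f : ℕ → L2Field L) (f₀ : L2Field L) (u : ℕ → ℝ → L2Field L) (u₀ : ℝ → L2Field L),
      0 < ν → 5 / 4 ≤ l → (∀ n, 0 ≤ ε n) → 0 ≤ ε₀ → (R ≠ ∞ ∨ 0 < ε₀) →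
      (∀ n, IsWeakSolution ν l (ε n) (f n) (u n)) → (∀ n, InBall R (u n)) →
      IsWeakSolution ν l ε₀ f₀ u₀ → InBall R u₀ →
      Tendsto ε atTop (𝓝 ε₀) → Tendsto f atTop (𝓝 f₀) →
      Tendsto (fun n => u n 0) atTop (𝓝 (u₀ 0)) →
      TendstoX0 u u₀) ∧
    -- the Gronwall bound on `[0, T]`, with an absolute constant `c`
    (∃ c : ℝ, 0 < c ∧ ∀ (L : ℝ) [Fact (0 < L)] (ν l ε ε' R T : ℝ) (f f' : L2Field L)
      (u u' : ℝ → L2Field L),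
      0 < ν → 5 / 4 ≤ l → 0 ≤ ε → 0 ≤ ε' → (0 < ε ∨ ε = ε') → 0 ≤ R →
      IsWeakSolution ν l ε f u → InBall (ENNReal.ofReal R) u →
      IsWeakSolution ν l ε' f' u' → InBall (ENNReal.ofReal R) u' →
      ∀ t ∈ Icc 0 T,
        ENNReal.ofReal (‖u t - u' t‖ ^ 2) ≤
          ENNReal.ofReal (Real.exp (c * R ^ 4 / ν ^ 3 * T)) *
            (ENNReal.ofReal (‖u 0 - u' 0‖ ^ 2
                + 2 * T / (ν * (2 * Real.pi / L) ^ 2) * ‖f - f'‖ ^ 2)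
              + ENNReal.ofReal ((ε - ε') ^ 2 / (2 * ε)) *
                ∫⁻ s in Icc 0 T, sobSq l (u' s))) := by
  refine ⟨fun L _ ν l ε R hν hl hε hR => ⟨flow, isSemiflow_flow hν hl hε hR,
      continuous_flow hν hl hε hR, fun f u hu hb p hp t => flow_eq hν hl hε hR hu hb hp t⟩,
    fun L _ ν l R ε ε₀ f f₀ u u₀ hν hl hε hε₀ hR hu hb hu₀ hb₀ hεt hft h0 =>
      tendstoX0_of_weakSolution hν hl hε hε₀ hR hu hb hu₀ hb₀ hεt hft h0,
    -- The absolute constant is the 2 in the term 2R⁴/ν³ of `young_ball`.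
    2, two_pos, fun L _ ν l ε ε' R T f f' u u' hν hl hε hε' hεε' hR hu hb hu' hb' t ht => ?_⟩
  have e : ENNReal.ofReal R ^ 2 = ENNReal.ofReal (R ^ 2) := (ENNReal.ofReal_pow hR 2).symm
  exact gronwall_bound hν hε hεε' hR hu hu' (fun s hs => (hb s hs).trans_eq e)
    (fun s hs => (hb' s hs).trans_eq e) ht
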